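/- A \emph{permutation class} is a set of finite permutations closed downward under pattern containment. For a permutation class $\mathcal{C}$ let $\mathcal{C}_n$ be the set of its members of length $n$, and put \[ \overline{\mathrm{gr}}(\mathcal{C})=\limsup_{n\to\infty}\sqrt[n]{|\mathcal{C}_n|},\qquad \underline{\mathrm{gr}}(\mathcal{C})=\liminf_{n\to\infty}\sqrt[n]{|\mathcal{C}_n|} \] (values in $[0,\infty]$); if the two are equal, their common value is the growth rate $\mathrm{gr}(\mathcal{C})$, and one says that it exists. The class $\mathcal{C}$ is \emph{$\mathcal{G}$-griddable} for a permutation class $\mathcal{G}$ if there are $t,u$ such that for every $\pi\in\mathcal{C}$, of length $n$ say, there are column divisions $1=c_1\le\cdots\le c_{t+1}=n+1$ and row divisions $1=r_1\le\cdots\le r_{u+1}=n+1$ for which, for all $i,j$, the entries of $\pi$ with index in $[c_i,c_{i+1})$ and value in $[r_j,r_{j+1})$, if there are any, are order isomorphic to a member of $\mathcal{G}$. Two axis-parallel rectangles are \emph{independent} if both their $x$-axis and their $y$-axis projections are disjoint. The class $\mathcal{G}$ is \emph{concentrated} if there are natural numbers $q,r$ such that for every $\pi\in\mathcal{G}$ and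 every horizontal or vertical line $L$ through the plot of $\pi$ that passes through no entry of $\pi$, all but at most $r$ of the entries of $\pi$ can be covered by $q$ pairwise independent axis-parallel rectangles that do not intersect $L$. \textbf{Corollary.} Suppose that the permutation class $\mathcal{C}$ is $\mathcal{G}$-griddable for a concentrated permutation class $\mathcal{G}$ and that $\underline{\mathrm{gr}}(\mathcal{C})<1+\sqrt{2}$. Then either $\mathrm{gr}(\mathcal{C})$ exists and is an integer, or $\overline{\mathrm{gr}}(\mathcal{C})=\overline{\mathrm{gr}}(\mathcal{D})$ for some permutation class $\mathcal{D}\subseteq\mathcal{G}$. -/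

import Mathlib

open Filter
open scoped ENNReal

/-- The finite permutations of all lengths (entries and positions are numbered from `0`). -/
abbrev FinPerm : Type := Σ n : ℕ, Equiv.Perm (Fin n)

/-- `σ.ContainedIn π`: some subsequence of `π` is order isomorphic to `σ`. -/
def FinPerm.ContainedIn (σ π : FinPerm) : Prop :=
  ∃ f : Fin σ.1 ↪o Fin π.1, ∀ i j, σ.2 i < σ.2 j ↔ π.2 (f i) < π.2 (f j)

/-- A permutation class: a set of finite permutations closed downward under containment. -/
structure PermClass where
  carrier : Set FinPerm
  down_closed : ∀ σ π : FinPerm, σ.ContainedIn π → π ∈ carrier → σ ∈ carrier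

namespace PermClass

/-- `C.speed n` is the number of permutations of length `n` in `C`. -/
noncomputable def speed (C : PermClass) (n : ℕ) : ℕ :=
  {π : Equiv.Perm (Fin n) | (⟨n, π⟩ : FinPerm) ∈ C.carrier}.ncard

/-- `limsup` of the `n`-th root of the number of members of length `n`, in `[0, ∞]`. -/
noncomputable def upperGrowthRate (C : PermClass) : ℝ≥0∞ :=
  limsup (fun n : ℕ => (C.speed n : ℝ≥0∞) ^ (1 / (n : ℝ))) atTop

/-- `liminf` of the `n`-th root of the number of members of length `n`, in `[0, ∞]`. -/
noncomputable def lowerGrowthRate (C : PermClass) : ℝ≥0∞ :=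
  liminf (fun n : ℕ => (C.speed n : ℝ≥0∞) ^ (1 / (n : ℝ))) atTop

/-- The growth rate of `C` exists and equals `g`. -/
def HasGrowthRate (C : PermClass) (g : ℝ≥0∞) : Prop :=
  C.lowerGrowthRate = g ∧ C.upperGrowthRate = g

end PermClass

/-- The permutation order isomorphic to the subsequence of `π` at the indices in `S`. -/
def patternOn {n : ℕ} (π : Equiv.Perm (Fin n)) (S : Finset (Fin n)) :
    Equiv.Perm (Fin S.card) :=
  ((S.orderIsoOfFin rfl).toEquiv.trans
    (π.subtypeEquiv (q := fun b => b ∈ S.map π.toEmbedding) (fun a => by simp))).trans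
    ((S.map π.toEmbedding).orderIsoOfFin (S.card_map π.toEmbedding)).toEquiv.symm

/-- An axis-parallel rectangle, up to the entries it can enclose: the indices in
`[left, right)` times the values in `[bottom, top)`. -/
structure Rect where
  left : ℕ
  right : ℕ
  bottom : ℕ
  top : ℕ

/-- Both the `x`-axis and the `y`-axis projections are disjoint. -/
def Rect.Independent (R R' : Rect) : Prop :=
  Disjoint (Set.Ico R.left R.right) (Set.Ico R'.left R'.right) ∧
    Disjoint (Set.Ico R.bottom R.top) (Set.Ico R'.bottom R'.top)

/-- The indices of the entries of `π` that lie in `R`. -/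
def Rect.entries (R : Rect) {n : ℕ} (π : Equiv.Perm (Fin n)) : Finset (Fin n) :=
  Finset.univ.filter fun i =>
    (R.left ≤ (i : ℕ) ∧ (i : ℕ) < R.right) ∧ (R.bottom ≤ (π i : ℕ) ∧ (π i : ℕ) < R.top)

/-- The vertical line `x = k - 1/2` (between index `k - 1` and index `k`) misses `R`. -/
def Rect.MissesVertical (R : Rect) (k : ℕ) : Prop := R.right ≤ k ∨ k ≤ R.left

/-- The horizontal line `y = k - 1/2` (between value `k - 1` and value `k`) misses `R`. -/
def Rect.MissesHorizontal (R : Rect) (k : ℕ) : Prop := R.top ≤ k ∨ k ≤ R.bottom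

/-- All but at most `r` entries of `π` can be covered by `q` pairwise independent rectangles
that all satisfy `P`. (Rectangles may be empty, so `q` means "at most `q`".) -/
def CoverableBy (q r : ℕ) {n : ℕ} (π : Equiv.Perm (Fin n)) (P : Rect → Prop) : Prop :=
  ∃ R : Fin q → Rect, (∀ a b, a ≠ b → (R a).Independent (R b)) ∧ (∀ a, P (R a)) ∧
    (Finset.univ.filter fun i : Fin n => ∀ a, i ∉ (R a).entries π).card ≤ r

/-- `π` is `(q, r)`-concentrated: for each vertical or horizontal line that avoids the entries,
all but at most `r` entries can be covered by `q` independent rectangles missing the line. -/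
def FinPerm.IsConcentrated (q r : ℕ) (π : FinPerm) : Prop :=
  ∀ k : ℕ, CoverableBy q r π.2 (fun R => R.MissesVertical k) ∧
    CoverableBy q r π.2 (fun R => R.MissesHorizontal k)

/-- A set of permutations is concentrated if, for some `q` and `r`, all its members are
`(q, r)`-concentrated. -/
def Concentrated (X : Set FinPerm) : Prop :=
  ∃ q r : ℕ, ∀ π ∈ X, π.IsConcentrated q r

/-- `c` and `d` are the column and row divisions of an `M`-gridding of `π`, where `M` is a matrix
with `t` columns and `u` rows, indexed in Cartesian coordinates. A cell without entries
is always admitted, also where the entry of `M` is the empty class. -/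
structure IsGridding {t u : ℕ} (M : Fin t → Fin u → PermClass) (π : FinPerm)
    (c : Fin (t + 1) → ℕ) (d : Fin (u + 1) → ℕ) : Prop where
  col_mono : Monotone c
  col_first : c 0 = 0
  col_last : c (Fin.last t) = π.1
  row_mono : Monotone d
  row_first : d 0 = 0
  row_last : d (Fin.last u) = π.1
  cell : ∀ (i : Fin t) (j : Fin u) (S : Finset (Fin π.1)),
    S = (Rect.mk (c i.castSucc) (c i.succ) (d j.castSucc) (d j.succ)).entries π.2 →
      S = ∅ ∨ (⟨S.card, patternOn π.2 S⟩ : FinPerm) ∈ (M i j).carrier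

/-- The permutations that have an `M`-gridding. -/
def gridClass {t u : ℕ} (M : Fin t → Fin u → PermClass) : Set FinPerm :=
  {π | ∃ c d, IsGridding M π c d}

/-- `C` is `G`-griddable: `C` is contained in the grid class of a finite matrix all of whose
entries equal `G`. -/
def Griddable (C G : PermClass) : Prop :=
  ∃ t u : ℕ, C.carrier ⊆ gridClass (fun (_ : Fin t) (_ : Fin u) => G)

/-! The class `D` is always `inter C G`, and the integer, where one is needed, is 2. The proof rests
on two thresholds, 2 and 1 + √2. At each of them, certain configurations, repeated along `n` stacked
slabs of a single member of `C`, produce many members of `C` of length `n`. A lower growth rate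
below the threshold supplies one `n` at which the speed is too small for this, and that fixed `n`
bounds the number of repetitions in every member of `C`, whatever its length.

Threshold 2. If `n` stacked slabs all meet two cells in different columns, then picking a point of
one cell or of the other in each slab encodes all binary words of length `n` (`two_pow_le_speed`).
Otherwise a greedy choice finds at most `2 * n` lines such that every slab meeting both cells is
crossed by one of them (`exists_stacked_or_lines`). Concentration converts boundedly many lines into
boundedly many independent pieces of each cell that no line cuts, with boundedly many points left
over (`exists_split`); pieces of different cells are then independent as well
(`exists_lines_indep`). So a member of `C` is, up to boundedly many points, an independent union of
boundedly many patterns from `inter C G`. The positions of the pieces can be chosen in only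
polynomially many ways, and therefore `C` grows no faster than `inter C G`
(`upperGrowthRate_le_of_decomposable`).

Threshold 1 + √2. This is the growth rate of the words over 0, 1, 21, which satisfy the Pell
recurrence. Three configurations encode these words: slabs that meet three cells in different
columns, a cell that interacts with one cell in its row and another in its column (both by
`card_pellWords_le_of_three_cells`), and a non-monotone cell that interacts with another cell
(`card_pellWords_le_of_inverted_pairs`). In the last two, Ramsey's theorem and concentration first
arrange the slabs monotonically (`exists_arranged`). Once lines slice all three configurations,
interacting pieces are monotone and each piece interacts with at most one other cell
(`exists_lines_pairs`). A component is then a pattern from `inter C G` or an interleaving of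
monotone pieces of two cells, and the interleavings of length `n` number at most `2 ^ n` up to a
polynomial factor. Hence the upper growth rate of `C` is at most the maximum of 2 and that of `inter
C G`. When the lower growth rate is at least 2, either that maximum is 2 and the growth rate is 2,
or `C` and `inter C G` have the same upper growth rate. -/

namespace GridGrowth

/-! ### Patterns -/

theorem patternOn_lt_iff {n : ℕ} (π : Equiv.Perm (Fin n)) (S : Finset (Fin n))
    (a b : Fin S.card) :
    patternOn π S a < patternOn π S b ↔
      π (S.orderEmbOfFin rfl a) < π (S.orderEmbOfFin rfl b) := by
  unfold patternOn
  exact ((S.map π.toEmbedding).orderIsoOfFin (S.card_map π.toEmbedding)).symm.lt_iff_lt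

theorem patternOn_containedIn {n : ℕ} (π : Equiv.Perm (Fin n)) (S : Finset (Fin n)) :
    FinPerm.ContainedIn ⟨S.card, patternOn π S⟩ ⟨n, π⟩ :=
  ⟨S.orderEmbOfFin rfl, fun i j => patternOn_lt_iff π S i j⟩

theorem patternOn_containedIn_of_subset {n : ℕ} (π : Equiv.Perm (Fin n)) {S T : Finset (Fin n)}
    (h : S ⊆ T) :
    FinPerm.ContainedIn ⟨S.card, patternOn π S⟩ ⟨T.card, patternOn π T⟩ := by
  have hm : ∀ a : Fin S.card, ∃ b : Fin T.card, T.orderEmbOfFin rfl b = S.orderEmbOfFin rfl a := by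
    intro a
    have : S.orderEmbOfFin rfl a ∈ Set.range (T.orderEmbOfFin rfl) := by
      rw [Finset.range_orderEmbOfFin]
      exact h (Finset.orderEmbOfFin_mem S rfl a)
    exact this
  choose f hf using hm
  have hmono : StrictMono f := by
    intro a b hab
    rw [← (T.orderEmbOfFin rfl).lt_iff_lt, hf, hf]
    exact (S.orderEmbOfFin rfl).lt_iff_lt.2 hab
  refine ⟨OrderEmbedding.ofStrictMono f hmono, fun i j => ?_⟩
  simp only [patternOn_lt_iff, OrderEmbedding.coe_ofStrictMono, hf]

theorem lt_iff_of_patternOn_eq {n : ℕ} {π π' : Equiv.Perm (Fin n)} {S : Finset (Fin n)}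
    (h : patternOn π S = patternOn π' S) {i j : Fin n} (hi : i ∈ S) (hj : j ∈ S) :
    π i < π j ↔ π' i < π' j := by
  have hr : ∀ i ∈ S, ∃ a, S.orderEmbOfFin rfl a = i := by
    intro i hi
    have : i ∈ Set.range (S.orderEmbOfFin rfl) := by
      rw [Finset.range_orderEmbOfFin]; exact hi
    exact this
  obtain ⟨a, rfl⟩ := hr i hi
  obtain ⟨b, rfl⟩ := hr j hj
  rw [← patternOn_lt_iff, ← patternOn_lt_iff, h]

/-- A permutation listing points with injective coordinates `x`, `y`, in the order of `x`. -/
theorem exists_perm_of_points {n : ℕ} (x y : Fin n → ℕ) (hx : Function.Injective x)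
    (hy : Function.Injective y) :
    ∃ (a : Equiv.Perm (Fin n)) (σ : Equiv.Perm (Fin n)),
      StrictMono (x ∘ a) ∧ ∀ i j, σ i < σ j ↔ y (a i) < y (a j) := by
  have hsx : StrictMono (x ∘ Tuple.sort x) :=
    (Tuple.monotone_sort x).strictMono_of_injective (hx.comp (Equiv.injective _))
  have hsy : StrictMono (y ∘ Tuple.sort y) :=
    (Tuple.monotone_sort y).strictMono_of_injective (hy.comp (Equiv.injective _))
  refine ⟨Tuple.sort x, (Tuple.sort x).trans (Tuple.sort y).symm, hsx, fun i j => ?_⟩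
  rw [← hsy.lt_iff_lt]
  simp

/-- `x` and `y` are the two coordinates of the plot of `π`, in either order. -/
def Coords {N : ℕ} (π : Equiv.Perm (Fin N)) (x y : Fin N → ℕ) : Prop :=
  (x = (fun i : Fin N => (i : ℕ)) ∧ y = fun i : Fin N => (π i : ℕ)) ∨
    (y = (fun i : Fin N => (i : ℕ)) ∧ x = fun i : Fin N => (π i : ℕ))

theorem Coords.symm {N : ℕ} {π : Equiv.Perm (Fin N)} {x y : Fin N → ℕ} (h : Coords π x y) :
    Coords π y x := Or.symm h

theorem Coords.injective {N : ℕ} {π : Equiv.Perm (Fin N)} {x y : Fin N → ℕ} (h : Coords π x y) :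
    Function.Injective x := by
  rcases h with ⟨rfl, -⟩ | ⟨-, rfl⟩
  · exact Fin.val_injective
  · exact Fin.val_injective.comp π.injective

theorem ncard_speed (C : PermClass) (n : ℕ) (W : Finset (Equiv.Perm (Fin n)))
    (h : ∀ σ ∈ W, (⟨n, σ⟩ : FinPerm) ∈ C.carrier) : W.card ≤ C.speed n := by
  unfold PermClass.speed
  rw [← Set.ncard_coe_finset]
  exact Set.ncard_le_ncard (fun σ hσ => h σ hσ) (Set.toFinite _)

/-- If point sets in one member of `C`, indexed by `W`, are determined by their order type and by
two bounded statistics, then `W` is at most polynomially larger than `C.speed n`. -/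
theorem card_le_speed {α : Type} (C : PermClass) {N : ℕ} (π : Equiv.Perm (Fin N))
    (hπ : (⟨N, π⟩ : FinPerm) ∈ C.carrier) {x y : Fin N → ℕ} (hxy : Coords π x y) (n : ℕ)
    (W : Finset α) (p : α → Fin n → Fin N) (hp : ∀ w ∈ W, Function.Injective (p w))
    (d : α → ℕ × ℕ) (hd : ∀ w ∈ W, (d w).1 ≤ n ∧ (d w).2 ≤ n)
    (hinj : ∀ w ∈ W, ∀ v ∈ W, d w = d v → ∀ e : Equiv.Perm (Fin n),
      (∀ k l, x (p w k) < x (p w l) ↔ x (p v (e k)) < x (p v (e l))) →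
      (∀ k l, y (p w k) < y (p w l) ↔ y (p v (e k)) < y (p v (e l))) → w = v) :
    W.card ≤ (n + 1) ^ 2 * C.speed n := by
  classical
  have key : ∀ (w : α), ∃ (a σ : Equiv.Perm (Fin n)), w ∈ W →
      StrictMono (fun k => p w (a k)) ∧ ∀ i j, σ i < σ j ↔ π (p w (a i)) < π (p w (a j)) := by
    intro w
    by_cases hw : w ∈ W
    · obtain ⟨a, σ, h1, h2⟩ := exists_perm_of_points (fun k => (p w k : ℕ))
        (fun k => (π (p w k) : ℕ)) (Fin.val_injective.comp (hp w hw))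
        (Fin.val_injective.comp (π.injective.comp (hp w hw)))
      exact ⟨a, σ, fun _ => ⟨h1, h2⟩⟩
    · exact ⟨1, 1, fun h => absurd h hw⟩
  choose a σ hσ using key
  have hmem : ∀ w ∈ W, (⟨n, σ w⟩ : FinPerm) ∈ C.carrier := by
    intro w hw
    refine C.down_closed _ _ ⟨OrderEmbedding.ofStrictMono _ (hσ w hw).1, ?_⟩ hπ
    intro i j
    exact (hσ w hw).2 i j
  -- The two statistics take at most `(n + 1) ^ 2` values, and together with the pattern `σ w` they
  -- determine `w`: equal patterns give a bijection `e` between the two point sets that respects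
  -- both coordinates.
  have hcard : W.card ≤ ((Finset.range (n + 1) ×ˢ Finset.range (n + 1)) ×ˢ W.image σ).card := by
    refine Finset.card_le_card_of_injOn (fun w => (d w, σ w)) ?_ ?_
    · intro w hw
      have := hd w hw
      simp only [Finset.coe_product, Set.mem_prod, Finset.mem_coe, Finset.mem_range]
      exact ⟨⟨by omega, by omega⟩, Finset.mem_image_of_mem _ hw⟩
    · intro w hw v hv hwv
      simp only [Prod.mk.injEq] at hwv
      have hw' := hσ w hw
      have hv' := hσ v hv
      have H1 : ∀ k l, p w k < p w l ↔ p v (a v ((a w).symm k)) < p v (a v ((a w).symm l)) := by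
        intro k l
        have e1 := hw'.1.lt_iff_lt (a := (a w).symm k) (b := (a w).symm l)
        have e2 := hv'.1.lt_iff_lt (a := (a w).symm k) (b := (a w).symm l)
        simp only [Equiv.apply_symm_apply] at e1
        rw [e1, e2]
      have H2 : ∀ k l, π (p w k) < π (p w l) ↔
          π (p v (a v ((a w).symm k))) < π (p v (a v ((a w).symm l))) := by
        intro k l
        have e1 := hw'.2 ((a w).symm k) ((a w).symm l)
        have e2 := hv'.2 ((a w).symm k) ((a w).symm l)
        simp only [Equiv.apply_symm_apply] at e1
        rw [← e1, ← e2, hwv.2]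
      refine hinj w hw v hv hwv.1 ((a w).symm.trans (a v)) ?_ ?_
      · rcases hxy with ⟨rfl, rfl⟩ | ⟨rfl, rfl⟩
        · exact H1
        · exact H2
      · rcases hxy with ⟨rfl, rfl⟩ | ⟨rfl, rfl⟩
        · exact H2
        · exact H1
  refine hcard.trans ?_
  rw [Finset.card_product, Finset.card_product, Finset.card_range, ← sq]
  refine Nat.mul_le_mul_left _ (ncard_speed C n _ ?_)
  intro τ hτ
  obtain ⟨w, hw, rfl⟩ := Finset.mem_image.1 hτ
  exact hmem w hw

/-! ### Growth rates -/

theorem eventually_poly_mul_pow_le (k : ℕ) (c ρ ρ' : ℝ) (hρ : 0 < ρ) (h : ρ < ρ') :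
    ∀ᶠ n : ℕ in atTop, c * (n + 1 : ℝ) ^ k * ρ ^ n ≤ ρ' ^ n := by
  have hlim : Tendsto (fun n : ℕ => (n : ℝ) ^ k * (ρ / ρ') ^ n) atTop (nhds 0) :=
    tendsto_pow_const_mul_const_pow_of_lt_one k (div_pos hρ (hρ.trans h)).le
      ((div_lt_one (hρ.trans h)).2 h)
  have h2 : Tendsto (fun n : ℕ => |c| * 2 ^ k * ((n : ℝ) ^ k * (ρ / ρ') ^ n)) atTop (nhds 0) := by
    simpa using hlim.const_mul (|c| * 2 ^ k)
  filter_upwards [h2.eventually (gt_mem_nhds zero_lt_one), eventually_ge_atTop 1] with n hn h1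
  have hρ'n : 0 < ρ' ^ n := pow_pos (hρ.trans h) n
  rw [div_pow] at hn
  have h1' : (1 : ℝ) ≤ n := by exact_mod_cast h1
  have h3 : (n + 1 : ℝ) ^ k ≤ 2 ^ k * (n : ℝ) ^ k := by
    rw [← mul_pow]; gcongr; linarith
  have h4 : |c| * 2 ^ k * ((n : ℝ) ^ k * (ρ ^ n / ρ' ^ n)) =
      (|c| * (2 ^ k * (n : ℝ) ^ k) * ρ ^ n) / ρ' ^ n := by ring
  rw [h4, div_lt_one hρ'n] at hn
  refine le_trans ?_ hn.le
  gcongr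
  exact le_abs_self c

theorem ofReal_rpow_natCast_inv (a : ℝ) (ha : 0 ≤ a) (n : ℕ) (hn : n ≠ 0) :
    (ENNReal.ofReal (a ^ n)) ^ (1 / (n : ℝ)) = ENNReal.ofReal a := by
  rw [ENNReal.ofReal_rpow_of_nonneg (by positivity) (by positivity), one_div,
    Real.pow_rpow_inv_natCast ha hn]

theorem natCast_rpow_le_iff (m n : ℕ) (hn : n ≠ 0) (a : ℝ) (ha : 0 ≤ a) :
    (m : ℝ≥0∞) ^ (1 / (n : ℝ)) ≤ ENNReal.ofReal a ↔ (m : ℝ) ≤ a ^ n := by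
  have hpos : 0 < 1 / (n : ℝ) := by positivity
  rw [← ofReal_rpow_natCast_inv a ha n hn, ENNReal.rpow_le_rpow_iff hpos,
    ← ENNReal.ofReal_natCast, ENNReal.ofReal_le_ofReal_iff (by positivity)]

theorem le_natCast_rpow_iff (m n : ℕ) (hn : n ≠ 0) (a : ℝ) (ha : 0 ≤ a) :
    ENNReal.ofReal a ≤ (m : ℝ≥0∞) ^ (1 / (n : ℝ)) ↔ a ^ n ≤ (m : ℝ) := by
  have hpos : 0 < 1 / (n : ℝ) := by positivity
  rw [← ofReal_rpow_natCast_inv a ha n hn, ENNReal.rpow_le_rpow_iff hpos,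
    ← ENNReal.ofReal_natCast, ENNReal.ofReal_le_ofReal_iff (by positivity)]

/-- Polynomial factors do not affect growth rates. The contrapositive is what matters: a lower
growth rate below `ρ` yields a single length at which the bound fails. The factor `(n + 1) ^ 2` is
the loss in `card_le_speed`. -/
theorem le_lowerGrowthRate (C : PermClass) (c ρ : ℝ) (hc : 0 < c) (hρ : 0 < ρ)
    (h : ∀ n : ℕ, c * ρ ^ n ≤ (n + 1 : ℝ) ^ 2 * C.speed n) :
    ENNReal.ofReal ρ ≤ C.lowerGrowthRate := by
  refine le_of_forall_lt fun b hb => ?_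
  obtain ⟨b', hb1, hb2⟩ := exists_between hb
  have hfin : b' ≠ ⊤ := (hb2.trans_le le_top).ne
  have hb0 : 0 < b'.toReal := ENNReal.toReal_pos (bot_le.trans_lt hb1).ne' hfin
  have hb3 : b'.toReal < ρ := by
    rw [← ENNReal.ofReal_toReal hfin] at hb2
    exact (ENNReal.ofReal_lt_ofReal_iff hρ).1 hb2
  refine hb1.trans_le (le_liminf_of_le (by isBoundedDefault) ?_)
  filter_upwards [eventually_poly_mul_pow_le 2 (1 / c) b'.toReal ρ hb0 hb3,
    eventually_ge_atTop 1] with n hn h1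
  rw [← ENNReal.ofReal_toReal hfin, le_natCast_rpow_iff _ _ (by omega) _ hb0.le]
  have h2 := h n
  have hn2 : (0 : ℝ) < (n + 1 : ℝ) ^ 2 := by positivity
  have h3 : (n + 1 : ℝ) ^ 2 * b'.toReal ^ n ≤ c * ρ ^ n := by
    calc (n + 1 : ℝ) ^ 2 * b'.toReal ^ n = c * (1 / c * (n + 1 : ℝ) ^ 2 * b'.toReal ^ n) := by
          field_simp
      _ ≤ c * ρ ^ n := by gcongr
  exact le_of_mul_le_mul_left (h3.trans h2) hn2

theorem upperGrowthRate_le (C : PermClass) (k : ℕ) (c ρ : ℝ) (hρ : 0 < ρ)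
    (h : ∀ n : ℕ, (C.speed n : ℝ) ≤ c * (n + 1 : ℝ) ^ k * ρ ^ n) :
    C.upperGrowthRate ≤ ENNReal.ofReal ρ := by
  refine le_of_forall_gt fun b hb => ?_
  obtain ⟨b', hb1, hb2⟩ := exists_between hb
  have hfin : b' ≠ ⊤ := (hb2.trans_le le_top).ne
  have hb3 : ρ < b'.toReal := by
    rw [← ENNReal.ofReal_toReal hfin] at hb1
    exact (ENNReal.ofReal_lt_ofReal_iff_of_nonneg hρ.le).1 hb1
  refine lt_of_le_of_lt (limsup_le_of_le (by isBoundedDefault) ?_) hb2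
  filter_upwards [eventually_poly_mul_pow_le k c ρ b'.toReal hρ hb3,
    eventually_ge_atTop 1] with n hn h1
  rw [← ENNReal.ofReal_toReal hfin, natCast_rpow_le_iff _ _ (by omega) _ (hρ.trans hb3).le]
  exact (h n).trans hn

theorem exists_bound_of_eventually_le {f : ℕ → ℝ} (hf : ∀ n, 0 ≤ f n) {ρ : ℝ} (hρ : 0 < ρ)
    (h : ∀ᶠ n in atTop, f n ≤ ρ ^ n) : ∃ c : ℝ, 1 ≤ c ∧ ∀ n : ℕ, f n ≤ c * ρ ^ n := by
  obtain ⟨n₀, hn₀⟩ := eventually_atTop.1 h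
  have hf' : ∀ m, 0 ≤ f m / ρ ^ m := fun m => div_nonneg (hf m) (by positivity)
  have hs0 : 0 ≤ ∑ m ∈ Finset.range n₀, f m / ρ ^ m := Finset.sum_nonneg fun m _ => hf' m
  refine ⟨1 + ∑ m ∈ Finset.range n₀, f m / ρ ^ m, by linarith, fun n => ?_⟩
  by_cases hn : n < n₀
  · have h1 : f n / ρ ^ n ≤ ∑ m ∈ Finset.range n₀, f m / ρ ^ m :=
      Finset.single_le_sum (f := fun m => f m / ρ ^ m) (fun m _ => hf' m) (Finset.mem_range.2 hn)
    rw [← div_le_iff₀ (by positivity)]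
    linarith
  · exact (hn₀ n (by omega)).trans (le_mul_of_one_le_left (by positivity) (by linarith))

theorem exists_speed_le (C : PermClass) (ρ : ℝ) (hρ : 0 < ρ)
    (h : C.upperGrowthRate < ENNReal.ofReal ρ) :
    ∃ c : ℝ, 1 ≤ c ∧ ∀ n : ℕ, (C.speed n : ℝ) ≤ c * ρ ^ n := by
  refine exists_bound_of_eventually_le (fun n => Nat.cast_nonneg _) hρ ?_
  filter_upwards [eventually_lt_of_limsup_lt h (by isBoundedDefault), eventually_ge_atTop 1]
    with n hn h1
  exact (natCast_rpow_le_iff _ _ (by omega) _ hρ.le).1 hn.le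

theorem speed_mono {C D : PermClass} (h : D.carrier ⊆ C.carrier) (n : ℕ) :
    D.speed n ≤ C.speed n :=
  Set.ncard_le_ncard (fun _ hσ => h hσ) (Set.toFinite _)

theorem upperGrowthRate_mono {C D : PermClass} (h : D.carrier ⊆ C.carrier) :
    D.upperGrowthRate ≤ C.upperGrowthRate := by
  refine limsup_le_limsup (Eventually.of_forall fun n => ?_)
  exact ENNReal.rpow_le_rpow (by exact_mod_cast speed_mono h n) (by positivity)

theorem lowerGrowthRate_le_upperGrowthRate (C : PermClass) :
    C.lowerGrowthRate ≤ C.upperGrowthRate :=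
  liminf_le_limsup

/-! ### Words -/

/-- The word `w` preceded by the letter `c`. -/
def consWord (c : Fin 3) (w : ℕ → Fin 3) : ℕ → Fin 3
  | 0 => c
  | k + 1 => w k

theorem consWord_injective (c : Fin 3) : Function.Injective (consWord c) := by
  intro w v h
  funext k
  exact congrFun h (k + 1)

open Classical in
/-- The words of length `n` over `0`, `1`, `2` in which every `2` is followed by a `1`
(continued by zeros). -/
noncomputable def pellWords : ℕ → Finset (ℕ → Fin 3)
  | 0 => {fun _ => 0}
  | 1 => {consWord 0 (fun _ => 0), consWord 1 (fun _ => 0)}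
  | n + 2 => ((pellWords (n + 1)).image (consWord 0) ∪ (pellWords (n + 1)).image (consWord 1)) ∪
      (pellWords n).image (consWord 2 ∘ consWord 1)

open Classical in
theorem pellWords_spec : ∀ (n : ℕ), ∀ w ∈ pellWords n,
    (∀ k, n ≤ k → w k = 0) ∧ ∀ k, w k = 2 → k + 1 < n ∧ w (k + 1) = 1
  | 0, w, hw => by
    rw [pellWords, Finset.mem_singleton] at hw
    subst hw
    exact ⟨fun _ _ => rfl, fun k h => absurd h (by simp)⟩
  | 1, w, hw => by
    rw [pellWords, Finset.mem_insert, Finset.mem_singleton] at hw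
    rcases hw with rfl | rfl
    · refine ⟨fun k hk => ?_, fun k h => ?_⟩
      · obtain ⟨k, rfl⟩ := Nat.exists_eq_succ_of_ne_zero (by omega : k ≠ 0)
        rfl
      · rcases k with _ | k <;> simp [consWord] at h
    · refine ⟨fun k hk => ?_, fun k h => ?_⟩
      · obtain ⟨k, rfl⟩ := Nat.exists_eq_succ_of_ne_zero (by omega : k ≠ 0)
        rfl
      · rcases k with _ | k <;> simp [consWord] at h
  | n + 2, w, hw => by
    rw [pellWords, Finset.mem_union, Finset.mem_union, Finset.mem_image, Finset.mem_image,
      Finset.mem_image] at hw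
    have step : ∀ c : Fin 3, c ≠ 2 → ∀ v ∈ pellWords (n + 1),
        (∀ k, n + 2 ≤ k → consWord c v k = 0) ∧
          ∀ k, consWord c v k = 2 → k + 1 < n + 2 ∧ consWord c v (k + 1) = 1 := by
      intro c hc v hv
      have ih := pellWords_spec (n + 1) v hv
      refine ⟨fun k hk => ?_, fun k h => ?_⟩
      · obtain ⟨k, rfl⟩ := Nat.exists_eq_succ_of_ne_zero (by omega : k ≠ 0)
        exact ih.1 k (by omega)
      · rcases k with _ | k
        · exact absurd h hc
        · have := ih.2 k h
          exact ⟨by omega, this.2⟩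
    rcases hw with (⟨v, hv, rfl⟩ | ⟨v, hv, rfl⟩) | ⟨v, hv, rfl⟩
    · exact step 0 (by simp) v hv
    · exact step 1 (by simp) v hv
    · have ih := pellWords_spec n v hv
      refine ⟨fun k hk => ?_, fun k h => ?_⟩
      · obtain ⟨k, rfl⟩ := Nat.exists_eq_add_of_le (by omega : 2 ≤ k)
        rw [add_comm]
        exact ih.1 k (by omega)
      · rcases k with _ | _ | k
        · exact ⟨by omega, rfl⟩
        · simp [consWord] at h
        · have := ih.2 k h
          exact ⟨by omega, this.2⟩

open Classical in
theorem card_pellWords_add_two (n : ℕ) :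
    (pellWords (n + 2)).card = 2 * (pellWords (n + 1)).card + (pellWords n).card := by
  have hd : ∀ {c d : Fin 3} {w v : ℕ → Fin 3}, consWord c w = consWord d v → c = d :=
    fun h => congrFun h 0
  rw [pellWords, Finset.card_union_of_disjoint, Finset.card_union_of_disjoint,
    Finset.card_image_of_injective _ (consWord_injective 0),
    Finset.card_image_of_injective _ (consWord_injective 1),
    Finset.card_image_of_injective _ ((consWord_injective 2).comp (consWord_injective 1))]
  · ring
  · rw [Finset.disjoint_left]
    intro w h1 h2
    obtain ⟨v, -, rfl⟩ := Finset.mem_image.1 h1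
    obtain ⟨u, -, h⟩ := Finset.mem_image.1 h2
    exact absurd (hd h) (by simp)
  · rw [Finset.disjoint_left]
    intro w h1 h2
    obtain ⟨u, -, rfl⟩ := Finset.mem_image.1 h2
    rcases Finset.mem_union.1 h1 with h1 | h1
    · obtain ⟨v, -, h⟩ := Finset.mem_image.1 h1
      exact absurd (hd h) (by simp)
    · obtain ⟨v, -, h⟩ := Finset.mem_image.1 h1
      exact absurd (hd h) (by simp)

open Classical in
-- The number 1 + √2 is a root of `X ^ 2 = 2 * X + 1`, the characteristic equation of the
-- recurrence; the constant 1/2 accommodates the initial values 1 and 2.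
theorem le_card_pellWords : ∀ n : ℕ, 1 / 2 * (1 + √2) ^ n ≤ ((pellWords n).card : ℝ)
  | 0 => by simp [pellWords]; norm_num
  | 1 => by
    have h2 : (pellWords 1).card = 2 := by
      rw [pellWords, Finset.card_pair]
      intro h
      exact absurd (congrFun h 0) (by simp [consWord])
    rw [h2]
    have : √2 ≤ 2 := by
      rw [Real.sqrt_le_left (by norm_num)]; norm_num
    push_cast
    linarith
  | n + 2 => by
    rw [card_pellWords_add_two]
    have h1 := le_card_pellWords n
    have h2 := le_card_pellWords (n + 1)
    have h3 : (1 + √2) ^ 2 = 2 * (1 + √2) + 1 := by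
      have := Real.sq_sqrt (show (0 : ℝ) ≤ 2 by norm_num)
      linear_combination this
    push_cast
    calc 1 / 2 * (1 + √2) ^ (n + 2) = 2 * (1 / 2 * (1 + √2) ^ (n + 1)) + 1 / 2 * (1 + √2) ^ n := by
          rw [pow_add, h3]; ring
      _ ≤ _ := by linarith

/-! ### Lower bounds for the speed -/

/-- Two initial segments of the same size correspond under an order isomorphism. -/
theorem mem_iff_of_initial {n : ℕ} {f g : Fin n → ℕ} {e : Equiv.Perm (Fin n)}
    (hfg : ∀ k l, f k < f l ↔ g (e k) < g (e l)) {T T' : Finset (Fin n)}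
    (hT : ∀ k ∈ T, ∀ l, l ∉ T → f k < f l) (hT' : ∀ k ∈ T', ∀ l, l ∉ T' → g k < g l)
    (hc : T.card = T'.card) (k : Fin n) : k ∈ T ↔ e k ∈ T' := by
  have hm : T.map e.toEmbedding = T' := by
    by_contra hne
    have hcard : (T.map e.toEmbedding).card = T'.card := by rw [Finset.card_map, hc]
    have h1 : ∃ a ∈ T.map e.toEmbedding, a ∉ T' := by
      by_contra! h
      exact hne (Finset.eq_of_subset_of_card_le h hcard.ge)
    have h2 : ∃ b ∈ T', b ∉ T.map e.toEmbedding := by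
      by_contra! h
      exact hne (Finset.eq_of_subset_of_card_le h hcard.le).symm
    obtain ⟨a, ha, ha'⟩ := h1
    obtain ⟨b, hb, hb'⟩ := h2
    obtain ⟨a, ha0, rfl⟩ := Finset.mem_map.1 ha
    have hb0 : e.symm b ∉ T := fun h =>
      hb' (Finset.mem_map.2 ⟨_, h, by simp⟩)
    have h3 := (hfg _ _).1 (hT a ha0 _ hb0)
    have h4 := hT' b hb _ ha'
    simp at h3 h4
    omega
  rw [← hm]
  simp

theorem mem_iff_of_final {n : ℕ} {f g : Fin n → ℕ} {e : Equiv.Perm (Fin n)}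
    (hfg : ∀ k l, f k < f l ↔ g (e k) < g (e l)) {T T' : Finset (Fin n)}
    (hT : ∀ k ∈ T, ∀ l, l ∉ T → f l < f k) (hT' : ∀ k ∈ T', ∀ l, l ∉ T' → g l < g k)
    (hc : T.card = T'.card) (k : Fin n) : k ∈ T ↔ e k ∈ T' := by
  have := mem_iff_of_initial hfg (T := Tᶜ) (T' := T'ᶜ) (fun k hk l hl => ?_) (fun k hk l hl => ?_)
    (by rw [Finset.card_compl, Finset.card_compl, hc]) k
  · simpa [not_iff_not] using this
  · simp only [Finset.mem_compl, not_not] at hk hl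
    exact hT l hl k hk
  · simp only [Finset.mem_compl, not_not] at hk hl
    exact hT' l hl k hk

theorem perm_eq_one_of_lt_iff {n : ℕ} {e : Equiv.Perm (Fin n)}
    (h : ∀ k l, k < l → e k < e l) : e = 1 := by
  have hm : StrictMono e := fun k l => h k l
  have h1 : hm.orderIsoOfSurjective e e.surjective = OrderIso.refl (Fin n) := Subsingleton.elim _ _
  ext k
  have := congrArg (fun o : Fin n ≃o Fin n => ((o k : Fin n) : ℕ)) h1
  simpa using this

/-- `S` lies entirely below or entirely above `T` in the coordinate `f`. -/
def Sep {ι : Type} (f : ι → ℕ) (S T : Finset ι) : Prop :=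
  (∀ s ∈ S, ∀ t ∈ T, f s < f t) ∨ (∀ s ∈ S, ∀ t ∈ T, f t < f s)

/-- The intervals `[s i, t i)`, for `i < n`, follow one another. -/
def Stacked (s t : ℕ → ℕ) (n : ℕ) : Prop := ∀ i j, i < j → j < n → t i ≤ s j

/-- A binary word selects `a i` or `b i` in slab `i`. The `y`-order of the selected points recovers
the indices. Since `A` lies wholly to one side of `B`, the number of letters `true` together with
the `x`-order recovers which points come from `A`. -/
theorem two_pow_le_speed (C : PermClass) {N : ℕ} {π : Equiv.Perm (Fin N)}
    (hπ : (⟨N, π⟩ : FinPerm) ∈ C.carrier) {x y : Fin N → ℕ} (hxy : Coords π x y) (n : ℕ)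
    {A B : Finset (Fin N)} (hAB : Sep x A B) {s t : ℕ → ℕ} (hst : Stacked s t n)
    {a b : ℕ → Fin N} (ha : ∀ i < n, a i ∈ A ∧ s i ≤ y (a i) ∧ y (a i) < t i)
    (hb : ∀ i < n, b i ∈ B ∧ s i ≤ y (b i) ∧ y (b i) < t i) :
    2 ^ n ≤ (n + 1) ^ 2 * C.speed n := by
  classical
  set p : (Fin n → Bool) → Fin n → Fin N := fun w k => if w k then a k else b k with hpdef
  have hmono : ∀ w k l, k < l → y (p w k) < y (p w l) := by
    intro w k l hkl
    have h1 := hst k l hkl l.2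
    have h2 := ha k k.2
    have h3 := hb k k.2
    have h4 := ha l l.2
    have h5 := hb l l.2
    simp only [hpdef]
    split_ifs <;> omega
  have hsm : ∀ w, StrictMono fun k => y (p w k) := fun w k l => hmono w k l
  have hinj : ∀ w, Function.Injective (p w) := fun w k l h =>
    (hsm w).injective (congrArg y h)
  have hmain := card_le_speed C π hπ hxy n (Finset.univ : Finset (Fin n → Bool)) p
    (fun w _ => hinj w) (fun w => ((Finset.univ.filter fun k => w k = true).card, 0))
    (fun w _ => ⟨by simpa using Finset.card_filter_le Finset.univ fun k => w k = true, by simp⟩) ?_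
  · simpa using hmain
  intro w _ v _ hd e hex hey
  simp only [Prod.mk.injEq, and_true] at hd
  have he : e = 1 := perm_eq_one_of_lt_iff fun k l hkl =>
    (hsm v).lt_iff_lt.1 ((hey k l).1 (hmono w k l hkl))
  subst he
  funext k
  have hT : (k ∈ Finset.univ.filter fun k => w k = true) ↔
      (1 : Equiv.Perm (Fin n)) k ∈ Finset.univ.filter fun k => v k = true := by
    rcases hAB with h | h
    · refine mem_iff_of_initial (f := fun k => x (p w k)) (g := fun k => x (p v k)) hex ?_ ?_ hd k <;>
      · intro k hk l hl
        simp only [Finset.mem_filter, Finset.mem_univ, true_and] at hk hl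
        simp only [hpdef, hk, hl]
        exact h _ (ha k k.2).1 _ (hb l l.2).1
    · refine mem_iff_of_final (f := fun k => x (p w k)) (g := fun k => x (p v k)) hex ?_ ?_ hd k <;>
      · intro k hk l hl
        simp only [Finset.mem_filter, Finset.mem_univ, true_and] at hk hl
        simp only [hpdef, hk, hl]
        exact h _ (ha k k.2).1 _ (hb l l.2).1
  simp only [Finset.mem_filter, Finset.mem_univ, true_and, Equiv.Perm.coe_one, id_eq] at hT
  exact Bool.eq_iff_iff.2 hT

/-- A letter-preserving correspondence of words that respects the order of the letters `0, 1`
and the order of the letters `1, 2` is the identity, if every `2` is followed by a `1`. -/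
theorem word_eq_of_perm {n : ℕ} {w v : ℕ → Fin 3} (hw : w ∈ pellWords n) (hv : v ∈ pellWords n)
    {e : Equiv.Perm (Fin n)} (he : ∀ k : Fin n, w k = v (e k))
    (h2 : ∀ k l : Fin n, w k ≠ 2 → w l ≠ 2 → k < l → e k < e l)
    (h0 : ∀ k l : Fin n, w k ≠ 0 → w l ≠ 0 → k < l → e k < e l) : w = v := by
  have hw' := pellWords_spec n w hw
  have hv' := pellWords_spec n v hv
  have he1 : e = 1 := by
    refine perm_eq_one_of_lt_iff fun k l hkl => ?_
    by_cases hk2 : w k = 2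
    · by_cases hl0 : w l = 0
      -- A 2 before a 0 is compared with it through the 1 that follows the 2, which is comparable to
      -- both.
      · obtain ⟨h1, h3⟩ := hw'.2 k hk2
        have hkl' : (⟨k + 1, h1⟩ : Fin n) < l := by
          rw [Fin.lt_def] at hkl ⊢
          rcases Nat.lt_or_ge (k + 1) l with h | h
          · exact h
          · have : (l : ℕ) = k + 1 := by omega
            rw [this, h3] at hl0
            exact absurd hl0 (by simp)
        refine (h0 k ⟨k + 1, h1⟩ (by simp [hk2]) (by simp [h3]) (Fin.lt_def.2 (by simp))).trans
          (h2 _ l (by simp [h3]) (by simp [hl0]) hkl')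
      · exact h0 k l (by simp [hk2]) hl0 hkl
    · by_cases hl2 : w l = 2
      · by_cases hk0 : w k = 0
        -- For a 0 before a 2, the intermediate 1 is taken in `v`: if `e` reversed the two, the 1
        -- following the 2 in `v` would precede the 0 there, whereas its preimage `m` comes after
        -- the 0 in `w`.
        · by_contra hcon
          have hne : e k ≠ e l := fun h => hkl.ne (e.injective h)
          have hlt : e l < e k := lt_of_le_of_ne (not_lt.1 hcon) hne.symm
          obtain ⟨h1, h3⟩ := hv'.2 (e l) (by rw [← he, hl2])
          obtain ⟨m, hm⟩ := e.surjective ⟨e l + 1, h1⟩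
          have hwm : w m = 1 := by rw [he, hm]; exact h3
          have hmk : m ≠ k := by rintro rfl; rw [hwm] at hk0; exact absurd hk0 (by simp)
          have hml : m ≠ l := by rintro rfl; rw [hwm] at hl2; exact absurd hl2 (by simp)
          have hem : e l < e m := by rw [hm, Fin.lt_def]; simp
          have hem' : e m < e k := by
            have h4 : e m ≠ e k := fun h => hmk (e.injective h)
            rw [hm] at h4 ⊢
            rw [Fin.lt_def] at hlt ⊢
            have : (e l : ℕ) + 1 ≠ e k := fun h => h4 (Fin.ext h)
            simp only
            omega
          have hlm : l < m := by
            rcases lt_trichotomy l m with h | h | h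
            · exact h
            · exact absurd h.symm hml
            · exact absurd (h0 m l (by simp [hwm]) (by simp [hl2]) h) (not_lt.2 hem.le)
          have hkm : k < m := hkl.trans hlm
          exact absurd (h2 k m (by simp [hk0]) (by simp [hwm]) hkm) (not_lt.2 hem'.le)
        · exact h0 k l hk0 (by simp [hl2]) hkl
      · exact h2 k l hk2 hl2 hkl
  subst he1
  funext k
  by_cases hk : k < n
  · exact he ⟨k, hk⟩
  · rw [hw'.1 k (by omega), hv'.1 k (by omega)]

theorem mem_iff_of_sep {n N : ℕ} {z : Fin N → ℕ} {f g : Fin n → Fin N} {e : Equiv.Perm (Fin n)}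
    (hfg : ∀ k l, z (f k) < z (f l) ↔ z (g (e k)) < z (g (e l))) {T T' : Finset (Fin n)}
    {U V : Finset (Fin N)} (hUV : Sep z U V) (hf : ∀ k, if k ∈ T then f k ∈ U else f k ∈ V)
    (hg : ∀ k, if k ∈ T' then g k ∈ U else g k ∈ V) (hc : T.card = T'.card) (k : Fin n) :
    k ∈ T ↔ e k ∈ T' := by
  have h1 : ∀ k ∈ T, f k ∈ U := fun k hk => by simpa [hk] using hf k
  have h2 : ∀ k, k ∉ T → f k ∈ V := fun k hk => by simpa [hk] using hf k
  have h3 : ∀ k ∈ T', g k ∈ U := fun k hk => by simpa [hk] using hg k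
  have h4 : ∀ k, k ∉ T' → g k ∈ V := fun k hk => by simpa [hk] using hg k
  rcases hUV with h | h
  · exact mem_iff_of_initial (f := fun k => z (f k)) (g := fun k => z (g k)) hfg
      (fun k hk l hl => h _ (h1 k hk) _ (h2 l hl)) (fun k hk l hl => h _ (h3 k hk) _ (h4 l hl)) hc k
  · exact mem_iff_of_final (f := fun k => z (f k)) (g := fun k => z (g k)) hfg
      (fun k hk l hl => h _ (h1 k hk) _ (h2 l hl)) (fun k hk l hl => h _ (h3 k hk) _ (h4 l hl)) hc k

/-- The word `w` selects the points `p (w k) k`. Counting letters 0 and 2 and using the separations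
recovers the letter of each point. The order of the letters 0 and 1 is visible in `y`, that of 1 and
2 in `y` or `x`, but 0 and 2 need not be comparable. This is why the words are restricted to those
in which a 1 follows every 2: `word_eq_of_perm` then applies. -/
theorem card_pellWords_le_of_three_cells (C : PermClass) {N : ℕ} {π : Equiv.Perm (Fin N)}
    (hπ : (⟨N, π⟩ : FinPerm) ∈ C.carrier) {x y : Fin N → ℕ} (hxy : Coords π x y) (n : ℕ)
    {U : Fin 3 → Finset (Fin N)} (h0 : Sep x (U 0) (U 1 ∪ U 2))
    (h2 : Sep x (U 2) (U 0 ∪ U 1) ∨ Sep y (U 2) (U 0 ∪ U 1))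
    {p : Fin 3 → ℕ → Fin N} (hp : ∀ c, ∀ i < n, p c i ∈ U c)
    (hy : ∀ c d, c ≠ 2 → d ≠ 2 → ∀ i j, i < j → j < n → y (p c i) < y (p d j))
    (hr : (∀ c d, c ≠ 0 → d ≠ 0 → ∀ i j, i < j → j < n → y (p c i) < y (p d j)) ∨
      (∀ c d, c ≠ 0 → d ≠ 0 → ∀ i j, i < j → j < n → x (p c i) < x (p d j)) ∨
      (∀ c d, c ≠ 0 → d ≠ 0 → ∀ i j, i < j → j < n → x (p d j) < x (p c i))) :
    (pellWords n).card ≤ (n + 1) ^ 2 * C.speed n := by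
  classical
  have hlet : ∀ c : Fin 3, c = 0 ∨ c = 1 ∨ c = 2 := by decide
  have hUne : ∀ a ∈ U 0, ∀ b ∈ U 2, a ≠ b := by
    rintro a ha b hb rfl
    rcases h0 with h | h
    · exact lt_irrefl _ (h a ha a (Finset.mem_union_right _ hb))
    · exact lt_irrefl _ (h a ha a (Finset.mem_union_right _ hb))
  have hne : ∀ w : ℕ → Fin 3, ∀ k l, k < l → l < n → p (w k) k ≠ p (w l) l := by
    intro w k l hkl hl heq
    by_cases hk2 : w k = 2
    · by_cases hl0 : w l = 0
      · exact hUne _ (hl0 ▸ hp (w l) l hl) _ (hk2 ▸ hp (w k) k (hkl.trans hl)) heq.symm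
      · rcases hr with h | h | h <;>
        · have := h (w k) (w l) (by simp [hk2]) hl0 k l hkl hl
          rw [heq] at this
          exact lt_irrefl _ this
    · by_cases hl2 : w l = 2
      · by_cases hk0 : w k = 0
        · exact hUne _ (hk0 ▸ hp (w k) k (hkl.trans hl)) _ (hl2 ▸ hp (w l) l hl) heq
        · rcases hr with h | h | h <;>
          · have := h (w k) (w l) hk0 (by simp [hl2]) k l hkl hl
            rw [heq] at this
            exact lt_irrefl _ this
      · have := hy (w k) (w l) hk2 hl2 k l hkl hl
        rw [heq] at this
        exact lt_irrefl _ this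
  refine card_le_speed C π hπ hxy n (pellWords n) (fun w k => p (w k) k) ?_
    (fun w => ((Finset.univ.filter fun k : Fin n => w k = 0).card,
      (Finset.univ.filter fun k : Fin n => w k = 2).card))
    (fun w _ => ⟨by simpa using Finset.card_filter_le Finset.univ fun k : Fin n => w k = 0,
      by simpa using Finset.card_filter_le Finset.univ fun k : Fin n => w k = 2⟩) ?_
  · intro w _ k l hkl
    by_contra hcon
    rcases lt_or_gt_of_ne hcon with h | h
    · exact hne w k l h l.2 hkl
    · exact hne w l k h k.2 hkl.symm
  intro w hw v hv hd e hex hey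
  simp only [Prod.mk.injEq] at hd
  have hmem : ∀ (c : Fin 3) (V : Finset (Fin N)), (∀ d, d ≠ c → U d ⊆ V) → ∀ (w : ℕ → Fin 3)
      (k : Fin n), if k ∈ Finset.univ.filter (fun k : Fin n => w k = c) then p (w k) k ∈ U c
        else p (w k) k ∈ V := by
    intro c V hV w k
    by_cases h : w k = c
    · simpa [h] using hp c k k.2
    · simpa [h] using hV _ h (hp (w k) k k.2)
  have hV0 : ∀ d, d ≠ 0 → U d ⊆ U 1 ∪ U 2 := by
    intro d hd
    rcases hlet d with rfl | rfl | rfl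
    · exact absurd rfl hd
    · exact Finset.subset_union_left
    · exact Finset.subset_union_right
  have hV2 : ∀ d, d ≠ 2 → U d ⊆ U 0 ∪ U 1 := by
    intro d hd
    rcases hlet d with rfl | rfl | rfl
    · exact Finset.subset_union_left
    · exact Finset.subset_union_right
    · exact absurd rfl hd
  have ht0 := mem_iff_of_sep hex h0 (hmem 0 _ hV0 w) (hmem 0 _ hV0 v) hd.1
  have ht2 : ∀ k : Fin n, (k ∈ Finset.univ.filter fun k : Fin n => w k = 2) ↔
      e k ∈ Finset.univ.filter fun k : Fin n => v k = 2 := by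
    rcases h2 with h2 | h2
    · exact mem_iff_of_sep hex h2 (hmem 2 _ hV2 w) (hmem 2 _ hV2 v) hd.2
    · exact mem_iff_of_sep hey h2 (hmem 2 _ hV2 w) (hmem 2 _ hV2 v) hd.2
  simp only [Finset.mem_filter, Finset.mem_univ, true_and] at ht0 ht2
  have hwv : ∀ k : Fin n, w k = v (e k) := by
    intro k
    have e0 := ht0 k
    have e2 := ht2 k
    rcases hlet (w k) with h | h | h <;> rcases hlet (v (e k)) with h' | h' | h' <;>
      simp [h, h'] at e0 e2 ⊢
  refine word_eq_of_perm hw hv hwv ?_ ?_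
  · intro k l hk hl hkl
    by_contra hcon
    have hlt : e l < e k :=
      lt_of_le_of_ne (not_lt.1 hcon) fun h => hkl.ne (e.injective h).symm
    have h1 := (hey k l).1 (hy _ _ hk hl k l hkl l.2)
    have h2 := hy (v (e l)) (v (e k)) (by rw [← hwv]; exact hl) (by rw [← hwv]; exact hk)
      (e l) (e k) hlt (e k).2
    exact lt_asymm h1 h2
  · intro k l hk hl hkl
    by_contra hcon
    have hlt : e l < e k :=
      lt_of_le_of_ne (not_lt.1 hcon) fun h => hkl.ne (e.injective h).symm
    have hk' : v (e k) ≠ 0 := by rw [← hwv]; exact hk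
    have hl' : v (e l) ≠ 0 := by rw [← hwv]; exact hl
    rcases hr with h | h | h
    · exact lt_asymm ((hey k l).1 (h _ _ hk hl k l hkl l.2)) (h _ _ hl' hk' _ _ hlt (e k).2)
    · exact lt_asymm ((hex k l).1 (h _ _ hk hl k l hkl l.2)) (h _ _ hl' hk' _ _ hlt (e k).2)
    · exact lt_asymm ((hex l k).1 (h _ _ hk hl k l hkl l.2)) (h _ _ hl' hk' _ _ hlt (e k).2)

/-- Slabs that meet `B` and contain a pair of points of `A` (the lower one `p false`, the upper one
`p true`), where the pairs are arranged monotonically, but each pair is arranged in the opposite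
way. -/
theorem card_pellWords_le_of_inverted_pairs (C : PermClass) {N : ℕ} {π : Equiv.Perm (Fin N)}
    (hπ : (⟨N, π⟩ : FinPerm) ∈ C.carrier) {x y : Fin N → ℕ} (hxy : Coords π x y) (n : ℕ)
    {A B : Finset (Fin N)} (hAB : Sep x B A) {s t : ℕ → ℕ} (hst : Stacked s t n)
    {b : ℕ → Fin N} {p : Bool → ℕ → Fin N}
    (hb : ∀ i < n, b i ∈ B ∧ s i ≤ y (b i) ∧ y (b i) < t i)
    (hp : ∀ c, ∀ i < n, p c i ∈ A ∧ s i ≤ y (p c i) ∧ y (p c i) < t i)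
    (hpy : ∀ i < n, y (p false i) < y (p true i))
    (hr : ((∀ c d i j, i < j → j < n → x (p c i) < x (p d j)) ∧
        ∀ i < n, x (p true i) < x (p false i)) ∨
      ((∀ c d i j, i < j → j < n → x (p d j) < x (p c i)) ∧
        ∀ i < n, x (p false i) < x (p true i))) :
    (pellWords n).card ≤ (n + 1) ^ 2 * C.speed n := by
  classical
  have hlet : ∀ c : Fin 3, c = 0 ∨ c = 1 ∨ c = 2 := by decide
  -- Letter 0 selects a point of `B`, letter 2 the lower and letter 1 the upper point of a pair. A 1
  -- directly after a 2 goes back to the slab of that 2, so that the block 21 selects a whole pair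
  -- and shows as an inversion; every other letter uses the slab of its own position.
  set idx : (ℕ → Fin 3) → ℕ → ℕ := fun w k => if w k = 1 ∧ 0 < k ∧ w (k - 1) = 2 then k - 1 else k
    with hidx
  set pt : (ℕ → Fin 3) → ℕ → Fin N := fun w k =>
    if w k = 0 then b k else p (decide (w k = 1)) (idx w k) with hpt
  have hidx_le : ∀ w k, idx w k ≤ k := by
    intro w k
    simp only [hidx]
    split_ifs <;> omega
  have hle_idx : ∀ w k, k ≤ idx w k + 1 := by
    intro w k
    simp only [hidx]
    split_ifs <;> omega
  have hslab : ∀ w k, k < n → s (idx w k) ≤ y (pt w k) ∧ y (pt w k) < t (idx w k) := by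
    intro w k hk
    have h1 := hidx_le w k
    by_cases h : w k = 0
    · have h2 : idx w k = k := by simp [hidx, h]
      simp only [hpt, h, if_true, h2]
      exact (hb k hk).2
    · simp only [hpt, h, if_false]
      exact (hp _ _ (by omega)).2
  have hmono : ∀ w k l, k < l → l < n → y (pt w k) < y (pt w l) := by
    intro w k l hkl hl
    have h1 := hslab w k (hkl.trans hl)
    have h2 := hslab w l hl
    have h3 := hidx_le w k
    have h4 := hle_idx w l
    have h5 := hidx_le w l
    -- Two positions share a slab only when they form a block 21, and then the lower point of the
    -- pair comes first.
    rcases Nat.lt_or_ge (idx w k) (idx w l) with h | h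
    · have := hst _ _ h (by omega)
      omega
    · have hlk : l = k + 1 := by omega
      subst hlk
      have hid : idx w (k + 1) = k := by omega
      have hc : w (k + 1) = 1 ∧ w k = 2 := by
        by_contra hcon
        have : idx w (k + 1) = k + 1 := by
          simp only [hidx]
          rw [if_neg]
          simpa using hcon
        omega
      have hid' : idx w k = k := by omega
      simp only [hpt, hc.1, hc.2, hid, hid']
      simpa using hpy k (by omega)
  have hsm : ∀ w, StrictMono fun k : Fin n => y (pt w k) := fun w k l h => hmono w k l h l.2
  refine card_le_speed C π hπ hxy n (pellWords n) (fun w k => pt w k) ?_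
    (fun w => ((Finset.univ.filter fun k : Fin n => w k = 0).card, 0))
    (fun w _ => ⟨by simpa using Finset.card_filter_le Finset.univ fun k : Fin n => w k = 0,
      by simp⟩) ?_
  · intro w _ k l hkl
    exact (hsm w).injective (congrArg y hkl)
  intro w hw v hv hd e hex hey
  simp only [Prod.mk.injEq, and_true] at hd
  have he : e = 1 := perm_eq_one_of_lt_iff fun k l hkl =>
    (hsm v).lt_iff_lt.1 ((hey k l).1 (hmono w k l hkl l.2))
  subst he
  have hmem : ∀ (w : ℕ → Fin 3)
      (k : Fin n), if k ∈ Finset.univ.filter (fun k : Fin n => w k = 0) then pt w k ∈ B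
        else pt w k ∈ A := by
    intro w k
    by_cases h : w k = 0
    · simpa [h, hpt] using (hb k k.2).1
    · simpa [h, hpt] using (hp _ _ ((hidx_le w k).trans_lt k.2)).1
  have ht0 := mem_iff_of_sep hex hAB (hmem w) (hmem v) hd
  simp only [Finset.mem_filter, Finset.mem_univ, true_and, Equiv.Perm.coe_one, id_eq] at ht0 hex
  -- A letter `2` of `w` sits at the start of an inverted pair, which `v` must reproduce.
  have htwo : ∀ w ∈ pellWords n, ∀ v : ℕ → Fin 3,
      (∀ k : Fin n, w k = 0 ↔ v k = 0) →
      (∀ k l : Fin n, x (pt w k) < x (pt w l) ↔ x (pt v k) < x (pt v l)) →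
      ∀ k : Fin n, w k = 2 → v k = 2 := by
    intro w hw v h0 hx k hk
    obtain ⟨hk1, hk2⟩ := (pellWords_spec n w hw).2 k hk
    by_contra hvk
    have hv0 : v k ≠ 0 := fun h => by have := (h0 k).2 h; rw [hk] at this; exact absurd this (by simp)
    have hv1 : v (k + 1) ≠ 0 := fun h => by
      have := (h0 ⟨k + 1, hk1⟩).2 h
      simp only [hk2] at this
      exact absurd this (by simp)
    have hwi : idx w k = k := by simp [hidx, hk]
    have hwi' : idx w (k + 1) = k := by simp [hidx, hk, hk2]
    have hvi' : idx v (k + 1) = k + 1 := by simp [hidx, hvk]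
    have hvi := hidx_le v k
    have hwk : pt w k = p false k := by simp [hpt, hk, hwi]
    have hwk' : pt w (k + 1) = p true k := by simp [hpt, hk2, hwi']
    have hvk : pt v k = p (decide (v k = 1)) (idx v k) := by simp [hpt, hv0]
    have hvk' : pt v (k + 1) = p (decide (v (k + 1) = 1)) (k + 1) := by simp [hpt, hv1, hvi']
    have hx1 := hx k ⟨k + 1, hk1⟩
    have hx2 := hx ⟨k + 1, hk1⟩ k
    simp only [hwk, hwk', hvk, hvk'] at hx1 hx2
    rcases hr with ⟨h1, h2⟩ | ⟨h1, h2⟩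
    · have h3 := h2 k k.2
      have h4 := h1 (decide (v k = 1)) (decide (v (k + 1) = 1)) (idx v k) (k + 1) (by omega) hk1
      exact lt_asymm h4 (hx2.1 h3)
    · have h3 := h2 k k.2
      have h4 := h1 (decide (v k = 1)) (decide (v (k + 1) = 1)) (idx v k) (k + 1) (by omega) hk1
      exact lt_asymm h4 (hx1.1 h3)
  have hA := htwo w hw v ht0 hex
  have hB := htwo v hv w (fun k => (ht0 k).symm) (fun k l => (hex k l).symm)
  funext k
  by_cases hk : k < n
  · have e0 := ht0 ⟨k, hk⟩
    have e1 := hA ⟨k, hk⟩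
    have e2 := hB ⟨k, hk⟩
    simp only at e0 e1 e2
    rcases hlet (w k) with h | h | h <;> rcases hlet (v k) with h' | h' | h' <;>
      simp [h, h'] at e0 e1 e2 ⊢
  · rw [(pellWords_spec n w hw).1 k (by omega), (pellWords_spec n v hv).1 k (by omega)]

/-! ### Greedy slicing and a Ramsey argument -/

/-- Greedy choice: take the least `b` for which `[z, b)` has the property and continue from `b`.
Either this succeeds `m` times, or it stops and the endpoints found so far slice every interval with
the property. -/
theorem exists_stacked_or_lines_from (P : ℕ → ℕ → Prop)
    (hP : ∀ a b a' b', a' ≤ a → b ≤ b' → P a b → P a' b') (hP1 : ∀ a, ¬ P a (a + 1)) (m : ℕ) :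
    ∀ z, (∃ s t : ℕ → ℕ, (∀ i < m, z ≤ s i ∧ P (s i) (t i)) ∧ Stacked s t m) ∨
      ∃ T : Finset ℕ, T.card ≤ 2 * m ∧ ∀ a b, z ≤ a → P a b → ∃ c ∈ T, a < c ∧ c < b := by
  classical
  induction m with
  | zero => exact fun z => Or.inl ⟨id, id, fun i hi => absurd hi (by omega),
      fun i j _ hj => absurd hj (by omega)⟩
  | succ m ih =>
    intro z
    by_cases hex : ∃ b, P z b
    · have hb := Nat.find_spec hex
      have hmin : ∀ b', b' < Nat.find hex → ¬ P z b' := fun b' h => Nat.find_min hex h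
      set b := Nat.find hex
      have hzb : z + 1 < b := by
        by_contra hcon
        exact hP1 z (hP z b z (z + 1) le_rfl (by omega) hb)
      rcases ih b with ⟨s, t, h1, h2⟩ | ⟨T, hT, h⟩
      · refine Or.inl ⟨fun i => Nat.casesOn i z s, fun i => Nat.casesOn i b t, ?_, ?_⟩
        · rintro (_ | i) hi
          · exact ⟨le_rfl, hb⟩
          · have := h1 i (by omega)
            exact ⟨by simp only; omega, this.2⟩
        · rintro (_ | i) (_ | j) hij hj
          · omega
          · exact (h1 j (by omega)).1
          · omega
          · exact h2 i j (by omega) (by omega)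
      -- An interval with the property that starts before `b` ends at `b` or later, by minimality.
      -- It is crossed at `b - 1`, unless it starts there; in that case it is crossed at `b`,
      -- because a single row does not have the property.
      · refine Or.inr ⟨insert (b - 1) (insert b T), ?_, ?_⟩
        · have h1 := Finset.card_insert_le (b - 1) (insert b T)
          have h2 := Finset.card_insert_le b T
          omega
        · intro a b' ha hab
          by_cases hab' : b ≤ a
          · obtain ⟨c, hc, h'⟩ := h a b' hab' hab
            exact ⟨c, by simp [hc], h'⟩
          · have h1 : ¬ b' < b := fun h' => hmin b' h' (hP a b' z b' ha le_rfl hab)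
            by_cases h2 : a < b - 1
            · exact ⟨b - 1, by simp, h2, by omega⟩
            · refine ⟨b, by simp, by omega, ?_⟩
              by_contra h3
              have : b' = a + 1 := by omega
              subst this
              exact hP1 a hab
    · refine Or.inr ⟨∅, by simp, fun a b ha hab => ?_⟩
      exact absurd ⟨b, hP a b z b ha le_rfl hab⟩ hex

/-- A monotone property of intervals, which fails for single rows, holds for `m` consecutive
intervals, or `2 * m` lines slice all intervals that have it. -/
theorem exists_stacked_or_lines (P : ℕ → ℕ → Prop)
    (hP : ∀ a b a' b', a' ≤ a → b ≤ b' → P a b → P a' b') (hP1 : ∀ a, ¬ P a (a + 1)) (m : ℕ) :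
    (∃ s t : ℕ → ℕ, (∀ i < m, P (s i) (t i)) ∧ Stacked s t m) ∨
      ∃ T : Finset ℕ, T.card ≤ 2 * m ∧ ∀ a b, P a b → ∃ c ∈ T, a < c ∧ c < b := by
  rcases exists_stacked_or_lines_from P hP hP1 m 0 with ⟨s, t, h1, h2⟩ | ⟨T, hT, h⟩
  · exact Or.inl ⟨s, t, fun i hi => (h1 i hi).2, h2⟩
  · exact Or.inr ⟨T, hT, fun a b => h a b (Nat.zero_le _)⟩

/-- Ramsey's theorem for two colours, by the usual recurrence: the least element of `S` splits the
others according to their relation to it, and one of the two parts is large. -/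
theorem exists_homogeneous (a b : ℕ) : ∃ M : ℕ, ∀ (R : ℕ → ℕ → Prop) (S : Finset ℕ), M ≤ S.card →
    (∃ T ⊆ S, T.card = a ∧ ∀ i ∈ T, ∀ j ∈ T, i < j → R i j) ∨
      ∃ T ⊆ S, T.card = b ∧ ∀ i ∈ T, ∀ j ∈ T, i < j → ¬ R i j := by
  classical
  induction a generalizing b with
  | zero => exact ⟨0, fun R S _ => Or.inl ⟨∅, by simp, by simp, by simp⟩⟩
  | succ a iha =>
    induction b with
    | zero => exact ⟨0, fun R S _ => Or.inr ⟨∅, by simp, by simp, by simp⟩⟩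
    | succ b ihb =>
      obtain ⟨M₁, h₁⟩ := iha (b + 1)
      obtain ⟨M₂, h₂⟩ := ihb
      refine ⟨M₁ + M₂ + 1, fun R S hS => ?_⟩
      have hne : S.Nonempty := Finset.card_pos.1 (by omega)
      set m := S.min' hne
      have hmS : m ∈ S := S.min'_mem hne
      have hlt : ∀ i ∈ S.erase m, m < i := fun i hi =>
        lt_of_le_of_ne (S.min'_le i (Finset.mem_of_mem_erase hi)) (Finset.ne_of_mem_erase hi).symm
      have hcard : ((S.erase m).filter (R m)).card + ((S.erase m).filter fun j => ¬ R m j).card =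
          (S.erase m).card := Finset.card_filter_add_card_filter_not _
      have hE : (S.erase m).card = S.card - 1 := Finset.card_erase_of_mem hmS
      have hext : ∀ (Q : ℕ → ℕ → Prop) (T : Finset ℕ), T ⊆ (S.erase m).filter (Q m) →
          (∀ i ∈ T, ∀ j ∈ T, i < j → Q i j) → insert m T ⊆ S ∧ (insert m T).card = T.card + 1 ∧
          ∀ i ∈ insert m T, ∀ j ∈ insert m T, i < j → Q i j := by
        intro Q T hT hQ
        have hT' : ∀ i ∈ T, i ∈ S.erase m ∧ Q m i := fun i hi => Finset.mem_filter.1 (hT hi)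
        refine ⟨?_, ?_, ?_⟩
        · intro i hi
          rcases Finset.mem_insert.1 hi with rfl | hi
          · exact hmS
          · exact Finset.mem_of_mem_erase (hT' i hi).1
        · exact Finset.card_insert_of_notMem fun h => lt_irrefl _ (hlt m (hT' m h).1)
        · intro i hi j hj hij
          rcases Finset.mem_insert.1 hi with rfl | hi
          · rcases Finset.mem_insert.1 hj with rfl | hj
            · exact absurd hij (lt_irrefl _)
            · exact (hT' j hj).2
          · rcases Finset.mem_insert.1 hj with rfl | hj
            · exact absurd hij (lt_asymm (hlt i (hT' i hi).1))
            · exact hQ i hi j hj hij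
      by_cases hbig : M₁ ≤ ((S.erase m).filter (R m)).card
      · rcases h₁ R _ hbig with ⟨T, hT, hc, h⟩ | ⟨T, hT, hc, h⟩
        · obtain ⟨e1, e2, e3⟩ := hext R T hT h
          exact Or.inl ⟨_, e1, by omega, e3⟩
        · exact Or.inr ⟨T, hT.trans ((Finset.filter_subset _ _).trans (Finset.erase_subset _ _)),
            hc, h⟩
      · rcases h₂ R ((S.erase m).filter fun j => ¬ R m j) (by omega) with
          ⟨T, hT, hc, h⟩ | ⟨T, hT, hc, h⟩
        · exact Or.inl ⟨T, hT.trans ((Finset.filter_subset _ _).trans (Finset.erase_subset _ _)),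
            hc, h⟩
        · obtain ⟨e1, e2, e3⟩ := hext (fun i j => ¬ R i j) T
            (fun i hi => by simpa using hT hi) h
          exact Or.inr ⟨_, e1, by omega, e3⟩

/-- `S` lies on one side of the line at `L`. -/
def OneSided {ι : Type} (f : ι → ℕ) (L : ℕ) (S : Finset ι) : Prop :=
  (∀ s ∈ S, f s < L) ∨ ∀ s ∈ S, L ≤ f s

/-- For every line in the coordinate `f`, all but at most `r` points of `A` are covered by `q`
pairwise independent pieces that lie on one side of the line. -/
def Conc {ι : Type} [DecidableEq ι] (f g : ι → ℕ) (q r : ℕ) (A : Finset ι) : Prop :=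
  ∀ L : ℕ, ∃ P : Fin q → Finset ι, (∀ a, P a ⊆ A) ∧
    (∀ a b, a ≠ b → Sep f (P a) (P b) ∧ Sep g (P a) (P b)) ∧ (∀ a, OneSided f L (P a)) ∧
    (A.filter fun i => ∀ a, i ∉ P a).card ≤ r

/-- In a concentrated set few slabs have points on both sides of a line. -/
theorem card_crossing_le {ι : Type} [DecidableEq ι] {x y : ι → ℕ} {q r : ℕ} {A : Finset ι}
    (hA : Conc x y q r A) {s t : ℕ → ℕ} {m : ℕ} (hst : Stacked s t m) {a b : ℕ → ι}
    (ha : ∀ i < m, a i ∈ A ∧ s i ≤ y (a i) ∧ y (a i) < t i)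
    (hb : ∀ i < m, b i ∈ A ∧ s i ≤ y (b i) ∧ y (b i) < t i) (L : ℕ) (T : Finset ℕ)
    (hT : ∀ i ∈ T, i < m ∧ x (a i) < L ∧ L ≤ x (b i)) : T.card ≤ 2 * q + r := by
  classical
  obtain ⟨P, hPA, hsep, hside, hr⟩ := hA L
  set E := A.filter fun i => ∀ a, i ∉ P a with hE
  have hainj : ∀ i ∈ T, ∀ j ∈ T, ∀ u v : ι, (u = a i ∨ u = b i) → (v = a j ∨ v = b j) → i < j →
      y u < y v := by
    intro i hi j hj u v hu hv hij
    have h1 := hst i j hij (hT j hj).1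
    have h2 := ha i (hT i hi).1
    have h3 := hb i (hT i hi).1
    have h4 := ha j (hT j hj).1
    have h5 := hb j (hT j hj).1
    rcases hu with rfl | rfl <;> rcases hv with rfl | rfl <;> omega
  -- Different slabs contain different points, so the at most `r` uncovered points spoil at most `r`
  -- slabs.
  have hbad : (T.filter fun i => a i ∈ E ∨ b i ∈ E).card ≤ r := by
    refine le_trans (Finset.card_le_card_of_injOn (fun i => if a i ∈ E then a i else b i) ?_ ?_) hr
    · intro i hi
      simp only [Finset.coe_filter, Set.mem_ofPred_eq] at hi
      simp only [Finset.mem_coe]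
      split_ifs with h
      · exact h
      · exact hi.2.resolve_left h
    · intro i hi j hj hij
      simp only [Finset.coe_filter, Set.mem_ofPred_eq] at hi hj
      by_contra hne
      have hu : ∀ i, (if a i ∈ E then a i else b i) = a i ∨
          (if a i ∈ E then a i else b i) = b i := by
        intro i; split_ifs <;> simp
      rcases lt_or_gt_of_ne hne with h | h
      · have := hainj i hi.1 j hj.1 _ _ (hu i) (hu j) h
        simp only at hij
        rw [hij] at this
        exact lt_irrefl _ this
      · have := hainj j hj.1 i hi.1 _ _ (hu j) (hu i) h
        simp only at hij
        rw [hij] at this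
        exact lt_irrefl _ this
  have hsplit := Finset.card_filter_add_card_filter_not (s := T) (fun i => a i ∈ E ∨ b i ∈ E)
  by_contra hcon
  -- With more than `2 * q` slabs remaining, three of them have their point `a` in the same piece.
  have hgood : (Finset.univ : Finset (Fin q)).card * 2 <
      (T.filter fun i => ¬ (a i ∈ E ∨ b i ∈ E)).card := by
    simp only [Finset.card_univ, Fintype.card_fin]
    omega
  have hcov : ∀ i ∈ T, ∀ u, (u = a i ∨ u = b i) → u ∉ E → ∃ c, u ∈ P c := by
    intro i hi u hu huE
    have huA : u ∈ A := by
      rcases hu with rfl | rfl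
      · exact (ha i (hT i hi).1).1
      · exact (hb i (hT i hi).1).1
    by_contra! hno
    exact huE (Finset.mem_filter.2 ⟨huA, hno⟩)
  have hq : ∀ i, ∃ c : Option (Fin q), (i ∈ T.filter fun i => ¬ (a i ∈ E ∨ b i ∈ E)) →
      ∃ c', c = some c' ∧ a i ∈ P c' := by
    intro i
    by_cases hi : i ∈ T.filter fun i => ¬ (a i ∈ E ∨ b i ∈ E)
    · obtain ⟨h1, h2⟩ := Finset.mem_filter.1 hi
      obtain ⟨c, hc⟩ := hcov i h1 (a i) (Or.inl rfl) fun h => h2 (Or.inl h)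
      exact ⟨some c, fun _ => ⟨c, rfl, hc⟩⟩
    · exact ⟨none, fun h => absurd h hi⟩
  choose col hcol using hq
  obtain ⟨c, -, hc⟩ := Finset.exists_lt_card_fiber_of_mul_lt_card_of_maps_to
    (s := T.filter fun i => ¬ (a i ∈ E ∨ b i ∈ E)) (t := Finset.univ.image (some : Fin q → _))
    (f := col) (n := 2) (fun i hi => by
      obtain ⟨c', h, -⟩ := hcol i hi
      rw [h]; exact Finset.mem_image_of_mem _ (Finset.mem_univ _))
    (by rw [Finset.card_image_of_injective _ (Option.some_injective _)]; exact hgood)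
  obtain ⟨S₃, hS₃, hcard₃⟩ := Finset.exists_subset_card_eq (Nat.succ_le_of_lt hc)
  set o := S₃.orderEmbOfFin hcard₃
  have hmem : ∀ k, o k ∈ T ∧ (a (o k) ∉ E ∧ b (o k) ∉ E) ∧ col (o k) = c := by
    intro k
    have h := hS₃ (Finset.orderEmbOfFin_mem S₃ hcard₃ k)
    simp only [Finset.mem_filter, not_or] at h
    exact ⟨h.1.1, h.1.2, h.2⟩
  have hP : ∀ k, ∃ c', c = some c' ∧ a (o k) ∈ P c' := by
    intro k
    obtain ⟨c', h, h'⟩ := hcol (o k) (by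
      have := hmem k
      simp only [Finset.mem_filter, not_or]
      exact ⟨this.1, this.2.1⟩)
    exact ⟨c', (hmem k).2.2 ▸ h, h'⟩
  obtain ⟨c', hc', h0⟩ := hP 0
  obtain ⟨c'', hc'', h2⟩ := hP 2
  obtain rfl : c' = c'' := Option.some_injective _ (hc'.symm.trans hc'')
  -- In the middle one of the three slabs, `b` is on the other side of the line, hence in another
  -- piece. But its `y`-coordinate lies between those of the outer two points `a`, so the two pieces
  -- are not separated.
  obtain ⟨d, hd⟩ := hcov (o 1) (hmem 1).1 (b (o 1)) (Or.inr rfl) (hmem 1).2.1.2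
  have hdc : d ≠ c' := by
    rintro rfl
    rcases hside d with h | h
    · exact absurd (h _ hd) (not_lt.2 (hT _ (hmem 1).1).2.2)
    · exact absurd (h _ h0) (not_le.2 (hT _ (hmem 0).1).2.1)
  have e1 := hainj (o 0) (hmem 0).1 (o 1) (hmem 1).1 _ _ (Or.inl rfl) (Or.inr rfl)
    (o.lt_iff_lt.2 (by decide))
  have e2 := hainj (o 1) (hmem 1).1 (o 2) (hmem 2).1 _ _ (Or.inr rfl) (Or.inl rfl)
    (o.lt_iff_lt.2 (by decide))
  rcases (hsep d c' hdc).2 with h | h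
  · exact lt_asymm e1 (h _ hd _ h0)
  · exact lt_asymm e2 (h _ hd _ h2)

/-- Among many slabs of a concentrated set, with an interval of `x`-coordinates for each, there are
`n` whose intervals are disjoint and monotonically arranged. -/
theorem exists_arranged (q r n : ℕ) : ∃ m : ℕ, ∀ {ι : Type} [DecidableEq ι] {x y : ι → ℕ},
    Function.Injective x → ∀ {A : Finset ι}, Conc x y q r A → ∀ {s t : ℕ → ℕ}, Stacked s t m →
    ∀ {a b : ℕ → ι}, (∀ i < m, a i ∈ A ∧ s i ≤ y (a i) ∧ y (a i) < t i) →
    (∀ i < m, b i ∈ A ∧ s i ≤ y (b i) ∧ y (b i) < t i) →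
    ∃ g : ℕ → ℕ, (∀ i < n, g i < m) ∧ (∀ i j, i < j → j < n → g i < g j) ∧
      ((∀ i j, i < j → j < n → x (b (g i)) < x (a (g j))) ∨
        ∀ i j, i < j → j < n → x (b (g j)) < x (a (g i))) := by
  classical
  obtain ⟨M₁, h₁⟩ := exists_homogeneous n n
  obtain ⟨M₂, h₂⟩ := exists_homogeneous M₁ (2 * q + r + 2)
  refine ⟨M₂, fun {ι} _ {x y} hx {A} hA {s t} hst {a b} ha hb => ?_⟩
  have hnum : ∀ (T : Finset ℕ), T ⊆ Finset.range M₂ → T.card = n →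
      ∃ g : ℕ → ℕ, (∀ i < n, g i < M₂) ∧ (∀ i < n, g i ∈ T) ∧
        (∀ i j, i < j → j < n → g i < g j) := by
    intro T hT hc
    refine ⟨fun i => if h : i < n then T.orderEmbOfFin hc ⟨i, h⟩ else 0, ?_, ?_, ?_⟩
    · intro i hi
      simp only [hi, dif_pos]
      exact Finset.mem_range.1 (hT (Finset.orderEmbOfFin_mem T hc _))
    · intro i hi
      simp only [hi, dif_pos]
      exact Finset.orderEmbOfFin_mem T hc _
    · intro i j hij hj
      simp only [hj, hij.trans hj, dif_pos]
      exact (T.orderEmbOfFin hc).lt_iff_lt.2 hij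
  rcases h₂ (fun i j => x (b i) < x (a j) ∨ x (b j) < x (a i)) (Finset.range M₂) (by simp) with
    ⟨T, hT, hc, h⟩ | ⟨T, hT, hc, h⟩
  · rcases h₁ (fun i j => x (b i) < x (a j)) T hc.ge with ⟨T', hT', hc', h'⟩ | ⟨T', hT', hc', h'⟩
    · obtain ⟨g, g1, g2, g3⟩ := hnum T' (hT'.trans hT) hc'
      exact ⟨g, g1, g3, Or.inl fun i j hij hj =>
        h' _ (g2 i (hij.trans hj)) _ (g2 j hj) (g3 i j hij hj)⟩
    · obtain ⟨g, g1, g2, g3⟩ := hnum T' (hT'.trans hT) hc'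
      exact ⟨g, g1, g3, Or.inr fun i j hij hj =>
        (h _ (hT' (g2 i (hij.trans hj))) _ (hT' (g2 j hj)) (g3 i j hij hj)).resolve_left
          (h' _ (g2 i (hij.trans hj)) _ (g2 j hj) (g3 i j hij hj))⟩
  · exfalso
    -- Helly's theorem on the line: if no two of the intervals are disjoint, the line at the largest
    -- left endpoint meets them all. Apart from `i₀` itself there are `2 * q + r + 1` slabs with
    -- points on both sides, one too many for `card_crossing_le`.
    obtain ⟨i₀, hi₀, hmax⟩ := Finset.exists_max_image T (fun i => x (a i))
      (Finset.card_pos.1 (by omega))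
    have hle := card_crossing_le hA hst ha hb (x (a i₀)) (T.erase i₀) ?_
    · rw [Finset.card_erase_of_mem hi₀] at hle
      omega
    · intro i hi
      have hiT := Finset.mem_of_mem_erase hi
      have hne := Finset.ne_of_mem_erase hi
      have him := Finset.mem_range.1 (hT hiT)
      have hi₀m := Finset.mem_range.1 (hT hi₀)
      refine ⟨him, lt_of_le_of_ne (hmax i hiT) fun heq => ?_, ?_⟩
      · have := hx heq
        have h3 := ha i him
        have h4 := ha i₀ hi₀m
        rw [this] at h3
        rcases lt_or_gt_of_ne hne with h' | h'
        · have := hst i i₀ h' hi₀m; omega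
        · have := hst i₀ i h' him; omega
      · rcases lt_or_gt_of_ne hne with h' | h'
        · have := h i hiT i₀ hi₀ h'
          push Not at this
          exact this.1
        · have := h i₀ hi₀ i hiT h'
          push Not at this
          exact this.2

/-! ### Slicing lines for a system of cells -/

/-- The points of a permutation are covered by concentrated cells in columns and rows. -/
structure CellSystem {N : ℕ} (x y : Fin N → ℕ) (q r : ℕ) {κ : Type} (A : κ → Finset (Fin N))
    (col row : κ → ℕ) : Prop where
  cover : ∀ i, ∃ α, i ∈ A α
  col_lt : ∀ α β, col α < col β → ∀ a ∈ A α, ∀ b ∈ A β, x a < x b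
  row_lt : ∀ α β, row α < row β → ∀ a ∈ A α, ∀ b ∈ A β, y a < y b
  inj : ∀ α β, col α = col β → row α = row β → α = β
  concx : ∀ α, Conc x y q r (A α)
  concy : ∀ α, Conc y x q r (A α)

namespace CellSystem

variable {N : ℕ} {x y : Fin N → ℕ} {q r : ℕ} {κ : Type} {A : κ → Finset (Fin N)}
  {col row : κ → ℕ}

theorem swap (h : CellSystem x y q r A col row) : CellSystem y x q r A row col :=
  ⟨h.cover, h.row_lt, h.col_lt, fun α β h1 h2 => h.inj α β h2 h1, h.concy, h.concx⟩

theorem sep_x (h : CellSystem x y q r A col row) {α β : κ} (hne : col α ≠ col β) :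
    Sep x (A α) (A β) := by
  rcases lt_or_gt_of_ne hne with h' | h'
  · exact Or.inl (h.col_lt α β h')
  · exact Or.inr fun a ha b hb => h.col_lt β α h' b hb a ha

theorem sep_y (h : CellSystem x y q r A col row) {α β : κ} (hne : row α ≠ row β) :
    Sep y (A α) (A β) := h.swap.sep_x hne

end CellSystem

theorem Sep.symm {ι : Type} {f : ι → ℕ} {S T : Finset ι} (h : Sep f S T) : Sep f T S :=
  h.elim (fun h => Or.inr fun t ht s hs => h s hs t ht) fun h => Or.inl fun t ht s hs => h s hs t ht

theorem Sep.mono {ι : Type} {f : ι → ℕ} {S T S' T' : Finset ι} (h : Sep f S T) (hS : S' ⊆ S)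
    (hT : T' ⊆ T) : Sep f S' T' :=
  h.imp (fun h s hs t ht => h s (hS hs) t (hT ht)) fun h s hs t ht => h s (hS hs) t (hT ht)

theorem Sep.ne {ι : Type} {f : ι → ℕ} {S T : Finset ι} (h : Sep f S T) {a b : ι} (ha : a ∈ S)
    (hb : b ∈ T) : a ≠ b := by
  rintro rfl
  rcases h with h | h <;> exact lt_irrefl _ (h a ha a hb)

/-- The points of `A` with `y`-coordinate in `[a, b)`. -/
def slab {ι : Type} (y : ι → ℕ) (a b : ℕ) (A : Finset ι) : Finset ι :=
  A.filter fun i => a ≤ y i ∧ y i < b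

theorem mem_slab {ι : Type} {y : ι → ℕ} {a b : ℕ} {A : Finset ι} {i : ι} :
    i ∈ slab y a b A ↔ i ∈ A ∧ a ≤ y i ∧ y i < b := by simp [slab]

theorem slab_mono {ι : Type} {y : ι → ℕ} {a b a' b' : ℕ} {A : Finset ι} (ha : a' ≤ a)
    (hb : b ≤ b') : slab y a b A ⊆ slab y a' b' A := by
  intro i hi
  rw [mem_slab] at hi ⊢
  exact ⟨hi.1, by omega, by omega⟩

/-- `S` contains an increasing and a decreasing pair. -/
def NonMono {ι : Type} (x y : ι → ℕ) (S : Finset ι) : Prop :=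
  (∃ i ∈ S, ∃ j ∈ S, x i < x j ∧ y i < y j) ∧ ∃ i ∈ S, ∃ j ∈ S, x i < x j ∧ y j < y i

theorem NonMono.mono {ι : Type} {x y : ι → ℕ} {S T : Finset ι} (h : NonMono x y S) (hST : S ⊆ T) :
    NonMono x y T := by
  obtain ⟨⟨i, hi, j, hj, h1⟩, k, hk, l, hl, h2⟩ := h
  exact ⟨⟨i, hST hi, j, hST hj, h1⟩, k, hST hk, l, hST hl, h2⟩

theorem NonMono.swap {ι : Type} {x y : ι → ℕ} {S : Finset ι} (h : NonMono x y S) :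
    NonMono y x S := by
  obtain ⟨⟨i, hi, j, hj, h1⟩, k, hk, l, hl, h2⟩ := h
  exact ⟨⟨i, hi, j, hj, h1.symm⟩, l, hl, k, hk, h2.symm⟩

section Lines

variable {C : PermClass} {N : ℕ} {π : Equiv.Perm (Fin N)} {x y : Fin N → ℕ} {q r : ℕ} {κ : Type}
  {A : κ → Finset (Fin N)} {col row : κ → ℕ}

/-- The alternative in `exists_stacked_or_lines` would contradict `two_pow_le_speed`. A single row
cannot meet both cells because it holds at most one point. -/
theorem exists_lines_of_two_pow (hπ : (⟨N, π⟩ : FinPerm) ∈ C.carrier) (hxy : Coords π x y)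
    (hA : CellSystem x y q r A col row) {n : ℕ} (hn : (n + 1) ^ 2 * C.speed n < 2 ^ n) {α β : κ}
    (hαβ : col α ≠ col β) :
    ∃ T : Finset ℕ, T.card ≤ 2 * n ∧ ∀ a b, (slab y a b (A α)).Nonempty →
      (slab y a b (A β)).Nonempty → ∃ c ∈ T, a < c ∧ c < b := by
  have hsep := hA.sep_x hαβ
  rcases isEmpty_or_nonempty (Fin N) with hN | hN
  · exact ⟨∅, by simp, fun a b ⟨i, _⟩ => (hN.false i).elim⟩
  rcases exists_stacked_or_lines
    (fun a b => (slab y a b (A α)).Nonempty ∧ (slab y a b (A β)).Nonempty)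
    (fun a b a' b' ha hb h => ⟨h.1.mono (slab_mono ha hb), h.2.mono (slab_mono ha hb)⟩) (by
      rintro a ⟨⟨i, hi⟩, j, hj⟩
      rw [mem_slab] at hi hj
      exact hsep.ne hi.1 hj.1 (hxy.symm.injective (by omega))) n with
    ⟨s, t, h1, h2⟩ | ⟨T, hT, h⟩
  · have h3 : ∀ i, ∃ u, i < n → u ∈ slab y (s i) (t i) (A α) := fun i => by
      by_cases hi : i < n
      · exact (h1 i hi).1.imp fun u hu _ => hu
      · exact ⟨Classical.arbitrary _, fun h => absurd h hi⟩
    have h4 : ∀ i, ∃ u, i < n → u ∈ slab y (s i) (t i) (A β) := fun i => by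
      by_cases hi : i < n
      · exact (h1 i hi).2.imp fun u hu _ => hu
      · exact ⟨Classical.arbitrary _, fun h => absurd h hi⟩
    choose a ha using h3
    choose b hb using h4
    exact absurd (two_pow_le_speed C hπ hxy n hsep h2 (fun i hi => mem_slab.1 (ha i hi))
      fun i hi => mem_slab.1 (hb i hi)) (not_le.2 hn)
  · exact ⟨T, hT, fun a b ha hb => h a b ⟨ha, hb⟩⟩

theorem exists_lines_of_three_cells (hπ : (⟨N, π⟩ : FinPerm) ∈ C.carrier) (hxy : Coords π x y)
    (hA : CellSystem x y q r A col row) {n : ℕ}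
    (hn : (n + 1) ^ 2 * C.speed n < (pellWords n).card) {α : Fin 3 → κ}
    (h01 : col (α 0) < col (α 1)) (h12 : col (α 1) < col (α 2)) :
    ∃ T : Finset ℕ, T.card ≤ 2 * n ∧ ∀ a b, (∀ k, (slab y a b (A (α k))).Nonempty) →
      ∃ c ∈ T, a < c ∧ c < b := by
  rcases isEmpty_or_nonempty (Fin N) with hN | hN
  · exact ⟨∅, by simp, fun a b h => (hN.false (h 0).choose).elim⟩
  rcases exists_stacked_or_lines (fun a b => ∀ k, (slab y a b (A (α k))).Nonempty)
    (fun a b a' b' ha hb h k => (h k).mono (slab_mono ha hb)) (by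
      intro a h
      obtain ⟨i, hi⟩ := h 0
      obtain ⟨j, hj⟩ := h 1
      rw [mem_slab] at hi hj
      exact (hA.sep_x h01.ne).ne hi.1 hj.1 (hxy.symm.injective (by omega))) n with
    ⟨s, t, h1, h2⟩ | ⟨T, hT, h⟩
  · have h3 : ∀ k i, ∃ u, i < n → u ∈ slab y (s i) (t i) (A (α k)) := fun k i => by
      by_cases hi : i < n
      · exact (h1 i hi k).imp fun u hu _ => hu
      · exact ⟨Classical.arbitrary _, fun h => absurd h hi⟩
    choose p hp using h3
    have hp' : ∀ k i, i < n → _ := fun k i hi => mem_slab.1 (hp k i hi)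
    have hy : ∀ c d i j, i < j → j < n → y (p c i) < y (p d j) := by
      intro c d i j hij hj
      have e1 := hp' c i (hij.trans hj)
      have e2 := hp' d j hj
      have e3 := h2 i j hij hj
      omega
    refine absurd (card_pellWords_le_of_three_cells C hπ hxy n (U := fun k => A (α k)) ?_ ?_
      (fun c i hi => (hp' c i hi).1) (fun c d _ _ => hy c d) (Or.inl fun c d _ _ => hy c d))
      (not_le.2 hn)
    · refine Or.inl fun a ha b hb => ?_
      rcases Finset.mem_union.1 hb with hb | hb
      · exact hA.col_lt _ _ h01 a ha b hb
      · exact hA.col_lt _ _ (h01.trans h12) a ha b hb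
    · refine Or.inl (Or.inr fun a ha b hb => ?_)
      rcases Finset.mem_union.1 hb with hb | hb
      · exact hA.col_lt _ _ (h01.trans h12) b hb a ha
      · exact hA.col_lt _ _ h12 b hb a ha
  · exact ⟨T, hT, h⟩

/-- Many stacked slabs of this kind would, after `exists_arranged` is applied to the leftmost and
rightmost points of `A α` in each, contain `n` slabs whose `α`-parts are arranged monotonically.
Each part contains pairs of both directions, so one of them goes against the arrangement and
`card_pellWords_le_of_inverted_pairs` applies. -/
theorem exists_lines_of_nonMono (q r n : ℕ) : ∃ m : ℕ, ∀ {C : PermClass} {N : ℕ}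
    {π : Equiv.Perm (Fin N)} {x y : Fin N → ℕ} {κ : Type} {A : κ → Finset (Fin N)}
    {col row : κ → ℕ}, (⟨N, π⟩ : FinPerm) ∈ C.carrier → Coords π x y →
    CellSystem x y q r A col row → (n + 1) ^ 2 * C.speed n < (pellWords n).card →
    ∀ {α β : κ}, col α ≠ col β → ∃ T : Finset ℕ, T.card ≤ m ∧ ∀ a b,
      NonMono x y (slab y a b (A α)) → (slab y a b (A β)).Nonempty → ∃ c ∈ T, a < c ∧ c < b := by
  obtain ⟨m, hm⟩ := exists_arranged q r n
  refine ⟨2 * m, fun {C N π x y κ A col row} hπ hxy hA hn {α β} hαβ => ?_⟩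
  have hsep := hA.sep_x hαβ
  rcases isEmpty_or_nonempty (Fin N) with hN | hN
  · exact ⟨∅, by simp, fun a b _ ⟨i, _⟩ => (hN.false i).elim⟩
  rcases exists_stacked_or_lines
    (fun a b => NonMono x y (slab y a b (A α)) ∧ (slab y a b (A β)).Nonempty)
    (fun a b a' b' ha hb h => ⟨h.1.mono (slab_mono ha hb), h.2.mono (slab_mono ha hb)⟩) (by
      rintro a ⟨⟨⟨i, hi, -⟩, -⟩, j, hj⟩
      rw [mem_slab] at hi hj
      exact hsep.ne hi.1 hj.1 (hxy.symm.injective (by omega))) m with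
    ⟨s, t, h1, h2⟩ | ⟨T, hT, h⟩
  · have h3 : ∀ i, ∃ u v u₁ v₁ u₂ v₂ b : Fin N, i < m →
        b ∈ slab y (s i) (t i) (A β) ∧
        (u ∈ slab y (s i) (t i) (A α) ∧ v ∈ slab y (s i) (t i) (A α) ∧
          ∀ w ∈ slab y (s i) (t i) (A α), x u ≤ x w ∧ x w ≤ x v) ∧
        (u₁ ∈ slab y (s i) (t i) (A α) ∧ v₁ ∈ slab y (s i) (t i) (A α) ∧ x u₁ < x v₁ ∧
          y u₁ < y v₁) ∧
        (u₂ ∈ slab y (s i) (t i) (A α) ∧ v₂ ∈ slab y (s i) (t i) (A α) ∧ x u₂ < x v₂ ∧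
          y v₂ < y u₂) := fun i => by
      by_cases hi : i < m
      · obtain ⟨⟨⟨u₁, hu₁, v₁, hv₁, h11⟩, u₂, hu₂, v₂, hv₂, h22⟩, b, hb⟩ := h1 i hi
        obtain ⟨u, hu, hu'⟩ := Finset.exists_min_image _ x ⟨u₁, hu₁⟩
        obtain ⟨v, hv, hv'⟩ := Finset.exists_max_image _ x ⟨u₁, hu₁⟩
        exact ⟨u, v, u₁, v₁, u₂, v₂, b, fun _ => ⟨hb, ⟨hu, hv, fun w hw => ⟨hu' w hw, hv' w hw⟩⟩,
          ⟨hu₁, hv₁, h11⟩, hu₂, hv₂, h22⟩⟩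
      · have o := Classical.arbitrary (Fin N)
        exact ⟨o, o, o, o, o, o, o, fun h => absurd h hi⟩
    choose u v u₁ v₁ u₂ v₂ b H using h3
    obtain ⟨g, g1, g2, g3⟩ := hm hxy.injective (hA.concx α) h2
      (fun i hi => mem_slab.1 (H i hi).2.1.1) (fun i hi => mem_slab.1 (H i hi).2.1.2.1)
    have hst : Stacked (s ∘ g) (t ∘ g) n := fun i j hij hj => h2 _ _ (g2 i j hij hj) (g1 j hj)
    have hinterval : ∀ i < n, ∀ w ∈ slab y (s (g i)) (t (g i)) (A α),
        x (u (g i)) ≤ x w ∧ x w ≤ x (v (g i)) := fun i hi => (H _ (g1 i hi)).2.1.2.2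
    refine absurd ?_ (not_le.2 hn)
    -- An increasing arrangement calls for the decreasing pairs, a decreasing arrangement for the
    -- increasing ones.
    rcases g3 with g3 | g3
    · have hp : ∀ c, ∀ i < n, (bif c then u₂ (g i) else v₂ (g i)) ∈
          slab y (s (g i)) (t (g i)) (A α) := by
        rintro (_ | _) i hi
        · exact (H _ (g1 i hi)).2.2.2.2.1
        · exact (H _ (g1 i hi)).2.2.2.1
      refine card_pellWords_le_of_inverted_pairs C hπ hxy n hsep.symm hst
        (b := fun i => b (g i)) (p := fun c i => bif c then u₂ (g i) else v₂ (g i))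
        (fun i hi => mem_slab.1 (H _ (g1 i hi)).1) (fun c i hi => mem_slab.1 (hp c i hi))
        (fun i hi => (H _ (g1 i hi)).2.2.2.2.2.2) (Or.inl ⟨fun c d i j hij hj => ?_,
          fun i hi => (H _ (g1 i hi)).2.2.2.2.2.1⟩)
      exact ((hinterval i (hij.trans hj) _ (hp c i (hij.trans hj))).2.trans_lt
        (g3 i j hij hj)).trans_le (hinterval j hj _ (hp d j hj)).1
    · have hp : ∀ c, ∀ i < n, (bif c then v₁ (g i) else u₁ (g i)) ∈
          slab y (s (g i)) (t (g i)) (A α) := by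
        rintro (_ | _) i hi
        · exact (H _ (g1 i hi)).2.2.1.1
        · exact (H _ (g1 i hi)).2.2.1.2.1
      refine card_pellWords_le_of_inverted_pairs C hπ hxy n hsep.symm hst
        (b := fun i => b (g i)) (p := fun c i => bif c then v₁ (g i) else u₁ (g i))
        (fun i hi => mem_slab.1 (H _ (g1 i hi)).1) (fun c i hi => mem_slab.1 (hp c i hi))
        (fun i hi => (H _ (g1 i hi)).2.2.1.2.2.2) (Or.inr ⟨fun c d i j hij hj => ?_,
          fun i hi => (H _ (g1 i hi)).2.2.1.2.2.1⟩)
      exact ((hinterval j hj _ (hp d j hj)).2.trans_lt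
        (g3 i j hij hj)).trans_le (hinterval i (hij.trans hj) _ (hp c i (hij.trans hj))).1
  · exact ⟨T, hT, fun a b h1 h2 => h a b ⟨h1, h2⟩⟩

/-- The cell `β` is the corner of an L with arms `α` in its row and `γ` in its column. Letters 0, 1,
2 stand for points of `α`, `β`, `γ`. The slabs order the letters 0 and 1 by `y`. Once the
`x`-intervals of `β` are arranged monotonically, each point of `γ` inherits its place from the
interval it lies over, so that the letters 1 and 2 are ordered by `x`. -/
theorem exists_lines_of_corner (q r n : ℕ) : ∃ m : ℕ, ∀ {C : PermClass} {N : ℕ}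
    {π : Equiv.Perm (Fin N)} {x y : Fin N → ℕ} {κ : Type} {A : κ → Finset (Fin N)}
    {col row : κ → ℕ}, (⟨N, π⟩ : FinPerm) ∈ C.carrier → Coords π x y →
    CellSystem x y q r A col row → (n + 1) ^ 2 * C.speed n < (pellWords n).card →
    ∀ {α β γ : κ}, col α ≠ col β → row α = row β → row γ ≠ row β → col γ = col β →
    ∃ T : Finset ℕ, T.card ≤ m ∧ ∀ a b, (slab y a b (A α)).Nonempty →
      (∃ u ∈ slab y a b (A β), ∃ v ∈ slab y a b (A β), ∃ w ∈ A γ, x u ≤ x w ∧ x w ≤ x v) →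
      ∃ c ∈ T, a < c ∧ c < b := by
  obtain ⟨m, hm⟩ := exists_arranged q r n
  refine ⟨2 * m, fun {C N π x y κ A col row} hπ hxy hA hn {α β γ} hαβ hαβ' hγβ hγβ' => ?_⟩
  have hsep := hA.sep_x hαβ
  rcases isEmpty_or_nonempty (Fin N) with hN | hN
  · exact ⟨∅, by simp, fun a b ⟨i, _⟩ => (hN.false i).elim⟩
  rcases exists_stacked_or_lines
    (fun a b => (slab y a b (A α)).Nonempty ∧
      ∃ u ∈ slab y a b (A β), ∃ v ∈ slab y a b (A β), ∃ w ∈ A γ, x u ≤ x w ∧ x w ≤ x v)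
    (by
      rintro a b a' b' ha hb ⟨h1, u, hu, v, hv, w, hw, h⟩
      exact ⟨h1.mono (slab_mono ha hb), u, slab_mono ha hb hu, v, slab_mono ha hb hv, w, hw, h⟩) (by
      rintro a ⟨⟨i, hi⟩, j, hj, -⟩
      rw [mem_slab] at hi hj
      exact hsep.ne hi.1 hj.1 (hxy.symm.injective (by omega))) m with ⟨s, t, h1, h2⟩ | ⟨T, hT, h⟩
  · have h3 : ∀ i, ∃ a u v w : Fin N, i < m →
        a ∈ slab y (s i) (t i) (A α) ∧ u ∈ slab y (s i) (t i) (A β) ∧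
        v ∈ slab y (s i) (t i) (A β) ∧ w ∈ A γ ∧ x u ≤ x w ∧ x w ≤ x v := fun i => by
      by_cases hi : i < m
      · obtain ⟨⟨a, ha⟩, u, hu, v, hv, w, hw, h'⟩ := h1 i hi
        exact ⟨a, u, v, w, fun _ => ⟨ha, hu, hv, hw, h'⟩⟩
      · have o := Classical.arbitrary (Fin N)
        exact ⟨o, o, o, o, fun h => absurd h hi⟩
    choose a u v w H using h3
    obtain ⟨g, g1, g2, g3⟩ := hm hxy.injective (hA.concx β) h2
      (fun i hi => mem_slab.1 (H i hi).2.1) (fun i hi => mem_slab.1 (H i hi).2.2.1)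
    refine absurd ?_ (not_le.2 hn)
    set p : Fin 3 → ℕ → Fin N := ![a ∘ g, u ∘ g, w ∘ g] with hp
    have hlet : ∀ c : Fin 3, c = 0 ∨ c = 1 ∨ c = 2 := by decide
    have hcolαγ : col α ≠ col γ := by rw [hγβ']; exact hαβ
    have hrowγα : row γ ≠ row α := by rw [hαβ']; exact hγβ
    have hpI : ∀ c, c ≠ 0 → ∀ i < n, x (u (g i)) ≤ x (p c i) ∧ x (p c i) ≤ x (v (g i)) := by
      intro c hc i hi
      have := H _ (g1 i hi)
      rcases hlet c with rfl | rfl | rfl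
      · exact absurd rfl hc
      · exact ⟨le_rfl, this.2.2.2.2.1.trans this.2.2.2.2.2⟩
      · exact this.2.2.2.2
    have hpY : ∀ c, c ≠ 2 → ∀ i < n, s (g i) ≤ y (p c i) ∧ y (p c i) < t (g i) := by
      intro c hc i hi
      have := H _ (g1 i hi)
      rcases hlet c with rfl | rfl | rfl
      · exact (mem_slab.1 this.1).2
      · exact (mem_slab.1 this.2.1).2
      · exact absurd rfl hc
    refine card_pellWords_le_of_three_cells C hπ hxy n (U := ![A α, A β, A γ]) (p := p)
      ?_ (Or.inr ?_) ?_ ?_ (Or.inr ?_)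
    · simp only [Matrix.cons_val]
      rcases lt_or_gt_of_ne hαβ with h | h
      · refine Or.inl fun a ha b hb => ?_
        rcases Finset.mem_union.1 hb with hb | hb
        · exact hA.col_lt _ _ h a ha b hb
        · exact hA.col_lt _ _ (hγβ' ▸ h) a ha b hb
      · refine Or.inr fun a ha b hb => ?_
        rcases Finset.mem_union.1 hb with hb | hb
        · exact hA.col_lt _ _ h b hb a ha
        · exact hA.col_lt _ _ (hγβ' ▸ h) b hb a ha
    · simp only [Matrix.cons_val]
      rcases lt_or_gt_of_ne hγβ with h | h
      · refine Or.inl fun a ha b hb => ?_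
        rcases Finset.mem_union.1 hb with hb | hb
        · exact hA.row_lt _ _ (hαβ' ▸ h) a ha b hb
        · exact hA.row_lt _ _ h a ha b hb
      · refine Or.inr fun a ha b hb => ?_
        rcases Finset.mem_union.1 hb with hb | hb
        · exact hA.row_lt _ _ (hαβ' ▸ h) b hb a ha
        · exact hA.row_lt _ _ h b hb a ha
    · intro c i hi
      have := H _ (g1 i hi)
      rcases hlet c with rfl | rfl | rfl
      · exact (mem_slab.1 this.1).1
      · exact (mem_slab.1 this.2.1).1
      · exact this.2.2.2.1
    · intro c d hc hd i j hij hj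
      have e1 := hpY c hc i (hij.trans hj)
      have e2 := hpY d hd j hj
      have e3 := h2 _ _ (g2 i j hij hj) (g1 j hj)
      omega
    · rcases g3 with g3 | g3
      · exact Or.inl fun c d hc hd i j hij hj => ((hpI c hc i (hij.trans hj)).2.trans_lt
          (g3 i j hij hj)).trans_le (hpI d hd j hj).1
      · exact Or.inr fun c d hc hd i j hij hj => ((hpI d hd j hj).2.trans_lt
          (g3 i j hij hj)).trans_le (hpI c hc i (hij.trans hj)).1
  · exact ⟨T, hT, fun a b h1 h2 => h a b ⟨h1, h2⟩⟩

end Lines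

/-! ### Pieces that no line cuts -/

theorem OneSided.mono {ι : Type} {f : ι → ℕ} {L : ℕ} {S T : Finset ι} (h : OneSided f L T)
    (hST : S ⊆ T) : OneSided f L S :=
  h.imp (fun h s hs => h s (hST hs)) fun h s hs => h s (hST hs)

theorem OneSided.lt_iff {ι : Type} {f : ι → ℕ} {L : ℕ} {S : Finset ι} (h : OneSided f L S)
    {u v : ι} (hu : u ∈ S) (hv : v ∈ S) : f u < L ↔ f v < L := by
  rcases h with h | h
  · simp [h u hu, h v hv]
  · simp [not_lt.2 (h u hu), not_lt.2 (h v hv)]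

/-- If the two sets were on opposite sides, the line itself would separate them. -/
theorem OneSided.lt_iff_of_not_sep {ι : Type} {f : ι → ℕ} {L : ℕ} {S T : Finset ι}
    (hS : OneSided f L S) (hT : OneSided f L T) (h : ¬ Sep f S T) {u v : ι} (hu : u ∈ S)
    (hv : v ∈ T) : f u < L ↔ f v < L := by
  rcases hS with h1 | h1 <;> rcases hT with h2 | h2
  · simp [h1 u hu, h2 v hv]
  · exact absurd (Or.inl fun s hs t ht => (h1 s hs).trans_le (h2 t ht)) h
  · exact absurd (Or.inr fun s hs t ht => (h2 t ht).trans_le (h1 s hs)) h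
  · simp [not_lt.2 (h1 u hu), not_lt.2 (h2 v hv)]

theorem nonempty_of_not_sep {ι : Type} {f : ι → ℕ} {S T : Finset ι} (h : ¬ Sep f S T) :
    S.Nonempty ∧ T.Nonempty := by
  constructor
  · rw [Finset.nonempty_iff_ne_empty]
    rintro rfl
    exact h (Or.inl (by simp))
  · rw [Finset.nonempty_iff_ne_empty]
    rintro rfl
    exact h (Or.inl (by simp))

/-- `S` is not cut by any of the lines in `T`. -/
def Sliced {ι : Type} (f : ι → ℕ) (T : Finset ℕ) (S : Finset ι) : Prop :=
  ∀ c ∈ T, OneSided f c S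

theorem Sliced.anti {ι : Type} {f : ι → ℕ} {T T' : Finset ℕ} {S : Finset ι} (h : Sliced f T' S)
    (hT : T ⊆ T') : Sliced f T S := fun c hc => h c (hT hc)

/-- Points not separated by lines lie in a slab that no line slices. -/
theorem exists_slab {ι : Type} {y : ι → ℕ} {T : Finset ℕ} {V : Finset ι} (hV : V.Nonempty)
    (h : ∀ u ∈ V, ∀ v ∈ V, ∀ c ∈ T, y u < c ↔ y v < c) :
    ∃ a b, (∀ u ∈ V, a ≤ y u ∧ y u < b) ∧ ∀ c ∈ T, ¬ (a < c ∧ c < b) := by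
  obtain ⟨u, hu, hu'⟩ := Finset.exists_min_image V y hV
  obtain ⟨v, hv, hv'⟩ := Finset.exists_max_image V y hV
  refine ⟨y u, y v + 1, fun w hw => ⟨hu' w hw, by have := hv' w hw; omega⟩, fun c hc hcc => ?_⟩
  have := h u hu v hv c hc
  omega

/-- This converts the statements about slabs into statements about pieces: two uncut pieces that
fail to be separated share a slab crossed by no line, which the choice of the lines forbids. -/
theorem exists_slab_of_not_sep {ι : Type} [DecidableEq ι] {y : ι → ℕ} {T : Finset ℕ}
    {S S' : Finset ι} (hS : Sliced y T S) (hS' : Sliced y T S') (h : ¬ Sep y S S') :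
    ∃ a b, (∀ u ∈ S ∪ S', a ≤ y u ∧ y u < b) ∧ ∀ c ∈ T, ¬ (a < c ∧ c < b) := by
  refine exists_slab ((nonempty_of_not_sep h).1.mono Finset.subset_union_left) ?_
  intro u hu v hv c hc
  rcases Finset.mem_union.1 hu with hu | hu <;> rcases Finset.mem_union.1 hv with hv | hv
  · exact (hS c hc).lt_iff hu hv
  · exact (hS c hc).lt_iff_of_not_sep (hS' c hc) h hu hv
  · exact ((hS c hc).lt_iff_of_not_sep (hS' c hc) h hv hu).symm
  · exact (hS' c hc).lt_iff hu hv

/-- Two lines around `S`. -/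
theorem exists_hull_lines {ι : Type} (x : ι → ℕ) (S : Finset ι) : ∃ F : Finset ℕ, F.card ≤ 2 ∧
    ∀ R : Finset ι, Sliced x F R →
      Sep x S R ∨ ∃ u ∈ S, ∃ v ∈ S, ∃ w ∈ R, x u ≤ x w ∧ x w ≤ x v := by
  rcases S.eq_empty_or_nonempty with rfl | hS
  · exact ⟨∅, by simp, fun R _ => Or.inl (Or.inl (by simp))⟩
  obtain ⟨u, hu, hu'⟩ := Finset.exists_min_image S x hS
  obtain ⟨v, hv, hv'⟩ := Finset.exists_max_image S x hS
  refine ⟨{x u, x v + 1}, Finset.card_le_two, fun R hR => ?_⟩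
  rcases R.eq_empty_or_nonempty with rfl | ⟨w, hw⟩
  · exact Or.inl (Or.inl (by simp))
  rcases hR (x u) (by simp) with h1 | h1
  · exact Or.inl (Or.inr fun s hs t ht => (h1 t ht).trans_le (hu' s hs))
  rcases hR (x v + 1) (by simp) with h2 | h2
  · exact Or.inr ⟨u, hu, v, hv, w, hw, h1 w hw, Nat.lt_succ_iff.1 (h2 w hw)⟩
  · exact Or.inl (Or.inl fun s hs t ht => by have := hv' s hs; have := h2 t ht; omega)

/-- Both projections are disjoint. -/
def Indep {ι : Type} (x y : ι → ℕ) (S T : Finset ι) : Prop := Sep x S T ∧ Sep y S T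

theorem Indep.symm {ι : Type} {x y : ι → ℕ} {S T : Finset ι} (h : Indep x y S T) :
    Indep x y T S := ⟨h.1.symm, h.2.symm⟩

theorem Indep.mono {ι : Type} {x y : ι → ℕ} {S T S' T' : Finset ι} (h : Indep x y S T)
    (hS : S' ⊆ S) (hT : T' ⊆ T) : Indep x y S' T' := ⟨h.1.mono hS hT, h.2.mono hS hT⟩

section Lines

variable {C : PermClass} {N : ℕ} {π : Equiv.Perm (Fin N)} {x y : Fin N → ℕ} {q r : ℕ} {κ : Type}
  {A : κ → Finset (Fin N)} {col row : κ → ℕ}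

theorem exists_lines_sep (hπ : (⟨N, π⟩ : FinPerm) ∈ C.carrier) (hxy : Coords π x y)
    (hA : CellSystem x y q r A col row) {n : ℕ} (hn : (n + 1) ^ 2 * C.speed n < 2 ^ n) (α β : κ) :
    ∃ T : Finset ℕ, T.card ≤ 2 * n ∧ (col α ≠ col β → ∀ S ⊆ A α, ∀ S' ⊆ A β,
      Sliced y T S → Sliced y T S' → Sep y S S') := by
  by_cases hαβ : col α = col β
  · exact ⟨∅, by simp, fun h => absurd hαβ h⟩
  obtain ⟨T, hT, h⟩ := exists_lines_of_two_pow hπ hxy hA hn hαβ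
  refine ⟨T, hT, fun _ S hS S' hS' h1 h2 => ?_⟩
  by_contra hsep
  obtain ⟨a, b, hab, hc⟩ := exists_slab_of_not_sep h1 h2 hsep
  obtain ⟨⟨u, hu⟩, v, hv⟩ := nonempty_of_not_sep hsep
  obtain ⟨c, hcT, hc'⟩ := h a b
    ⟨u, mem_slab.2 ⟨hS hu, hab u (Finset.mem_union_left _ hu)⟩⟩
    ⟨v, mem_slab.2 ⟨hS' hv, hab v (Finset.mem_union_right _ hv)⟩⟩
  exact hc c hcT hc'

theorem exists_lines_mono (q r n : ℕ) : ∃ m : ℕ, ∀ {C : PermClass} {N : ℕ}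
    {π : Equiv.Perm (Fin N)} {x y : Fin N → ℕ} {κ : Type} {A : κ → Finset (Fin N)}
    {col row : κ → ℕ}, (⟨N, π⟩ : FinPerm) ∈ C.carrier → Coords π x y →
    CellSystem x y q r A col row → (n + 1) ^ 2 * C.speed n < (pellWords n).card →
    ∀ α β : κ, ∃ T : Finset ℕ, T.card ≤ m ∧ (col α ≠ col β → ∀ S ⊆ A α, ∀ S' ⊆ A β,
      Sliced y T S → Sliced y T S' → ¬ Sep y S S' → ¬ NonMono x y S) := by
  obtain ⟨m, hm⟩ := exists_lines_of_nonMono q r n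
  refine ⟨m, fun {C N π x y κ A col row} hπ hxy hA hn α β => ?_⟩
  by_cases hαβ : col α = col β
  · exact ⟨∅, by simp, fun h => absurd hαβ h⟩
  obtain ⟨T, hT, h⟩ := hm hπ hxy hA hn hαβ
  refine ⟨T, hT, fun _ S hS S' hS' h1 h2 hsep hnon => ?_⟩
  obtain ⟨a, b, hab, hc⟩ := exists_slab_of_not_sep h1 h2 hsep
  obtain ⟨-, v, hv⟩ := nonempty_of_not_sep hsep
  obtain ⟨c, hcT, hc'⟩ := h a b
    (hnon.mono fun u hu => mem_slab.2 ⟨hS hu, hab u (Finset.mem_union_left _ hu)⟩)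
    ⟨v, mem_slab.2 ⟨hS' hv, hab v (Finset.mem_union_right _ hv)⟩⟩
  exact hc c hcT hc'

theorem exists_lines_triple (hπ : (⟨N, π⟩ : FinPerm) ∈ C.carrier) (hxy : Coords π x y)
    (hA : CellSystem x y q r A col row) {n : ℕ}
    (hn : (n + 1) ^ 2 * C.speed n < (pellWords n).card) (α β γ : κ) :
    ∃ T : Finset ℕ, T.card ≤ 2 * n ∧ (col α ≠ col β → col γ ≠ col β → col α ≠ col γ →
      ∀ S ⊆ A α, ∀ S' ⊆ A β, ∀ S'' ⊆ A γ, Sliced y T S → Sliced y T S' → Sliced y T S'' →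
      Sep y S S' ∨ Sep y S' S'') := by
  by_cases hne : col α ≠ col β ∧ col γ ≠ col β ∧ col α ≠ col γ
  swap
  · exact ⟨∅, by simp, fun h1 h2 h3 => absurd ⟨h1, h2, h3⟩ hne⟩
  have hsorted : ∃ T : Finset ℕ, T.card ≤ 2 * n ∧ ∀ a b, (slab y a b (A α)).Nonempty →
      (slab y a b (A β)).Nonempty → (slab y a b (A γ)).Nonempty → ∃ c ∈ T, a < c ∧ c < b := by
    have main : ∀ δ : Fin 3 → κ, col (δ 0) < col (δ 1) → col (δ 1) < col (δ 2) →
        (∀ k, δ k = α ∨ δ k = β ∨ δ k = γ) →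
        ∃ T : Finset ℕ, T.card ≤ 2 * n ∧ ∀ a b, (slab y a b (A α)).Nonempty →
        (slab y a b (A β)).Nonempty → (slab y a b (A γ)).Nonempty → ∃ c ∈ T, a < c ∧ c < b := by
      intro δ h1 h2 h3
      obtain ⟨T, hT, h⟩ := exists_lines_of_three_cells hπ hxy hA hn h1 h2
      refine ⟨T, hT, fun a b ha hb hc => h a b fun k => ?_⟩
      rcases h3 k with h | h | h <;> rw [h] <;> assumption
    obtain ⟨h1, h2, h3⟩ := hne
    rcases lt_or_gt_of_ne h1 with h1 | h1 <;> rcases lt_or_gt_of_ne h2 with h2 | h2 <;>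
      rcases lt_or_gt_of_ne h3 with h3 | h3
    · exact main ![α, γ, β] h3 h2 (by simp [Fin.forall_fin_succ])
    · exact main ![γ, α, β] h3 h1 (by simp [Fin.forall_fin_succ])
    · exact main ![α, β, γ] h1 h2 (by simp [Fin.forall_fin_succ])
    · omega
    · omega
    · exact main ![γ, β, α] h2 h1 (by simp [Fin.forall_fin_succ])
    · exact main ![β, α, γ] h1 h3 (by simp [Fin.forall_fin_succ])
    · exact main ![β, γ, α] h2 h3 (by simp [Fin.forall_fin_succ])
  obtain ⟨T, hT, h⟩ := hsorted
  refine ⟨T, hT, fun _ _ _ S hS S' hS' S'' hS'' h1 h2 h3 => ?_⟩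
  by_contra! hcon
  obtain ⟨hs1, hs2⟩ := hcon
  obtain ⟨⟨u, hu⟩, v, hv⟩ := nonempty_of_not_sep hs1
  obtain ⟨-, w, hw⟩ := nonempty_of_not_sep hs2
  -- One point of each piece suffices. The middle piece is separated from neither of the others, so
  -- all three points are on the same side of each line.
  have hside : ∀ z ∈ ({u, v, w} : Finset (Fin N)), ∀ c ∈ T, y z < c ↔ y v < c := by
    intro z hz c hc
    simp only [Finset.mem_insert, Finset.mem_singleton] at hz
    rcases hz with rfl | rfl | rfl
    · exact (h1 c hc).lt_iff_of_not_sep (h2 c hc) hs1 hu hv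
    · rfl
    · exact ((h2 c hc).lt_iff_of_not_sep (h3 c hc) hs2 hv hw).symm
  obtain ⟨a, b, hab, hc⟩ := exists_slab (V := ({u, v, w} : Finset (Fin N))) (y := y) (T := T)
    (by simp) fun z hz z' hz' c hc => (hside z hz c hc).trans (hside z' hz' c hc).symm
  obtain ⟨c, hcT, hc'⟩ := h a b ⟨u, mem_slab.2 ⟨hS hu, hab u (by simp)⟩⟩
    ⟨v, mem_slab.2 ⟨hS' hv, hab v (by simp)⟩⟩ ⟨w, mem_slab.2 ⟨hS'' hw, hab w (by simp)⟩⟩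
  exact hc c hcT hc'

/-- The horizontal lines come from `exists_lines_of_corner`. They divide `A β` into strips, and two
vertical lines are added around the hull of each strip. A piece of `γ` that these do not cut is
either separated from the strip or has a point over its hull; the latter, with a piece of `α` in the
same strip, is a configuration that a horizontal line would have to slice. -/
theorem exists_lines_corner (q r n : ℕ) : ∃ m : ℕ, ∀ {C : PermClass} {N : ℕ}
    {π : Equiv.Perm (Fin N)} {x y : Fin N → ℕ} {κ : Type} {A : κ → Finset (Fin N)}
    {col row : κ → ℕ}, (⟨N, π⟩ : FinPerm) ∈ C.carrier → Coords π x y →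
    CellSystem x y q r A col row → (n + 1) ^ 2 * C.speed n < (pellWords n).card →
    ∀ α β γ : κ, ∃ Tx Ty : Finset ℕ, Tx.card ≤ m ∧ Ty.card ≤ m ∧
      (col α ≠ col β → row α = row β → row γ ≠ row β → col γ = col β →
      ∀ S ⊆ A α, ∀ S' ⊆ A β, ∀ S'' ⊆ A γ, Sliced y Ty S → Sliced y Ty S' → Sliced x Tx S'' →
      Sep y S S' ∨ Sep x S' S'') := by
  classical
  obtain ⟨m, hm⟩ := exists_lines_of_corner q r n
  refine ⟨2 * (m + 1), fun {C N π x y κ A col row} hπ hxy hA hn α β γ => ?_⟩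
  by_cases hne : col α ≠ col β ∧ row α = row β ∧ row γ ≠ row β ∧ col γ = col β
  swap
  · exact ⟨∅, ∅, by simp, by simp, fun h1 h2 h3 h4 => absurd ⟨h1, h2, h3, h4⟩ hne⟩
  obtain ⟨T, hT, h⟩ := hm hπ hxy hA hn hne.1 hne.2.1 hne.2.2.1 hne.2.2.2
  set U : ℕ → Finset (Fin N) := fun c =>
    (A β).filter fun i => c ≤ y i ∧ ∀ c' ∈ T, c < c' → y i < c' with hU
  choose F hF hFsep using fun c => exists_hull_lines x (U c)
  refine ⟨(insert 0 T).biUnion F, T, ?_, by omega, fun _ _ _ _ S hS S' hS' S'' hS'' h1 h2 h3 => ?_⟩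
  · refine Finset.card_biUnion_le.trans ((Finset.sum_le_card_nsmul _ _ 2 fun c _ => hF c).trans ?_)
    have := Finset.card_insert_le 0 T
    simp only [smul_eq_mul]
    omega
  by_contra! hcon
  obtain ⟨hs1, hs2⟩ := hcon
  obtain ⟨hSne, v, hv⟩ := nonempty_of_not_sep hs1
  -- The strip of `v` starts at the highest line not above it; the extra line at 0 starts the lowest
  -- strip.
  obtain ⟨c, hc, hcmax⟩ := Finset.exists_max_image ((insert 0 T).filter fun c => c ≤ y v) id
    ⟨0, by simp⟩
  obtain ⟨hcT, hcv⟩ := Finset.mem_filter.1 hc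
  have hUside : ∀ u ∈ U c, ∀ c' ∈ T, y u < c' ↔ c < c' := by
    intro u hu c' hc'
    simp only [hU, Finset.mem_filter] at hu
    constructor
    · intro h; omega
    · exact hu.2.2 c' hc'
  have hvU : ∀ z ∈ S', z ∈ U c := by
    intro z hz
    have hz' : ∀ c' ∈ T, y z < c' ↔ y v < c' := fun c' hc' => (h2 c' hc').lt_iff hz hv
    simp only [hU, Finset.mem_filter]
    refine ⟨hS' hz, ?_, fun c' hc' hcc' => ?_⟩
    · rcases Finset.mem_insert.1 hcT with h0 | h0
      · omega
      · have := hz' c h0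
        omega
    · rw [hz' c' hc']
      by_contra hlt
      have := hcmax c' (Finset.mem_filter.2 ⟨Finset.mem_insert_of_mem hc', not_lt.1 hlt⟩)
      simp only [id] at this
      omega
  have hside : ∀ z ∈ S ∪ U c, ∀ c' ∈ T, y z < c' ↔ c < c' := by
    intro z hz c' hc'
    rcases Finset.mem_union.1 hz with hz | hz
    · rw [(h1 c' hc').lt_iff_of_not_sep (h2 c' hc') hs1 hz hv]
      exact hUside v (hvU v hv) c' hc'
    · exact hUside z hz c' hc'
  obtain ⟨a, b, hab, hno⟩ := exists_slab (V := S ∪ U c) (y := y) (T := T)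
    (hSne.mono Finset.subset_union_left)
    fun z hz z' hz' c' hc' => (hside z hz c' hc').trans (hside z' hz' c' hc').symm
  have hUslab : ∀ u ∈ U c, u ∈ slab y a b (A β) := fun u hu =>
    mem_slab.2 ⟨(Finset.mem_filter.1 hu).1, hab u (Finset.mem_union_right _ hu)⟩
  rcases hFsep c S'' (h3.anti (Finset.subset_biUnion_of_mem F hcT)) with hs | ⟨u, hu, z, hz, w, hw, hh⟩
  · exact hs2 (hs.mono hvU (Finset.Subset.refl _))
  · obtain ⟨s, hs⟩ := hSne
    obtain ⟨c', hc', hcc'⟩ := h a b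
      ⟨s, mem_slab.2 ⟨hS hs, hab s (Finset.mem_union_left _ hs)⟩⟩
      ⟨u, hUslab u hu, z, hUslab z hz, w, hS'' hw, hh⟩
    exact hno c' hc' hcc'

/-- Adding lines preserves the properties in question, so the union of the lines for all tuples of
cells serves every tuple at once. -/
theorem exists_union_lines {τ : Type} [Fintype τ] (P : τ → Finset ℕ → Finset ℕ → Prop)
    (hP : ∀ t T₁ T₂ T₁' T₂', T₁ ⊆ T₁' → T₂ ⊆ T₂' → P t T₁ T₂ → P t T₁' T₂') (m : ℕ)
    (h : ∀ t, ∃ T₁ T₂ : Finset ℕ, T₁.card ≤ m ∧ T₂.card ≤ m ∧ P t T₁ T₂) :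
    ∃ T₁ T₂ : Finset ℕ, T₁.card ≤ Fintype.card τ * m ∧ T₂.card ≤ Fintype.card τ * m ∧
      ∀ t, P t T₁ T₂ := by
  classical
  choose T₁ T₂ h1 h2 h3 using h
  refine ⟨Finset.univ.biUnion T₁, Finset.univ.biUnion T₂,
    Finset.card_biUnion_le_card_mul _ _ _ fun t _ => h1 t,
    Finset.card_biUnion_le_card_mul _ _ _ fun t _ => h2 t, fun t => ?_⟩
  exact hP t _ _ _ _ (Finset.subset_biUnion_of_mem T₁ (Finset.mem_univ t))
    (Finset.subset_biUnion_of_mem T₂ (Finset.mem_univ t)) (h3 t)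

/-- If the speed is below `2 ^ n`, boundedly many lines make all cells independent. -/
theorem exists_lines_indep (hπ : (⟨N, π⟩ : FinPerm) ∈ C.carrier) (hxy : Coords π x y)
    [Fintype κ] (hA : CellSystem x y q r A col row) {n : ℕ}
    (hn : (n + 1) ^ 2 * C.speed n < 2 ^ n) :
    ∃ Tx Ty : Finset ℕ, Tx.card ≤ Fintype.card (κ × κ) * (2 * n) ∧
      Ty.card ≤ Fintype.card (κ × κ) * (2 * n) ∧
      ∀ α β, α ≠ β → ∀ S ⊆ A α, ∀ S' ⊆ A β, Sliced x Tx S → Sliced y Ty S → Sliced x Tx S' →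
        Sliced y Ty S' → Indep x y S S' := by
  have hlines := exists_union_lines (τ := κ × κ)
    (fun t Tx Ty => t.1 ≠ t.2 → ∀ S ⊆ A t.1, ∀ S' ⊆ A t.2, Sliced x Tx S → Sliced y Ty S →
      Sliced x Tx S' → Sliced y Ty S' → Indep x y S S')
    (fun t T₁ T₂ T₁' T₂' e1 e2 h hne S hS S' hS' s1 s2 s3 s4 =>
      h hne S hS S' hS' (s1.anti e1) (s2.anti e2) (s3.anti e1) (s4.anti e2)) (2 * n) ?_
  · obtain ⟨Tx, Ty, h1, h2, h⟩ := hlines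
    exact ⟨Tx, Ty, h1, h2, fun α β => h (α, β)⟩
  rintro ⟨α, β⟩
  obtain ⟨Ty, hTy, hy⟩ := exists_lines_sep hπ hxy hA hn α β
  -- Exchanging the coordinates gives the vertical lines. Cells in different columns are already
  -- separated in `x`, and cells in different rows in `y`.
  obtain ⟨Tx, hTx, hx⟩ := exists_lines_sep hπ hxy.symm hA.swap hn α β
  refine ⟨Tx, Ty, hTx, hTy, fun hne S hS S' hS' s1 s2 s3 s4 => ⟨?_, ?_⟩⟩
  · by_cases hr : row α = row β
    · exact (hA.sep_x fun hc => hne (hA.inj _ _ hc hr)).mono hS hS'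
    · exact hx hr S hS S' hS' s1 s3
  · by_cases hc : col α = col β
    · exact (hA.sep_y fun hr => hne (hA.inj _ _ hc hr)).mono hS hS'
    · exact hy hc S hS S' hS' s2 s4

/-- If the speed is below the number of words over `0`, `1`, `21`, boundedly many lines make
interacting pieces monotone, and let each piece interact with at most one other cell. -/
theorem exists_lines_pairs (q r n : ℕ) (κ : Type) [Fintype κ] : ∃ m : ℕ, ∀ {C : PermClass} {N : ℕ}
    {π : Equiv.Perm (Fin N)} {x y : Fin N → ℕ} {A : κ → Finset (Fin N)}
    {col row : κ → ℕ}, (⟨N, π⟩ : FinPerm) ∈ C.carrier → Coords π x y →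
    CellSystem x y q r A col row → (n + 1) ^ 2 * C.speed n < (pellWords n).card →
    ∃ Tx Ty : Finset ℕ, Tx.card ≤ m ∧ Ty.card ≤ m ∧
      ∀ α β γ, ∀ S ⊆ A α, ∀ S' ⊆ A β, ∀ S'' ⊆ A γ, Sliced x Tx S → Sliced y Ty S →
        Sliced x Tx S' → Sliced y Ty S' → Sliced x Tx S'' → Sliced y Ty S'' →
        (α ≠ β → ¬ Indep x y S S' → ¬ NonMono x y S) ∧
        (α ≠ β → γ ≠ β → α ≠ γ → Indep x y S S' ∨ Indep x y S' S'') := by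
  classical
  obtain ⟨m₁, hm₁⟩ := exists_lines_mono q r n
  obtain ⟨m₂, hm₂⟩ := exists_lines_corner q r n
  refine ⟨Fintype.card (κ × κ × κ) * (m₁ + 2 * m₂ + 2 * n),
    fun {C N π x y A col row} hπ hxy hA hn => ?_⟩
  have hlines := exists_union_lines (τ := κ × κ × κ)
    (fun t Tx Ty => ∀ S ⊆ A t.1, ∀ S' ⊆ A t.2.1, ∀ S'' ⊆ A t.2.2, Sliced x Tx S → Sliced y Ty S →
        Sliced x Tx S' → Sliced y Ty S' → Sliced x Tx S'' → Sliced y Ty S'' →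
        (t.1 ≠ t.2.1 → ¬ Indep x y S S' → ¬ NonMono x y S) ∧
        (t.1 ≠ t.2.1 → t.2.2 ≠ t.2.1 → t.1 ≠ t.2.2 → Indep x y S S' ∨ Indep x y S' S''))
    (fun t T₁ T₂ T₁' T₂' e1 e2 h S hS S' hS' S'' hS'' s1 s2 s3 s4 s5 s6 =>
      h S hS S' hS' S'' hS'' (s1.anti e1) (s2.anti e2) (s3.anti e1) (s4.anti e2) (s5.anti e1)
        (s6.anti e2)) (m₁ + 2 * m₂ + 2 * n) ?_
  · obtain ⟨Tx, Ty, h1, h2, h⟩ := hlines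
    exact ⟨Tx, Ty, h1, h2, fun α β γ => h (α, β, γ)⟩
  rintro ⟨α, β, γ⟩
  obtain ⟨Y₁, cY₁, hY₁⟩ := hm₁ hπ hxy hA hn α β
  obtain ⟨X₁, cX₁, hX₁⟩ := hm₁ hπ hxy.symm hA.swap hn α β
  obtain ⟨Y₂, cY₂, hY₂⟩ := exists_lines_triple hπ hxy hA hn α β γ
  obtain ⟨X₂, cX₂, hX₂⟩ := exists_lines_triple hπ hxy.symm hA.swap hn α β γ
  obtain ⟨X₃, Y₃, cX₃, cY₃, h₃⟩ := hm₂ hπ hxy hA hn α β γ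
  -- The two arms of a corner play different roles, so both assignments of `α` and `γ` to them are
  -- needed.
  obtain ⟨X₄, Y₄, cX₄, cY₄, h₄⟩ := hm₂ hπ hxy hA hn γ β α
  have hcard : ∀ T₁ T₂ T₃ T₄ : Finset ℕ, T₁.card ≤ m₁ → T₂.card ≤ 2 * n → T₃.card ≤ m₂ →
      T₄.card ≤ m₂ → ((T₁ ∪ T₂) ∪ (T₃ ∪ T₄)).card ≤ m₁ + 2 * m₂ + 2 * n := by
    intro T₁ T₂ T₃ T₄ _ _ _ _
    have e1 := Finset.card_union_le (T₁ ∪ T₂) (T₃ ∪ T₄)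
    have e2 := Finset.card_union_le T₁ T₂
    have e3 := Finset.card_union_le T₃ T₄
    omega
  have i1 : ∀ T₁ T₂ T₃ T₄ : Finset ℕ, T₁ ⊆ (T₁ ∪ T₂) ∪ (T₃ ∪ T₄) := fun T₁ T₂ T₃ T₄ =>
    Finset.subset_union_left.trans Finset.subset_union_left
  have i2 : ∀ T₁ T₂ T₃ T₄ : Finset ℕ, T₂ ⊆ (T₁ ∪ T₂) ∪ (T₃ ∪ T₄) := fun T₁ T₂ T₃ T₄ =>
    Finset.subset_union_right.trans Finset.subset_union_left
  have i3 : ∀ T₁ T₂ T₃ T₄ : Finset ℕ, T₃ ⊆ (T₁ ∪ T₂) ∪ (T₃ ∪ T₄) := fun T₁ T₂ T₃ T₄ =>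
    Finset.subset_union_left.trans Finset.subset_union_right
  have i4 : ∀ T₁ T₂ T₃ T₄ : Finset ℕ, T₄ ⊆ (T₁ ∪ T₂) ∪ (T₃ ∪ T₄) := fun T₁ T₂ T₃ T₄ =>
    Finset.subset_union_right.trans Finset.subset_union_right
  refine ⟨(X₁ ∪ X₂) ∪ (X₃ ∪ X₄), (Y₁ ∪ Y₂) ∪ (Y₃ ∪ Y₄), hcard _ _ _ _ cX₁ cX₂ cX₃ cX₄,
    hcard _ _ _ _ cY₁ cY₂ cY₃ cY₄, fun S hS S' hS' S'' hS'' s1 s2 s3 s4 s5 s6 => ⟨?_, ?_⟩⟩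
  · intro hne hind hnon
    by_cases hc : col α = col β
    · have hr : row α ≠ row β := fun hr => hne (hA.inj _ _ hc hr)
      refine hX₁ hr S hS S' hS' (s1.anti (i1 _ _ _ _)) (s3.anti (i1 _ _ _ _)) (fun h => hind ?_)
        hnon.swap
      exact ⟨h, (hA.sep_y hr).mono hS hS'⟩
    · refine hY₁ hc S hS S' hS' (s2.anti (i1 _ _ _ _)) (s4.anti (i1 _ _ _ _)) (fun h => hind ?_)
        hnon
      exact ⟨(hA.sep_x hc).mono hS hS', h⟩
  · intro hαβ hγβ hαγ
    by_contra! hcon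
    obtain ⟨n1, n2⟩ := hcon
    -- two distinct cells that interact share a row or a column
    have hshare : ∀ α γ : κ, ∀ S ⊆ A α, ∀ S' ⊆ A γ, α ≠ γ → ¬ Indep x y S S' →
        (col α ≠ col γ ∧ row α = row γ ∧ ¬ Sep y S S') ∨
        (row α ≠ row γ ∧ col α = col γ ∧ ¬ Sep x S S') := by
      intro α γ S hS S' hS' hne hind
      by_cases hc : col α = col γ
      · have hr : row α ≠ row γ := fun hr => hne (hA.inj _ _ hc hr)
        exact Or.inr ⟨hr, hc, fun h => hind ⟨h, (hA.sep_y hr).mono hS hS'⟩⟩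
      · by_cases hr : row α = row γ
        · exact Or.inl ⟨hc, hr, fun h => hind ⟨(hA.sep_x hc).mono hS hS', h⟩⟩
        · exact absurd ⟨(hA.sep_x hc).mono hS hS', (hA.sep_y hr).mono hS hS'⟩ hind
    have n2' : ¬ Indep x y S'' S' := fun h => n2 h.symm
    rcases hshare α β S hS S' hS' hαβ n1 with ⟨a1, a2, a3⟩ | ⟨a1, a2, a3⟩ <;>
      rcases hshare γ β S'' hS'' S' hS' hγβ n2' with ⟨b1, b2, b3⟩ | ⟨b1, b2, b3⟩
    · rcases hY₂ a1 b1 (fun h => hαγ (hA.inj _ _ h (a2.trans b2.symm))) S hS S' hS' S'' hS''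
        (s2.anti (i2 _ _ _ _)) (s4.anti (i2 _ _ _ _)) (s6.anti (i2 _ _ _ _)) with h | h
      · exact a3 h
      · exact b3 h.symm
    · rcases h₃ a1 a2 b1 b2 S hS S' hS' S'' hS'' (s2.anti (i3 _ _ _ _)) (s4.anti (i3 _ _ _ _))
        (s5.anti (i3 _ _ _ _)) with h | h
      · exact a3 h
      · exact b3 h.symm
    · rcases h₄ b1 b2 a1 a2 S'' hS'' S' hS' S hS (s6.anti (i4 _ _ _ _)) (s4.anti (i4 _ _ _ _))
        (s1.anti (i4 _ _ _ _)) with h | h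
      · exact b3 h
      · exact a3 h.symm
    · rcases hX₂ a1 b1 (fun h => hαγ (hA.inj _ _ (a2.trans b2.symm) h)) S hS S' hS' S'' hS''
        (s1.anti (i2 _ _ _ _)) (s3.anti (i2 _ _ _ _)) (s5.anti (i2 _ _ _ _)) with h | h
      · exact a3 h
      · exact b3 h.symm

end Lines

/-- A concentrated set can be split by boundedly many lines into boundedly many pairwise
independent pieces, up to boundedly many points. -/
theorem exists_split_list (q r b : ℕ) : ∃ (τ : Type) (_ : Fintype τ) (M : ℕ),
    ∀ {ι : Type} [DecidableEq ι] {x y : ι → ℕ} {A : Finset ι}, Conc x y q r A → Conc y x q r A →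
    ∀ ls : List (Bool × ℕ), ls.length ≤ b → ∃ P : τ → Finset ι, (∀ i, P i ⊆ A) ∧
      (∀ i j, i ≠ j → Indep x y (P i) (P j)) ∧
      (∀ i, ∀ l ∈ ls, OneSided (bif l.1 then x else y) l.2 (P i)) ∧
      (A.filter fun u => ∀ i, u ∉ P i).card ≤ M := by
  classical
  induction b with
  | zero =>
    refine ⟨Unit, inferInstance, 0, fun {ι} _ {x y A} _ _ ls hls => ⟨fun _ => A, ?_, ?_, ?_, ?_⟩⟩
    · exact fun _ => Finset.Subset.refl _
    · exact fun i j h => absurd rfl h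
    · intro i l hl
      rw [List.length_eq_zero_iff.1 (by omega : ls.length = 0)] at hl
      simp at hl
    · simp [Finset.filter_eq_empty_iff]
  | succ b ih =>
    obtain ⟨τ, _, M, h⟩ := ih
    refine ⟨τ × Fin q, inferInstance, M + r, fun {ι} _ {x y A} hx hy ls hls => ?_⟩
    obtain ⟨P, h1, h2, h3, h4⟩ := h hx hy ls.tail (by simp; omega)
    -- The old pieces are intersected with the concentration cover for one more line. The default
    -- line `(true, 0)` for an empty list only refines the pieces further.
    obtain ⟨Q, q1, q2, q3, q4⟩ : ∃ Q : Fin q → Finset ι, (∀ a, Q a ⊆ A) ∧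
        (∀ a b, a ≠ b → Indep x y (Q a) (Q b)) ∧
        (∀ a, OneSided (bif (ls.headD (true, 0)).1 then x else y) (ls.headD (true, 0)).2 (Q a)) ∧
        (A.filter fun i => ∀ a, i ∉ Q a).card ≤ r := by
      rcases hl : ls.headD (true, 0) with ⟨_ | _, L⟩
      · obtain ⟨Q, q1, q2, q3, q4⟩ := hy L
        exact ⟨Q, q1, fun a b hab => ⟨(q2 a b hab).2, (q2 a b hab).1⟩, q3, q4⟩
      · exact hx L
    refine ⟨fun i => P i.1 ∩ Q i.2, fun i => Finset.inter_subset_left.trans (h1 _), ?_, ?_, ?_⟩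
    · rintro ⟨i, a⟩ ⟨j, b⟩ hne
      by_cases hij : i = j
      · subst hij
        have hab : a ≠ b := fun h => hne (by rw [h])
        exact (q2 a b hab).mono Finset.inter_subset_right Finset.inter_subset_right
      · exact (h2 i j hij).mono Finset.inter_subset_left Finset.inter_subset_left
    · rintro ⟨i, a⟩ l hl
      rcases ls with _ | ⟨l', ls⟩
      · simp at hl
      · rcases List.mem_cons.1 hl with rfl | hl
        · exact (q3 a).mono Finset.inter_subset_right
        · exact (h3 i l hl).mono Finset.inter_subset_left
    · refine (Finset.card_le_card (t := (A.filter fun u => ∀ i, u ∉ P i) ∪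
        A.filter fun u => ∀ a, u ∉ Q a) ?_).trans ((Finset.card_union_le _ _).trans
        (Nat.add_le_add h4 q4))
      intro u hu
      simp only [Finset.mem_filter, Finset.mem_union, Finset.mem_inter, Prod.forall] at hu ⊢
      by_contra! hcon
      obtain ⟨c1, c2⟩ := hcon
      obtain ⟨i, hi⟩ := c1 hu.1
      obtain ⟨a, ha⟩ := c2 hu.1
      exact hu.2 i a ⟨hi, ha⟩

theorem exists_split (q r m : ℕ) : ∃ (τ : Type) (_ : Fintype τ) (M : ℕ),
    ∀ {ι : Type} [DecidableEq ι] {x y : ι → ℕ} {A : Finset ι}, Conc x y q r A → Conc y x q r A →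
    ∀ Tx Ty : Finset ℕ, Tx.card ≤ m → Ty.card ≤ m → ∃ P : τ → Finset ι, (∀ i, P i ⊆ A) ∧
      (∀ i j, i ≠ j → Indep x y (P i) (P j)) ∧
      (∀ i, Sliced x Tx (P i) ∧ Sliced y Ty (P i)) ∧
      (A.filter fun u => ∀ i, u ∉ P i).card ≤ M := by
  obtain ⟨τ, hτ, M, h⟩ := exists_split_list q r (m + m)
  refine ⟨τ, hτ, M, fun {ι} _ {x y A} hx hy Tx Ty hTx hTy => ?_⟩
  obtain ⟨P, h1, h2, h3, h4⟩ := h hx hy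
    (Tx.toList.map (fun c => (true, c)) ++ Ty.toList.map fun c => (false, c)) (by simp; omega)
  refine ⟨P, h1, h2, fun i => ⟨fun c hc => ?_, fun c hc => ?_⟩, h4⟩
  · exact h3 i (true, c) (by simp [hc])
  · exact h3 i (false, c) (by simp [hc])

/-! ### Counting decomposed permutations -/

/-- Hulls are half-open with endpoints at most `n`, leaving `(n + 1) ^ 2` possibilities; `(0, 0)`
serves the empty set. Describing membership by betweenness makes it directly contradict `Sep`. -/
theorem exists_hull {ι : Type} (f : ι → ℕ) (Q : Finset ι) (n : ℕ) (hf : ∀ i, f i < n) :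
    ∃ h : Fin (n + 1) × Fin (n + 1), ∀ v : ℕ, ((h.1 : ℕ) ≤ v ∧ v < h.2) ↔
      ∃ i ∈ Q, ∃ j ∈ Q, f i ≤ v ∧ v ≤ f j := by
  rcases Q.eq_empty_or_nonempty with rfl | hQ
  · exact ⟨(0, 0), fun v => by simp⟩
  obtain ⟨a, ha, ha'⟩ := Finset.exists_min_image Q f hQ
  obtain ⟨b, hb, hb'⟩ := Finset.exists_max_image Q f hQ
  refine ⟨(⟨f a, (hf a).trans (Nat.lt_succ_self n)⟩, ⟨f b + 1, Nat.succ_lt_succ (hf b)⟩),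
    fun v => ⟨fun h => ⟨a, ha, b, hb, h.1, Nat.lt_succ_iff.1 h.2⟩, ?_⟩⟩
  rintro ⟨i, hi, j, hj, h1, h2⟩
  have e1 := ha' i hi
  have e2 := hb' j hj
  exact ⟨e1.trans h1, Nat.lt_succ_iff.2 (h2.trans e2)⟩

theorem Sep.false_of_between {ι : Type} {f : ι → ℕ} {S T : Finset ι} (h : Sep f S T) {t : ι}
    (ht : t ∈ T) (hb : ∃ i ∈ S, ∃ j ∈ S, f i ≤ f t ∧ f t ≤ f j) : False := by
  obtain ⟨i, hi, j, hj, h1, h2⟩ := hb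
  rcases h with h | h
  · exact absurd (h j hj t ht) (not_lt.2 h2)
  · exact absurd (h i hi t ht) (not_lt.2 h1)

/-- Permutations with the same image of `S` and the same order on `S` agree on `S`. -/
theorem eqOn_of_image_eq {n : ℕ} {π π' : Equiv.Perm (Fin n)} {S : Finset (Fin n)}
    (himg : S.image π = S.image π')
    (hlt : ∀ i ∈ S, ∀ j ∈ S, π i < π j ↔ π' i < π' j) : ∀ i ∈ S, π i = π' i := by
  intro i hi
  have hcount : ∀ (ρ : Equiv.Perm (Fin n)), ((S.image ρ).filter fun v => v < ρ i).card =
      (S.filter fun j => ρ j < ρ i).card := by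
    intro ρ
    rw [Finset.filter_image, Finset.card_image_of_injective _ ρ.injective]
  have h1 := hcount π
  have h2 := hcount π'
  rw [Finset.filter_congr (fun j hj => hlt j hj i hi), ← h2, ← himg] at h1
  have hlt' : ∀ u ∈ S.image π, ∀ v, u < v → ((S.image π).filter fun w => w < u).card <
      ((S.image π).filter fun w => w < v).card := by
    intro u hu v huv
    refine Finset.card_lt_card ⟨fun w hw => ?_, fun hsub => ?_⟩
    · rw [Finset.mem_filter] at hw ⊢
      exact ⟨hw.1, hw.2.trans huv⟩
    · have := hsub (Finset.mem_filter.2 ⟨hu, huv⟩)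
      exact lt_irrefl _ (Finset.mem_filter.1 this).2
  have hm : π i ∈ S.image π := Finset.mem_image_of_mem _ hi
  have hm' : π' i ∈ S.image π := himg ▸ Finset.mem_image_of_mem _ hi
  rcases lt_trichotomy (π i) (π' i) with h | h | h
  · exact absurd (hlt' _ hm _ h) (by omega)
  · exact h
  · exact absurd (hlt' _ hm' _ h) (by omega)

theorem image_eq_of_mem_iff {n : ℕ} {π : Equiv.Perm (Fin n)} {S V : Finset (Fin n)}
    (h : ∀ i, i ∈ S ↔ π i ∈ V) : S.image π = V := by
  ext v
  rw [Finset.mem_image]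
  constructor
  · rintro ⟨i, hi, rfl⟩
    exact (h i).1 hi
  · intro hv
    exact ⟨π.symm v, (h _).2 (by simpa using hv), by simp⟩

/-- `π` is, up to `k` points, a union of pieces indexed by `Λ`; the pieces are grouped into
components by `Γ`, pieces of different components are independent, and the patterns of the
components belong to `W`. -/
def Decomposable (Λ Γ : Type) [Fintype Λ] (W : Set FinPerm) (k : ℕ) {n : ℕ}
    (π : Equiv.Perm (Fin n)) : Prop :=
  ∃ (Q : Λ → Finset (Fin n)) (g : Λ → Γ),
    (∀ a b, g a ≠ g b → Indep (fun i : Fin n => (i : ℕ)) (fun i => (π i : ℕ)) (Q a) (Q b)) ∧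
    (∃ E : Finset (Fin n), E.card ≤ k ∧ ∀ i, (∀ a, i ∉ Q a) → i ∈ E) ∧
    ∀ (c : Γ) (S : Finset (Fin n)), (∀ i, i ∈ S ↔ ∃ a, g a = c ∧ i ∈ Q a) →
      (⟨S.card, patternOn π S⟩ : FinPerm) ∈ W

/-- Hulls of the pieces, their components, and the remaining points. -/
abbrev Frame (Λ Γ : Type) (k n : ℕ) : Type :=
  ((Λ → Γ) × (Fin k → Option (Fin n × Fin n))) ×
    ((Λ → Fin (n + 1) × Fin (n + 1)) × (Λ → Fin (n + 1) × Fin (n + 1)))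

namespace Frame

variable {Λ Γ : Type} {k n : ℕ}

open Classical in
/-- The positions of the component `c`. -/
noncomputable def positions (δ : Frame Λ Γ k n) (c : Γ) : Finset (Fin n) :=
  Finset.univ.filter fun i => (∀ e v, δ.1.2 e ≠ some (i, v)) ∧
    ∃ a, δ.1.1 a = c ∧ ((δ.2.1 a).1 : ℕ) ≤ i ∧ (i : ℕ) < (δ.2.1 a).2

open Classical in
/-- The values of the component `c`. -/
noncomputable def values (δ : Frame Λ Γ k n) (c : Γ) : Finset (Fin n) :=
  Finset.univ.filter fun v => (∀ e i, δ.1.2 e ≠ some (i, v)) ∧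
    ∃ a, δ.1.1 a = c ∧ ((δ.2.2 a).1 : ℕ) ≤ v ∧ (v : ℕ) < (δ.2.2 a).2

/-- `δ` is a frame of `π`. -/
structure Fits (δ : Frame Λ Γ k n) (W : Set FinPerm) (π : Equiv.Perm (Fin n)) : Prop where
  point : ∀ e i v, δ.1.2 e = some (i, v) → π i = v
  cover : ∀ i, (∃ e v, δ.1.2 e = some (i, v)) ∨ ∃ c, i ∈ δ.positions c
  disj : ∀ c d, c ≠ d → Disjoint (δ.positions c) (δ.positions d)
  mem_iff : ∀ c i, i ∈ δ.positions c ↔ π i ∈ δ.values c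
  pattern : ∀ c, (⟨(δ.positions c).card, patternOn π (δ.positions c)⟩ : FinPerm) ∈ W

/-- The frame fixes the exceptional points and, for each component, its set of positions and its set
of values. All that is missing is the pattern of each component. -/
theorem Fits.eq {δ : Frame Λ Γ k n} {W : Set FinPerm} {π π' : Equiv.Perm (Fin n)}
    (h : δ.Fits W π) (h' : δ.Fits W π')
    (hp : ∀ c, patternOn π (δ.positions c) = patternOn π' (δ.positions c)) : π = π' := by
  ext i : 1
  rcases h.cover i with ⟨e, v, hv⟩ | ⟨c, hc⟩
  · rw [h.point e i v hv, h'.point e i v hv]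
  · refine eqOn_of_image_eq ?_ (fun i hi j hj => lt_iff_of_patternOn_eq (hp c) hi hj) i hc
    rw [image_eq_of_mem_iff (h.mem_iff c), image_eq_of_mem_iff (h'.mem_iff c)]

theorem card_positions_bounds [Fintype Γ] {δ : Frame Λ Γ k n} {W : Set FinPerm}
    {π : Equiv.Perm (Fin n)} (h : δ.Fits W π) :
    ∑ c, (δ.positions c).card ≤ n ∧ n ≤ ∑ c, (δ.positions c).card + k := by
  classical
  have hU : ∑ c, (δ.positions c).card = (Finset.univ.biUnion δ.positions).card :=
    (Finset.card_biUnion fun c _ d _ hcd => h.disj c d hcd).symm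
  constructor
  · rw [hU]
    simpa using Finset.card_le_univ (Finset.univ.biUnion δ.positions)
  · have hsub : (Finset.univ : Finset (Fin n)) ⊆ Finset.univ.biUnion δ.positions ∪
        (Finset.univ.image fun e => (δ.1.2 e).map Prod.fst).eraseNone := by
      intro i _
      rw [Finset.mem_union]
      rcases h.cover i with ⟨e, v, hv⟩ | ⟨c, hc⟩
      · right
        rw [Finset.mem_eraseNone, Finset.mem_image]
        exact ⟨e, Finset.mem_univ _, by rw [hv]; rfl⟩
      · left
        exact Finset.mem_biUnion.2 ⟨c, Finset.mem_univ _, hc⟩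
    have h1 := (Finset.card_le_card hsub).trans (Finset.card_union_le _ _)
    have h2 : (Finset.univ.image fun e => (δ.1.2 e).map Prod.fst).eraseNone.card ≤ k := by
      refine (Finset.card_eraseNone_le _).trans (Finset.card_image_le.trans ?_)
      simp
    rw [Finset.card_univ, Fintype.card_fin] at h1
    omega

end Frame

/-- The hulls of the pieces recover the components: a non-exceptional point in the hull of `Q a`
belongs to some piece, and that piece cannot be in another component since it would be separated
from `Q a` in both coordinates. -/
theorem Decomposable.exists_frame {Λ Γ : Type} [Fintype Λ] {W : Set FinPerm} {k n : ℕ}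
    {π : Equiv.Perm (Fin n)} (h : Decomposable Λ Γ W k π) :
    ∃ δ : Frame Λ Γ k n, δ.Fits W π := by
  classical
  obtain ⟨Q, g, hind, ⟨E₀, hE₀, hE₀'⟩, hW⟩ := h
  set E : Finset (Fin n) := Finset.univ.filter fun i => ∀ a, i ∉ Q a with hE
  have hmemE : ∀ i, i ∈ E ↔ ∀ a, i ∉ Q a := by simp [hE]
  have hEk : E.card ≤ k :=
    (Finset.card_le_card fun i hi => hE₀' i ((hmemE i).1 hi)).trans hE₀
  choose hx hhx using fun a => exists_hull (fun i : Fin n => (i : ℕ)) (Q a) n fun i => i.2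
  choose hy hhy using fun a => exists_hull (fun i : Fin n => (π i : ℕ)) (Q a) n fun i => (π i).2
  set pts : Fin k → Option (Fin n × Fin n) := fun e =>
    if h : (e : ℕ) < E.card then
      some (E.orderEmbOfFin rfl ⟨e, h⟩, π (E.orderEmbOfFin rfl ⟨e, h⟩)) else none with hpts
  have hpt : ∀ e i v, pts e = some (i, v) → i ∈ E ∧ π i = v := by
    intro e i v hev
    simp only [hpts] at hev
    split_ifs at hev with he
    simp only [Option.some.injEq, Prod.mk.injEq] at hev
    obtain ⟨rfl, rfl⟩ := hev
    exact ⟨Finset.orderEmbOfFin_mem _ _ _, rfl⟩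
  have hpt' : ∀ i ∈ E, ∃ e, pts e = some (i, π i) := by
    intro i hi
    have : i ∈ Set.range (E.orderEmbOfFin rfl) := by
      rw [Finset.range_orderEmbOfFin]; exact hi
    obtain ⟨e, rfl⟩ := this
    refine ⟨⟨e, e.2.trans_le hEk⟩, ?_⟩
    simp [hpts]
  have hpos : ∀ c i, i ∈ Frame.positions ((g, pts), (hx, hy)) c ↔ ∃ a, g a = c ∧ i ∈ Q a := by
    intro c i
    simp only [Frame.positions, Finset.mem_filter, Finset.mem_univ, true_and, hhx]
    constructor
    · rintro ⟨h1, a, rfl, h2⟩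
      have hiE : i ∉ E := fun hi => by
        obtain ⟨e, he⟩ := hpt' i hi
        exact h1 e _ he
      rw [hmemE] at hiE
      push Not at hiE
      obtain ⟨b, hb⟩ := hiE
      by_cases hab : g a = g b
      · exact ⟨b, hab.symm, hb⟩
      · exact ((hind a b hab).1.false_of_between hb h2).elim
    · rintro ⟨a, rfl, ha⟩
      refine ⟨fun e v he => (hmemE i).1 (hpt e i v he).1 a ha, a, rfl, i, ha, i, ha, le_rfl, le_rfl⟩
  have hval : ∀ c i, π i ∈ Frame.values ((g, pts), (hx, hy)) c ↔ ∃ a, g a = c ∧ i ∈ Q a := by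
    intro c i
    simp only [Frame.values, Finset.mem_filter, Finset.mem_univ, true_and, hhy]
    constructor
    · rintro ⟨h1, a, rfl, h2⟩
      have hiE : i ∉ E := fun hi => by
        obtain ⟨e, he⟩ := hpt' i hi
        exact h1 e _ he
      rw [hmemE] at hiE
      push Not at hiE
      obtain ⟨b, hb⟩ := hiE
      by_cases hab : g a = g b
      · exact ⟨b, hab.symm, hb⟩
      · exact ((hind a b hab).2.false_of_between hb h2).elim
    · rintro ⟨a, rfl, ha⟩
      refine ⟨fun e j he => ?_, a, rfl, i, ha, i, ha, le_rfl, le_rfl⟩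
      obtain ⟨h1, h2⟩ := hpt e j _ he
      rw [π.injective h2] at h1
      exact (hmemE i).1 h1 a ha
  refine ⟨((g, pts), (hx, hy)), ⟨fun e i v he => (hpt e i v he).2, fun i => ?_, fun c d hcd => ?_,
    fun c i => (hpos c i).trans (hval c i).symm, fun c => hW c _ (hpos c)⟩⟩
  · by_cases hi : i ∈ E
    · obtain ⟨e, he⟩ := hpt' i hi
      exact Or.inl ⟨e, _, he⟩
    · rw [hmemE] at hi
      push Not at hi
      obtain ⟨a, ha⟩ := hi
      exact Or.inr ⟨g a, (hpos _ _).2 ⟨a, rfl, ha⟩⟩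
  · rw [Finset.disjoint_left]
    intro i hi hi'
    obtain ⟨a, rfl, ha⟩ := (hpos _ _).1 hi
    obtain ⟨b, rfl, hb⟩ := (hpos _ _).1 hi'
    exact (hind a b hcd).1.ne ha hb rfl

theorem ncard_fits_le {Λ Γ : Type} [Fintype Λ] [Fintype Γ] {W : Set FinPerm} {k n : ℕ} {c ρ : ℝ}
    (hc : 1 ≤ c) (hρ : 0 < ρ)
    (hW : ∀ s, ({σ : Equiv.Perm (Fin s) | (⟨s, σ⟩ : FinPerm) ∈ W}.ncard : ℝ) ≤ c * ρ ^ s)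
    (δ : Frame Λ Γ k n) :
    ({π : Equiv.Perm (Fin n) | δ.Fits W π}.ncard : ℝ) ≤
      c ^ Fintype.card Γ * (max 1 ρ⁻¹) ^ k * ρ ^ n := by
  classical
  rcases Set.eq_empty_or_nonempty {π : Equiv.Perm (Fin n) | δ.Fits W π} with h0 | ⟨π₀, hπ₀⟩
  · rw [h0, Set.ncard_empty, Nat.cast_zero]
    positivity
  obtain ⟨hle, hge⟩ := Frame.card_positions_bounds hπ₀
  set F : ∀ d : Γ, Finset (Equiv.Perm (Fin (δ.positions d).card)) := fun d =>
    Finset.univ.filter fun σ => (⟨_, σ⟩ : FinPerm) ∈ W with hF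
  have h1 : {π : Equiv.Perm (Fin n) | δ.Fits W π}.ncard ≤ (Fintype.piFinset F).card := by
    rw [← Set.ncard_coe_finset]
    refine Set.ncard_le_ncard_of_injOn (fun π d => patternOn π (δ.positions d)) ?_ ?_
      (Set.toFinite _)
    · intro π hπ
      simp only [Finset.mem_coe, Fintype.mem_piFinset, hF, Finset.mem_filter, Finset.mem_univ,
        true_and]
      exact hπ.pattern
    · intro π hπ π' hπ' heq
      exact hπ.eq hπ' fun d => congrFun heq d
  rw [Fintype.card_piFinset] at h1
  have h2 : ((∏ d, (F d).card : ℕ) : ℝ) ≤ ∏ d, (c * ρ ^ (δ.positions d).card) := by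
    push_cast
    refine Finset.prod_le_prod (fun _ _ => Nat.cast_nonneg _) fun d _ => ?_
    have := hW (δ.positions d).card
    rwa [Set.ncard_eq_toFinset_card', Set.toFinset_ofPred] at this
  rw [Finset.prod_mul_distrib, Finset.prod_const, Finset.card_univ, Finset.prod_pow_eq_pow_sum]
    at h2
  refine (Nat.cast_le.2 h1).trans (h2.trans ?_)
  rw [mul_assoc]
  refine mul_le_mul_of_nonneg_left ?_ (by positivity)
  -- The components have total size `n - j`, where `j ≤ k` points are exceptional. The maximum with
  -- 1 covers the case `ρ < 1`, in which dropping points increases the power of `ρ`.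
  obtain ⟨j, hj⟩ := Nat.exists_eq_add_of_le hle
  have hjk : j ≤ k := by omega
  have hone : (1 : ℝ) ≤ max 1 ρ⁻¹ := le_max_left _ _
  calc ρ ^ ∑ d, (δ.positions d).card
      = ρ⁻¹ ^ j * ρ ^ n := by
        conv_rhs => rw [hj, pow_add, inv_pow]
        field_simp
    _ ≤ (max 1 ρ⁻¹) ^ j * ρ ^ n := by
        gcongr
        exact le_max_right _ _
    _ ≤ (max 1 ρ⁻¹) ^ k * ρ ^ n := by
        gcongr

/-- Each of the `k` exceptional slots has `n * n + 1 ≤ (n + 1) ^ 2` states, and each piece has two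
hulls with two endpoints each. -/
theorem card_frame_le (Λ Γ : Type) [Fintype Λ] [Fintype Γ] [DecidableEq Λ] (k n : ℕ) :
    Fintype.card (Frame Λ Γ k n) ≤
      Fintype.card Γ ^ Fintype.card Λ * (n + 1) ^ (2 * k + 4 * Fintype.card Λ) := by
  simp only [Fintype.card_prod, Fintype.card_fun, Fintype.card_fin, Fintype.card_option]
  have h : n * n + 1 ≤ (n + 1) ^ 2 := by nlinarith
  calc Fintype.card Γ ^ Fintype.card Λ * (n * n + 1) ^ k *
        (((n + 1) * (n + 1)) ^ Fintype.card Λ * ((n + 1) * (n + 1)) ^ Fintype.card Λ)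
      ≤ Fintype.card Γ ^ Fintype.card Λ * ((n + 1) ^ 2) ^ k *
        (((n + 1) * (n + 1)) ^ Fintype.card Λ * ((n + 1) * (n + 1)) ^ Fintype.card Λ) := by
        gcongr
    _ = _ := by
        generalize n + 1 = a
        ring

/-- For a fixed frame the component patterns have total length at most `n`, which allows a constant
times `ρ ^ n` permutations; there are only polynomially many frames. -/
theorem upperGrowthRate_le_of_decomposable (C : PermClass) (Λ Γ : Type) [Fintype Λ] [Fintype Γ]
    (W : Set FinPerm) (k : ℕ) {c ρ : ℝ} (hc : 1 ≤ c) (hρ : 0 < ρ)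
    (hW : ∀ s, ({σ : Equiv.Perm (Fin s) | (⟨s, σ⟩ : FinPerm) ∈ W}.ncard : ℝ) ≤ c * ρ ^ s)
    (hC : ∀ (n : ℕ) (π : Equiv.Perm (Fin n)), (⟨n, π⟩ : FinPerm) ∈ C.carrier →
      Decomposable Λ Γ W k π) :
    C.upperGrowthRate ≤ ENNReal.ofReal ρ := by
  classical
  refine upperGrowthRate_le C (2 * k + 4 * Fintype.card Λ)
    (Fintype.card Γ ^ Fintype.card Λ * (c ^ Fintype.card Γ * (max 1 ρ⁻¹) ^ k)) ρ hρ fun n => ?_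
  set B : ℝ := c ^ Fintype.card Γ * (max 1 ρ⁻¹) ^ k * ρ ^ n with hB
  have hB0 : 0 ≤ B := by positivity
  set Z : Frame Λ Γ k n → Finset (Equiv.Perm (Fin n)) := fun δ =>
    Finset.univ.filter fun π => δ.Fits W π with hZ
  have h1 : C.speed n ≤ (Finset.univ.biUnion Z).card := by
    unfold PermClass.speed
    rw [← Set.ncard_coe_finset]
    refine Set.ncard_le_ncard (fun π hπ => ?_) (Set.toFinite _)
    obtain ⟨δ, hδ⟩ := (hC n π hπ).exists_frame
    simp only [Finset.mem_coe, Finset.mem_biUnion, Finset.mem_univ, true_and, hZ,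
      Finset.mem_filter]
    exact ⟨δ, hδ⟩
  have h2 : ((Finset.univ.biUnion Z).card : ℝ) ≤ Fintype.card (Frame Λ Γ k n) * B := by
    calc ((Finset.univ.biUnion Z).card : ℝ) ≤ ((∑ δ, (Z δ).card : ℕ) : ℝ) :=
          Nat.cast_le.2 Finset.card_biUnion_le
      _ = ∑ δ, ((Z δ).card : ℝ) := by push_cast; rfl
      _ ≤ ∑ _δ : Frame Λ Γ k n, B := by
          refine Finset.sum_le_sum fun δ _ => ?_
          have := ncard_fits_le hc hρ hW δ
          rwa [Set.ncard_eq_toFinset_card', Set.toFinset_ofPred] at this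
      _ = _ := by rw [Finset.sum_const, Finset.card_univ, nsmul_eq_mul]
  have h3 : (Fintype.card (Frame Λ Γ k n) : ℝ) ≤
      Fintype.card Γ ^ Fintype.card Λ * (n + 1 : ℝ) ^ (2 * k + 4 * Fintype.card Λ) := by
    exact_mod_cast card_frame_le Λ Γ k n
  calc (C.speed n : ℝ) ≤ ((Finset.univ.biUnion Z).card : ℝ) := Nat.cast_le.2 h1
    _ ≤ Fintype.card (Frame Λ Γ k n) * B := h2
    _ ≤ (Fintype.card Γ ^ Fintype.card Λ * (n + 1 : ℝ) ^ (2 * k + 4 * Fintype.card Λ)) * B := by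
        gcongr
    _ = _ := by rw [hB]; ring

/-! ### Interleaved monotone pieces -/

/-- `S` is covered by two families of monotone pieces, such that all pieces are separated in the
coordinate `x`, and the pieces of each family are separated in the coordinate `y`. -/
def Interleaved (Λ : Type) {ι : Type} (x y : ι → ℕ) (S : Finset ι) : Prop :=
  ∃ Q : Bool × Λ → Finset ι, (∀ i ∈ S, ∃ c, i ∈ Q c) ∧ (∀ c d, c ≠ d → Sep x (Q c) (Q d)) ∧
    (∀ b i j, i ≠ j → Sep y (Q (b, i)) (Q (b, j))) ∧ ∀ c, ¬ NonMono x y (Q c)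

theorem Interleaved.pullback {Λ ι ι' : Type} [Fintype ι'] {x y : ι → ℕ} {S : Finset ι}
    (h : Interleaved Λ x y S) {x' y' : ι' → ℕ} (e : ι' → ι) (he : ∀ i, e i ∈ S)
    (hx : ∀ i j, x' i < x' j ↔ x (e i) < x (e j)) (hy : ∀ i j, y' i < y' j ↔ y (e i) < y (e j)) :
    Interleaved Λ x' y' Finset.univ := by
  classical
  obtain ⟨Q, h1, h2, h3, h4⟩ := h
  have hmem : ∀ c i, i ∈ Finset.univ.filter (fun i => e i ∈ Q c) ↔ e i ∈ Q c := by simp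
  have hsep : ∀ {f : ι → ℕ} {f' : ι' → ℕ}, (∀ i j, f' i < f' j ↔ f (e i) < f (e j)) → ∀ {c d},
      Sep f (Q c) (Q d) → Sep f' (Finset.univ.filter fun i => e i ∈ Q c)
        (Finset.univ.filter fun i => e i ∈ Q d) := by
    intro f f' hf c d hs
    refine hs.imp (fun hs s hs' t ht => ?_) fun hs s hs' t ht => ?_
    · exact (hf _ _).2 (hs _ ((hmem _ _).1 hs') _ ((hmem _ _).1 ht))
    · exact (hf _ _).2 (hs _ ((hmem _ _).1 hs') _ ((hmem _ _).1 ht))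
  refine ⟨fun c => Finset.univ.filter fun i => e i ∈ Q c, fun i _ => ?_,
    fun c d hcd => hsep hx (h2 c d hcd), fun b i j hij => hsep hy (h3 b i j hij), fun c hc => ?_⟩
  · obtain ⟨c, hc⟩ := h1 _ (he i)
    exact ⟨c, (hmem _ _).2 hc⟩
  · obtain ⟨⟨i, hi, j, hj, e1, e2⟩, k, hk, l, hl, e3, e4⟩ := hc
    exact h4 c ⟨⟨e i, (hmem _ _).1 hi, e j, (hmem _ _).1 hj, (hx _ _).1 e1, (hy _ _).1 e2⟩,
      e k, (hmem _ _).1 hk, e l, (hmem _ _).1 hl, (hx _ _).1 e3, (hy _ _).1 e4⟩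

/-- Hulls and directions of the pieces, and the values of one of the two families. -/
abbrev InterleavingFrame (Λ : Type) (n : ℕ) : Type :=
  ((Bool × Λ → Fin (n + 1) × Fin (n + 1)) × (Bool × Λ → Fin (n + 1) × Fin (n + 1))) ×
    (Finset (Fin n) × (Bool × Λ → Bool))

namespace InterleavingFrame

variable {Λ : Type} {n : ℕ}

open Classical in
/-- The positions of the piece `c`. -/
noncomputable def positions (δ : InterleavingFrame Λ n) (c : Bool × Λ) : Finset (Fin n) :=
  Finset.univ.filter fun i => ((δ.1.1 c).1 : ℕ) ≤ i ∧ (i : ℕ) < (δ.1.1 c).2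

open Classical in
/-- The values of the piece `c`. -/
noncomputable def values (δ : InterleavingFrame Λ n) (c : Bool × Λ) : Finset (Fin n) :=
  Finset.univ.filter fun v => (v ∈ δ.2.1 ↔ c.1 = true) ∧
    ((δ.1.2 c).1 : ℕ) ≤ v ∧ (v : ℕ) < (δ.1.2 c).2

/-- `δ` is a frame of `σ`. -/
structure Fits (δ : InterleavingFrame Λ n) (σ : Equiv.Perm (Fin n)) : Prop where
  cover : ∀ i, ∃ c, i ∈ δ.positions c
  mem_iff : ∀ c i, i ∈ δ.positions c ↔ σ i ∈ δ.values c
  lt_iff : ∀ c, ∀ i ∈ δ.positions c, ∀ j ∈ δ.positions c,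
    σ i < σ j ↔ if δ.2.2 c then i < j else j < i

theorem Fits.eq {δ : InterleavingFrame Λ n} {σ σ' : Equiv.Perm (Fin n)} (h : δ.Fits σ)
    (h' : δ.Fits σ') : σ = σ' := by
  ext i : 1
  obtain ⟨c, hc⟩ := h.cover i
  refine eqOn_of_image_eq ?_ (fun i hi j hj => ?_) i hc
  · rw [image_eq_of_mem_iff (h.mem_iff c), image_eq_of_mem_iff (h'.mem_iff c)]
  · rw [h.lt_iff c i hi j hj, h'.lt_iff c i hi j hj]

end InterleavingFrame

/-- Separation in `x` makes the position hulls of the pieces disjoint. The value hulls of the two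
families may overlap, but once it is known which values belong to the family `true`, separation in
`y` within a family identifies the values of each piece. A monotone piece is then given by its
direction. -/
theorem Interleaved.exists_frame {Λ : Type} {n : ℕ} {σ : Equiv.Perm (Fin n)}
    (h : Interleaved Λ (fun i : Fin n => (i : ℕ)) (fun i => (σ i : ℕ)) Finset.univ) :
    ∃ δ : InterleavingFrame Λ n, δ.Fits σ := by
  classical
  obtain ⟨Q, h1, h2, h3, h4⟩ := h
  choose hx hhx using fun a => exists_hull (fun i : Fin n => (i : ℕ)) (Q a) n fun i => i.2
  choose hy hhy using fun a => exists_hull (fun i : Fin n => (σ i : ℕ)) (Q a) n fun i => (σ i).2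
  have huniq : ∀ {c d i}, i ∈ Q c → i ∈ Q d → c = d := fun {c d i} hc hd => by
    by_contra hne
    exact (h2 c d hne).ne hc hd rfl
  set V : Finset (Fin n) := Finset.univ.filter fun v => ∃ j, σ.symm v ∈ Q (true, j) with hV
  have hmemV : ∀ {i c}, i ∈ Q c → (σ i ∈ V ↔ c.1 = true) := by
    intro i c hc
    simp only [hV, Finset.mem_filter, Finset.mem_univ, true_and, Equiv.symm_apply_apply]
    constructor
    · rintro ⟨j, hj⟩
      rw [huniq hc hj]
    · intro h
      exact ⟨c.2, by rw [← h]; exact hc⟩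
  have hdir : ∀ c, ∃ b : Bool, ∀ i ∈ Q c, ∀ j ∈ Q c, σ i < σ j ↔ if b then i < j else j < i := by
    intro c
    have h := h4 c
    rw [NonMono, not_and_or] at h
    push Not at h
    rcases h with h | h
    · refine ⟨false, fun i hi j hj => ?_⟩
      simp only [Bool.false_eq_true, if_false]
      constructor
      · intro hij
        rcases lt_trichotomy i j with h' | h' | h'
        · exact absurd (h i hi j hj h') (not_le.2 hij)
        · rw [h'] at hij; exact absurd hij (lt_irrefl _)
        · exact h'
      · intro hij
        refine lt_of_le_of_ne (h j hj i hi hij) fun heq => ?_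
        exact hij.ne' (σ.injective (Fin.ext (congrArg Fin.val heq)))
    · refine ⟨true, fun i hi j hj => ?_⟩
      simp only [if_true]
      constructor
      · intro hij
        rcases lt_trichotomy i j with h' | h' | h'
        · exact h'
        · rw [h'] at hij; exact absurd hij (lt_irrefl _)
        · exact absurd (h j hj i hi h') (not_le.2 hij)
      · intro hij
        refine lt_of_le_of_ne (h i hi j hj hij) fun heq => ?_
        exact hij.ne (σ.injective (Fin.ext (congrArg Fin.val heq)))
  choose τ hτ using hdir
  have hpos : ∀ c i, i ∈ InterleavingFrame.positions ((hx, hy), (V, τ)) c ↔ i ∈ Q c := by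
    intro c i
    simp only [InterleavingFrame.positions, Finset.mem_filter, Finset.mem_univ, true_and, hhx]
    constructor
    · intro h
      obtain ⟨d, hd⟩ := h1 i (Finset.mem_univ _)
      by_cases hcd : c = d
      · rwa [hcd]
      · exact ((h2 c d hcd).false_of_between hd h).elim
    · exact fun h => ⟨i, h, i, h, le_rfl, le_rfl⟩
  have hval : ∀ c i, σ i ∈ InterleavingFrame.values ((hx, hy), (V, τ)) c ↔ i ∈ Q c := by
    intro c i
    simp only [InterleavingFrame.values, Finset.mem_filter, Finset.mem_univ, true_and, hhy]
    constructor
    · rintro ⟨hb, h⟩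
      obtain ⟨d, hd⟩ := h1 i (Finset.mem_univ _)
      rw [hmemV hd] at hb
      have hcd : c.1 = d.1 := Bool.eq_iff_iff.2 hb.symm
      by_cases hcd' : c.2 = d.2
      · rwa [Prod.ext hcd hcd']
      · have := h3 c.1 c.2 d.2 hcd'
        refine (this.false_of_between (t := i) ?_ h).elim
        rw [hcd]
        exact hd
    · exact fun h => ⟨hmemV h, i, h, i, h, le_rfl, le_rfl⟩
  refine ⟨((hx, hy), (V, τ)), fun i => ?_, fun c i => (hpos c i).trans (hval c i).symm,
    fun c i hi j hj => hτ c i ((hpos c i).1 hi) j ((hpos c j).1 hj)⟩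
  obtain ⟨c, hc⟩ := h1 i (Finset.mem_univ _)
  exact ⟨c, (hpos c i).2 hc⟩

/-- The factor `2 ^ n` is the choice of the values of one family. The hulls contribute the
polynomial and the directions the constant. -/
theorem ncard_interleaved_le (Λ : Type) [Fintype Λ] (n : ℕ) :
    {σ : Equiv.Perm (Fin n) | Interleaved Λ (fun i : Fin n => (i : ℕ)) (fun i => (σ i : ℕ))
      Finset.univ}.ncard ≤
      2 ^ (2 * Fintype.card Λ) * (n + 1) ^ (8 * Fintype.card Λ) * 2 ^ n := by
  classical
  have hex : ∀ σ : Equiv.Perm (Fin n), ∃ δ : InterleavingFrame Λ n,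
      Interleaved Λ (fun i : Fin n => (i : ℕ)) (fun i => (σ i : ℕ)) Finset.univ → δ.Fits σ := by
    intro σ
    by_cases h : Interleaved Λ (fun i : Fin n => (i : ℕ)) (fun i => (σ i : ℕ)) Finset.univ
    · exact h.exists_frame.imp fun δ hδ _ => hδ
    · exact ⟨((fun _ => 0, fun _ => 0), (∅, fun _ => true)), fun h' => absurd h' h⟩
  choose δ hδ using hex
  have h1 := Set.ncard_le_ncard_of_injOn
    (s := {σ : Equiv.Perm (Fin n) | Interleaved Λ (fun i : Fin n => (i : ℕ)) (fun i => (σ i : ℕ))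
      Finset.univ}) (t := (Set.univ : Set (InterleavingFrame Λ n)))
    δ (fun σ _ => Set.mem_univ _)
    (fun σ hσ σ' hσ' heq => (hδ σ hσ).eq (heq ▸ hδ σ' hσ')) (Set.toFinite _)
  refine h1.trans (le_of_eq ?_)
  rw [Set.ncard_univ, Nat.card_eq_fintype_card]
  simp only [Fintype.card_prod, Fintype.card_fun, Fintype.card_fin, Fintype.card_finset,
    Fintype.card_bool]
  generalize n + 1 = a
  ring

theorem exists_interleaved_bound (Λ : Type) [Fintype Λ] {ρ : ℝ} (hρ : 2 < ρ) :
    ∃ c : ℝ, 1 ≤ c ∧ ∀ n : ℕ, ({σ : Equiv.Perm (Fin n) | Interleaved Λ (fun i : Fin n => (i : ℕ))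
      (fun i => (σ i : ℕ)) Finset.univ}.ncard : ℝ) ≤ c * ρ ^ n := by
  refine exists_bound_of_eventually_le (fun n => Nat.cast_nonneg _) (by linarith) ?_
  filter_upwards [eventually_poly_mul_pow_le (8 * Fintype.card Λ) (2 ^ (2 * Fintype.card Λ)) 2 ρ
    (by norm_num) hρ] with n hn
  refine le_trans ?_ hn
  exact_mod_cast ncard_interleaved_le Λ n

/-- Inversion of permutations exchanges the two coordinates. -/
theorem ncard_interleaved_swap (Λ : Type) (n : ℕ) :
    {σ : Equiv.Perm (Fin n) | Interleaved Λ (fun i => (σ i : ℕ)) (fun i : Fin n => (i : ℕ))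
      Finset.univ}.ncard ≤
    {σ : Equiv.Perm (Fin n) | Interleaved Λ (fun i : Fin n => (i : ℕ)) (fun i => (σ i : ℕ))
      Finset.univ}.ncard := by
  refine Set.ncard_le_ncard_of_injOn (fun σ => σ.symm) (fun σ hσ => ?_)
    (fun σ _ σ' _ h => Equiv.symm_bijective.injective h) (Set.toFinite _)
  have h : Interleaved Λ (fun i => (σ i : ℕ)) (fun i : Fin n => (i : ℕ)) Finset.univ := hσ
  exact h.pullback σ.symm (fun _ => Finset.mem_univ _) (fun i j => by simp) fun i j => by simp

/-! ### From griddings to systems of concentrated cells -/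

/-- For a line through `π`, the entries of a pattern below it form a lower set in the relevant
order, so their number is the height of the corresponding line through the pattern. This is how
concentration of the pattern is read in the original coordinates. -/
theorem val_lt_card_iff {s : ℕ} (ρ : Equiv.Perm (Fin s)) (p : Fin s → Prop) [DecidablePred p]
    (hp : ∀ a b, ρ a < ρ b → p b → p a) (a : Fin s) :
    (ρ a : ℕ) < (Finset.univ.filter p).card ↔ p a := by
  have hcard : ∀ v : Fin s, (Finset.univ.filter fun b => ρ b < v).card = v := by
    intro v
    have : (Finset.univ.filter fun b => ρ b < v).map ρ.toEmbedding = Finset.Iio v := by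
      ext w
      simp only [Finset.mem_map, Finset.mem_filter, Finset.mem_univ, true_and, Finset.mem_Iio]
      constructor
      · rintro ⟨b, hb, rfl⟩
        exact hb
      · intro hw
        exact ⟨ρ.symm w, by simpa using hw, by simp⟩
    rw [← Finset.card_map, this, Fin.card_Iio]
  constructor
  · intro h
    by_contra hpa
    have hsub : Finset.univ.filter p ⊆ Finset.univ.filter fun b => ρ b < ρ a := by
      intro b hb
      simp only [Finset.mem_filter, Finset.mem_univ, true_and] at hb ⊢
      rcases lt_trichotomy (ρ b) (ρ a) with h' | h' | h'
      · exact h'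
      · rw [ρ.injective h'] at hb
        exact absurd hb hpa
      · exact absurd (hp a b h' hb) hpa
    have := Finset.card_le_card hsub
    rw [hcard] at this
    omega
  · intro hpa
    rw [← hcard (ρ a)]
    refine Finset.card_lt_card ⟨fun b hb => ?_, fun hsub => ?_⟩
    · simp only [Finset.mem_filter, Finset.mem_univ, true_and] at hb ⊢
      exact hp b a hb hpa
    · have := hsub (by simpa using hpa : a ∈ Finset.univ.filter p)
      simp at this

theorem sep_of_disjoint_Ico {ι : Type} {f : ι → ℕ} {S T : Finset ι} {l r l' r' : ℕ}
    (h : Disjoint (Set.Ico l r) (Set.Ico l' r')) (hS : ∀ s ∈ S, l ≤ f s ∧ f s < r)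
    (hT : ∀ t ∈ T, l' ≤ f t ∧ f t < r') : Sep f S T := by
  rw [Set.Ico_disjoint_Ico, min_le_iff, le_max_iff, le_max_iff] at h
  rcases h with (h | h) | (h | h)
  · exact Or.inl fun s hs => by have := hS s hs; omega
  · exact Or.inl fun s hs t ht => by have := hS s hs; have := hT t ht; omega
  · exact Or.inr fun s hs t ht => by have := hS s hs; have := hT t ht; omega
  · exact Or.inl fun s _ t ht => by have := hT t ht; omega

/-- Transport of a cover of the pattern of `S` to `S`. -/
theorem exists_pieces_of_pattern {n : ℕ} {S : Finset (Fin n)} {q r L k : ℕ} {f g : Fin n → ℕ}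
    {f' g' : Fin S.card → ℕ}
    (hf : ∀ a b, f' a < f' b ↔ f (S.orderEmbOfFin rfl a) < f (S.orderEmbOfFin rfl b))
    (hg : ∀ a b, g' a < g' b ↔ g (S.orderEmbOfFin rfl a) < g (S.orderEmbOfFin rfl b))
    (hk : ∀ a, f' a < k ↔ f (S.orderEmbOfFin rfl a) < L) (T : Fin q → Finset (Fin S.card))
    (hT : ∀ a b, a ≠ b → Sep f' (T a) (T b) ∧ Sep g' (T a) (T b))
    (hside : ∀ a, OneSided f' k (T a))
    (hr : (Finset.univ.filter fun i => ∀ a, i ∉ T a).card ≤ r) :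
    ∃ P : Fin q → Finset (Fin n), (∀ a, P a ⊆ S) ∧
      (∀ a b, a ≠ b → Sep f (P a) (P b) ∧ Sep g (P a) (P b)) ∧ (∀ a, OneSided f L (P a)) ∧
      (S.filter fun i => ∀ a, i ∉ P a).card ≤ r := by
  set e := S.orderEmbOfFin rfl with he
  have hsep : ∀ {f : Fin n → ℕ} {f' : Fin S.card → ℕ}, (∀ a b, f' a < f' b ↔ f (e a) < f (e b)) →
      ∀ {U V : Finset (Fin S.card)}, Sep f' U V →
      Sep f (U.map e.toEmbedding) (V.map e.toEmbedding) := by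
    intro f f' hf U V h
    refine h.imp (fun h s hs t ht => ?_) fun h s hs t ht => ?_ <;>
    · obtain ⟨a, ha, rfl⟩ := Finset.mem_map.1 hs
      obtain ⟨b, hb, rfl⟩ := Finset.mem_map.1 ht
      exact (hf _ _).1 (h a ha b hb)
  refine ⟨fun a => (T a).map e.toEmbedding, ?_, ?_, ?_, ?_⟩
  · intro a i hi
    obtain ⟨b, -, rfl⟩ := Finset.mem_map.1 hi
    exact Finset.orderEmbOfFin_mem S rfl b
  · exact fun a b hab => ⟨hsep hf (hT a b hab).1, hsep hg (hT a b hab).2⟩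
  · intro a
    refine (hside a).imp (fun h i hi => ?_) fun h i hi => ?_
    · obtain ⟨b, hb, rfl⟩ := Finset.mem_map.1 hi
      exact (hk b).1 (h b hb)
    · obtain ⟨b, hb, rfl⟩ := Finset.mem_map.1 hi
      exact not_lt.1 fun hlt => absurd ((hk b).2 hlt) (not_lt.2 (h b hb))
  · refine le_trans ?_ hr
    rw [← Finset.card_map e.toEmbedding]
    refine Finset.card_le_card fun i hi => ?_
    obtain ⟨hiS, hi⟩ := Finset.mem_filter.1 hi
    have : i ∈ Set.range e := by rw [he, Finset.range_orderEmbOfFin]; exact hiS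
    obtain ⟨b, rfl⟩ := this
    refine Finset.mem_map_of_mem _ (Finset.mem_filter.2 ⟨Finset.mem_univ _, fun a ha => ?_⟩)
    exact hi a (Finset.mem_map_of_mem _ ha)

theorem conc_of_isConcentrated {n : ℕ} {π : Equiv.Perm (Fin n)} {S : Finset (Fin n)} {q r : ℕ}
    (h : FinPerm.IsConcentrated q r ⟨S.card, patternOn π S⟩) :
    Conc (fun i : Fin n => (i : ℕ)) (fun i => (π i : ℕ)) q r S ∧
      Conc (fun i => (π i : ℕ)) (fun i : Fin n => (i : ℕ)) q r S := by
  classical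
  have hx : ∀ a b : Fin S.card, (a : ℕ) < b ↔
      (S.orderEmbOfFin rfl a : ℕ) < S.orderEmbOfFin rfl b := fun a b =>
    (S.orderEmbOfFin rfl).lt_iff_lt.symm
  have hy : ∀ a b : Fin S.card, (patternOn π S a : ℕ) < patternOn π S b ↔
      (π (S.orderEmbOfFin rfl a) : ℕ) < π (S.orderEmbOfFin rfl b) := fun a b =>
    patternOn_lt_iff π S a b
  have hentries : ∀ (R : Rect) (b : Fin S.card), b ∈ R.entries (patternOn π S) →
      (R.left ≤ (b : ℕ) ∧ (b : ℕ) < R.right) ∧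
        (R.bottom ≤ (patternOn π S b : ℕ) ∧ (patternOn π S b : ℕ) < R.top) := by
    intro R b hb
    exact (Finset.mem_filter.1 hb).2
  constructor
  · intro L
    obtain ⟨R, hind, hmiss, hr⟩ :=
      (h (Finset.univ.filter fun a => (S.orderEmbOfFin rfl a : ℕ) < L).card).1
    refine exists_pieces_of_pattern hx hy
      (fun a => val_lt_card_iff 1 (fun a => (S.orderEmbOfFin rfl a : ℕ) < L) ?_ a)
      (fun a => (R a).entries (patternOn π S)) (fun a b hab => ⟨?_, ?_⟩) (fun a => ?_) hr
    · intro a b hab hb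
      exact ((hx a b).1 hab).trans hb
    · exact sep_of_disjoint_Ico (hind a b hab).1 (fun i hi => (hentries _ _ hi).1)
        fun i hi => (hentries _ _ hi).1
    · exact sep_of_disjoint_Ico (hind a b hab).2 (fun i hi => (hentries _ _ hi).2)
        fun i hi => (hentries _ _ hi).2
    · exact (hmiss a).imp (fun h i hi => (hentries _ _ hi).1.2.trans_le h)
        fun h i hi => h.trans (hentries _ _ hi).1.1
  · intro L
    obtain ⟨R, hind, hmiss, hr⟩ :=
      (h (Finset.univ.filter fun a => (π (S.orderEmbOfFin rfl a) : ℕ) < L).card).2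
    refine exists_pieces_of_pattern hy hx
      (fun a => val_lt_card_iff (patternOn π S)
        (fun a => (π (S.orderEmbOfFin rfl a) : ℕ) < L) ?_ a)
      (fun a => (R a).entries (patternOn π S)) (fun a b hab => ⟨?_, ?_⟩) (fun a => ?_) hr
    · intro a b hab hb
      exact ((hy a b).1 hab).trans hb
    · exact sep_of_disjoint_Ico (hind a b hab).2 (fun i hi => (hentries _ _ hi).2)
        fun i hi => (hentries _ _ hi).2
    · exact sep_of_disjoint_Ico (hind a b hab).1 (fun i hi => (hentries _ _ hi).1)
        fun i hi => (hentries _ _ hi).1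
    · exact (hmiss a).imp (fun h i hi => (hentries _ _ hi).2.2.trans_le h)
        fun h i hi => h.trans (hentries _ _ hi).2.1

theorem conc_empty {ι : Type} [DecidableEq ι] (f g : ι → ℕ) (q r : ℕ) : Conc f g q r ∅ :=
  fun _ => ⟨fun _ => ∅, fun _ => Finset.Subset.refl _, fun _ _ _ => ⟨Or.inl (by simp),
    Or.inl (by simp)⟩, fun _ => Or.inl (by simp), by simp⟩

theorem exists_division {t n : ℕ} (c : Fin (t + 1) → ℕ) (h0 : c 0 = 0) (hl : c (Fin.last t) = n)
    {k : ℕ} (hk : k < n) : ∃ i : Fin t, c i.castSucc ≤ k ∧ k < c i.succ := by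
  by_contra! h
  have : ∀ i : Fin (t + 1), c i ≤ k := by
    intro i
    induction i using Fin.induction with
    | zero => omega
    | succ i ih => exact h i ih
  have := this (Fin.last t)
  omega

theorem exists_cellSystem {G : PermClass} {q r : ℕ} (hG : ∀ π ∈ G.carrier, π.IsConcentrated q r)
    {t u : ℕ} {N : ℕ} {π : Equiv.Perm (Fin N)}
    (hπ : (⟨N, π⟩ : FinPerm) ∈ gridClass (fun (_ : Fin t) (_ : Fin u) => G)) :
    ∃ A : Fin t × Fin u → Finset (Fin N),
      CellSystem (fun i : Fin N => (i : ℕ)) (fun i => (π i : ℕ)) q r A (fun α => (α.1 : ℕ))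
        (fun α => (α.2 : ℕ)) ∧
      ∀ α, ∀ S ⊆ A α, S = ∅ ∨ (⟨S.card, patternOn π S⟩ : FinPerm) ∈ G.carrier := by
  obtain ⟨c, d, hg⟩ := hπ
  set A : Fin t × Fin u → Finset (Fin N) := fun α =>
    (Rect.mk (c α.1.castSucc) (c α.1.succ) (d α.2.castSucc) (d α.2.succ)).entries π with hA
  have hmem : ∀ α i, i ∈ A α ↔ (c α.1.castSucc ≤ (i : ℕ) ∧ (i : ℕ) < c α.1.succ) ∧
      (d α.2.castSucc ≤ (π i : ℕ) ∧ (π i : ℕ) < d α.2.succ) := by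
    intro α i
    simp [hA, Rect.entries]
  have hcell : ∀ α, A α = ∅ ∨ (⟨(A α).card, patternOn π (A α)⟩ : FinPerm) ∈ G.carrier :=
    fun α => hg.cell α.1 α.2 (A α) rfl
  have hconc : ∀ α, Conc (fun i : Fin N => (i : ℕ)) (fun i => (π i : ℕ)) q r (A α) ∧
      Conc (fun i => (π i : ℕ)) (fun i : Fin N => (i : ℕ)) q r (A α) := by
    intro α
    rcases hcell α with h | h
    · rw [h]
      exact ⟨conc_empty _ _ _ _, conc_empty _ _ _ _⟩
    · exact conc_of_isConcentrated (hG _ h)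
  refine ⟨A, ⟨fun i => ?_, ?_, ?_, ?_, fun α => (hconc α).1, fun α => (hconc α).2⟩, ?_⟩
  · obtain ⟨a, ha⟩ := exists_division c hg.col_first hg.col_last i.2
    obtain ⟨b, hb⟩ := exists_division d hg.row_first hg.row_last (π i).2
    exact ⟨(a, b), (hmem _ _).2 ⟨ha, hb⟩⟩
  · intro α β hαβ a ha b hb
    have h1 := ((hmem _ _).1 ha).1.2
    have h2 := ((hmem _ _).1 hb).1.1
    have h3 := hg.col_mono (show α.1.succ ≤ β.1.castSucc from Fin.le_def.2 (by simpa using hαβ))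
    exact (h1.trans_le h3).trans_le h2
  · intro α β hαβ a ha b hb
    have h1 := ((hmem _ _).1 ha).2.2
    have h2 := ((hmem _ _).1 hb).2.1
    have h3 := hg.row_mono (show α.2.succ ≤ β.2.castSucc from Fin.le_def.2 (by simpa using hαβ))
    exact (h1.trans_le h3).trans_le h2
  · exact fun α β h1 h2 => Prod.ext (Fin.ext h1) (Fin.ext h2)
  · intro α S hS
    rcases hcell α with h | h
    · left
      rw [h] at hS
      exact Finset.subset_empty.1 hS
    · exact Or.inr (G.down_closed _ _ (patternOn_containedIn_of_subset π hS) h)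

/-! ### Decompositions -/

/-- The intersection of two permutation classes. -/
def inter (C G : PermClass) : PermClass where
  carrier := C.carrier ∩ G.carrier
  down_closed σ π h hπ := ⟨C.down_closed σ π h hπ.1, G.down_closed σ π h hπ.2⟩

/-- The members of `D`, the empty permutation, and the interleavings of monotone pieces. -/
def withInterleavings (D : PermClass) (Λ : Type) : Set FinPerm :=
  {σ | σ.1 = 0 ∨ σ ∈ D.carrier ∨
    Interleaved Λ (fun i : Fin σ.1 => (i : ℕ)) (fun i => (σ.2 i : ℕ)) Finset.univ ∨
    Interleaved Λ (fun i => (σ.2 i : ℕ)) (fun i : Fin σ.1 => (i : ℕ)) Finset.univ}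

theorem card_leftover_le {κ τ : Type} [Fintype κ] {N M : ℕ} {A : κ → Finset (Fin N)}
    (hA : ∀ i, ∃ α, i ∈ A α) {P : κ → τ → Finset (Fin N)}
    (hP : ∀ α (s : Finset (Fin N)), (∀ u ∈ s, u ∈ A α ∧ ∀ i, u ∉ P α i) → s.card ≤ M) :
    ∃ E : Finset (Fin N), E.card ≤ Fintype.card κ * M ∧
      ∀ i, (∀ a : κ × τ, i ∉ P a.1 a.2) → i ∈ E := by
  classical
  refine ⟨Finset.univ.biUnion fun α => (A α).filter fun u => ∀ i, u ∉ P α i,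
    Finset.card_biUnion_le_card_mul _ _ _ fun α _ => hP α _ fun u hu => Finset.mem_filter.1 hu,
    fun i hi => ?_⟩
  obtain ⟨α, hα⟩ := hA i
  exact Finset.mem_biUnion.2 ⟨α, Finset.mem_univ _, Finset.mem_filter.2 ⟨hα, fun j => hi (α, j)⟩⟩

/-- Every piece is a component of its own, because the lines make pieces of different cells
independent. Patterns of length 0 are admitted separately, since an empty piece need not have its
pattern in `G`. -/
theorem decomposable_of_two_pow {C G : PermClass} {q r : ℕ}
    (hG : ∀ π ∈ G.carrier, π.IsConcentrated q r) {t u : ℕ}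
    (hCG : C.carrier ⊆ gridClass (fun (_ : Fin t) (_ : Fin u) => G)) {n : ℕ}
    (hn : (n + 1) ^ 2 * C.speed n < 2 ^ n) :
    ∃ (Λ : Type) (_ : Fintype Λ) (k : ℕ), ∀ (N : ℕ) (π : Equiv.Perm (Fin N)),
      (⟨N, π⟩ : FinPerm) ∈ C.carrier →
      Decomposable Λ Λ {σ | σ.1 = 0 ∨ σ ∈ (inter C G).carrier} k π := by
  classical
  set κ := Fin t × Fin u
  obtain ⟨τ, _, M, hsplit⟩ := exists_split q r (Fintype.card (κ × κ) * (2 * n))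
  refine ⟨κ × τ, inferInstance, Fintype.card κ * M, fun N π hπ => ?_⟩
  obtain ⟨A, hA, hAG⟩ := exists_cellSystem hG (hCG hπ)
  obtain ⟨Tx, Ty, hTx, hTy, hlines⟩ := exists_lines_indep hπ (Or.inl ⟨rfl, rfl⟩) hA hn
  choose P h1 h2 h3 h4 using fun α => hsplit (hA.concx α) (hA.concy α) Tx Ty hTx hTy
  refine ⟨fun a => P a.1 a.2, id, ?_, card_leftover_le hA.cover fun α s hs => ?_, ?_⟩
  · rintro ⟨α, i⟩ ⟨β, j⟩ hne
    by_cases hαβ : α = β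
    · subst hαβ
      exact h2 α i j fun h => hne (by rw [h])
    · exact hlines α β hαβ _ (h1 α i) _ (h1 β j) (h3 α i).1 (h3 α i).2 (h3 β j).1 (h3 β j).2
  · exact (Finset.card_le_card fun u hu => Finset.mem_filter.2 (hs u hu)).trans (h4 α)
  · rintro a S hS
    rcases hAG a.1 S (fun i hi => by
      obtain ⟨b, rfl, hb⟩ := (hS i).1 hi
      exact h1 _ _ hb) with h | h
    · exact Or.inl (by simp [h])
    · exact Or.inr ⟨C.down_closed _ _ (patternOn_containedIn π S) hπ, h⟩

/-- A piece that interacts with no other cell is its own component. Any other piece has a unique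
partner cell and is assigned to the unordered pair formed by its own cell and the partner; if two
pieces of different cells interact, each lies in the partner cell of the other, so they get the same
pair. -/
theorem decomposable_of_pellWords {C G : PermClass} {q r : ℕ}
    (hG : ∀ π ∈ G.carrier, π.IsConcentrated q r) {t u : ℕ}
    (hCG : C.carrier ⊆ gridClass (fun (_ : Fin t) (_ : Fin u) => G)) {n : ℕ}
    (hn : (n + 1) ^ 2 * C.speed n < (pellWords n).card) :
    ∃ (Λ Γ τ : Type) (_ : Fintype Λ) (_ : Fintype Γ) (_ : Fintype τ) (k : ℕ),
      ∀ (N : ℕ) (π : Equiv.Perm (Fin N)), (⟨N, π⟩ : FinPerm) ∈ C.carrier →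
      Decomposable Λ Γ (withInterleavings (inter C G) τ) k π := by
  classical
  set κ := Fin t × Fin u
  obtain ⟨m, hm⟩ := exists_lines_pairs q r n κ
  obtain ⟨τ, _, M, hsplit⟩ := exists_split q r m
  refine ⟨κ × τ, (κ × τ) ⊕ Sym2 κ, τ, inferInstance, inferInstance, inferInstance,
    Fintype.card κ * M, fun N π hπ => ?_⟩
  obtain ⟨A, hA, hAG⟩ := exists_cellSystem hG (hCG hπ)
  set x : Fin N → ℕ := fun i => (i : ℕ) with hx
  set y : Fin N → ℕ := fun i => (π i : ℕ) with hy
  obtain ⟨Tx, Ty, hTx, hTy, hlines⟩ := hm hπ (Or.inl ⟨rfl, rfl⟩) hA hn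
  choose P h1 h2 h3 h4 using fun α => hsplit (hA.concx α) (hA.concy α) Tx Ty hTx hTy
  have hpair : ∀ (a b : κ × τ), a.1 ≠ b.1 → ¬ Indep x y (P a.1 a.2) (P b.1 b.2) →
      ¬ NonMono x y (P a.1 a.2) := fun a b =>
    (hlines a.1 b.1 b.1 _ (h1 _ _) _ (h1 _ _) _ (h1 _ b.2) (h3 _ _).1 (h3 _ _).2 (h3 _ _).1
      (h3 _ _).2 (h3 _ _).1 (h3 _ _).2).1
  have htriple : ∀ (a b c : κ × τ), a.1 ≠ b.1 → c.1 ≠ b.1 → a.1 ≠ c.1 →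
      Indep x y (P a.1 a.2) (P b.1 b.2) ∨ Indep x y (P b.1 b.2) (P c.1 c.2) := fun a b c =>
    (hlines a.1 b.1 c.1 _ (h1 _ _) _ (h1 _ _) _ (h1 _ _) (h3 _ _).1 (h3 _ _).2 (h3 _ _).1
      (h3 _ _).2 (h3 _ _).1 (h3 _ _).2).2
  -- the cells that a piece interacts with
  set Part : κ × τ → κ → Prop := fun a β =>
    a.1 ≠ β ∧ ∃ j, ¬ Indep x y (P a.1 a.2) (P β j) with hPart
  have huniq : ∀ a β γ, Part a β → Part a γ → β = γ := by
    -- Two different partner cells would make `a` the middle of a forbidden triple.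
    rintro a β γ ⟨hβ, i, hi⟩ ⟨hγ, j, hj⟩
    by_contra hne
    rcases htriple (β, i) a (γ, j) hβ.symm hγ.symm hne with h | h
    · exact hi h.symm
    · exact hj h
  set g : κ × τ → (κ × τ) ⊕ Sym2 κ := fun a =>
    if h : ∃ β, Part a β then Sum.inr s(a.1, h.choose) else Sum.inl a with hg
  have hg_part : ∀ a β, Part a β → g a = Sum.inr s(a.1, β) := by
    intro a β h
    have hex : ∃ β, Part a β := ⟨β, h⟩
    simp only [hg, dif_pos hex]
    rw [huniq a _ _ hex.choose_spec h]
  have hg_inl : ∀ a b, g a = Sum.inl b → a = b := by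
    intro a b h
    simp only [hg] at h
    split_ifs at h
    exact Sum.inl_injective h
  have hg_inr : ∀ a α β, g a = Sum.inr s(α, β) →
      (a.1 = α ∧ Part a β) ∨ (a.1 = β ∧ Part a α) := by
    intro a α β h
    simp only [hg] at h
    split_ifs at h with hex
    have h' := Sum.inr_injective h
    have hspec := hex.choose_spec
    rw [Sym2.eq_iff] at h'
    rcases h' with ⟨e1, e2⟩ | ⟨e1, e2⟩
    · exact Or.inl ⟨e1, e2 ▸ hspec⟩
    · exact Or.inr ⟨e1, e2 ▸ hspec⟩
  have hW_sub : ∀ α, ∀ S ⊆ A α,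
      (⟨S.card, patternOn π S⟩ : FinPerm) ∈ withInterleavings (inter C G) τ := by
    intro α S hS
    rcases hAG α S hS with h | h
    · exact Or.inl (by simp [h])
    · exact Or.inr (Or.inl ⟨C.down_closed _ _ (patternOn_containedIn π S) hπ, h⟩)
  refine ⟨fun a => P a.1 a.2, g, ?_, card_leftover_le hA.cover fun α s hs => ?_, ?_⟩
  · intro a b hgab
    by_contra hind
    have hne : a.1 ≠ b.1 := by
      intro heq
      refine hind ?_
      have hab : a.2 ≠ b.2 := fun h => hgab (by rw [Prod.ext heq h])
      have := h2 a.1 a.2 b.2 hab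
      rw [show P a.1 b.2 = P b.1 b.2 by rw [heq]] at this
      exact this
    refine hgab ?_
    rw [hg_part a b.1 ⟨hne, b.2, hind⟩,
      hg_part b a.1 ⟨hne.symm, a.2, fun h => hind h.symm⟩, Sym2.eq_swap]
  · exact (Finset.card_le_card fun u hu => Finset.mem_filter.2 (hs u hu)).trans (h4 α)
  · rintro (b | p) S hS
    · refine hW_sub b.1 S fun i hi => ?_
      obtain ⟨a, ha, hia⟩ := (hS i).1 hi
      rw [hg_inl a b ha] at hia
      exact h1 _ _ hia
    · induction p using Sym2.ind with
      | _ α β =>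
      rcases S.eq_empty_or_nonempty with rfl | ⟨i₀, hi₀⟩
      · exact Or.inl (by simp)
      have hne : α ≠ β := by
        obtain ⟨a, ha, -⟩ := (hS i₀).1 hi₀
        rcases hg_inr a α β ha with ⟨rfl, h, -⟩ | ⟨rfl, h, -⟩
        · exact h
        · exact h.symm
      set δ : Bool → κ := fun b => bif b then α else β with hδ
      -- The Boolean selects the cell. Pieces of these two cells that belong to other components are
      -- replaced by the empty set, so that every remaining piece interacts with another cell and is
      -- therefore monotone.
      set Q : Bool × τ → Finset (Fin N) := fun c =>
        if g (δ c.1, c.2) = Sum.inr s(α, β) then P (δ c.1) c.2 else ∅ with hQ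
      have hQP : ∀ c, Q c ⊆ P (δ c.1) c.2 := by
        intro c
        simp only [hQ]
        split_ifs
        · exact Finset.Subset.refl _
        · exact Finset.empty_subset _
      have hcover : ∀ i ∈ S, ∃ c, i ∈ Q c := by
        intro i hi
        obtain ⟨a, ha, hia⟩ := (hS i).1 hi
        rcases hg_inr a α β ha with ⟨h, -⟩ | ⟨h, -⟩
        · refine ⟨(true, a.2), ?_⟩
          have hδa : (δ true, a.2) = a := Prod.ext h.symm rfl
          simp only [hQ, hδa, ha, if_true]
          rw [show δ true = a.1 from h.symm]
          exact hia
        · refine ⟨(false, a.2), ?_⟩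
          have hδa : (δ false, a.2) = a := Prod.ext h.symm rfl
          simp only [hQ, hδa, ha, if_true]
          rw [show δ false = a.1 from h.symm]
          exact hia
      have hmono : ∀ c, ¬ NonMono x y (Q c) := by
        intro c hc
        by_cases hgc : g (δ c.1, c.2) = Sum.inr s(α, β)
        · have hpart : ∃ γ, Part (δ c.1, c.2) γ := by
            rcases hg_inr _ α β hgc with ⟨-, h⟩ | ⟨-, h⟩
            · exact ⟨_, h⟩
            · exact ⟨_, h⟩
          obtain ⟨γ, hγ, j, hj⟩ := hpart
          exact hpair (δ c.1, c.2) (γ, j) hγ hj (hc.mono (hQP c))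
        · simp only [hQ, hgc, if_false] at hc
          obtain ⟨⟨i, hi, -⟩, -⟩ := hc
          simp at hi
      have hsame : ∀ b i j, i ≠ j → Indep x y (Q (b, i)) (Q (b, j)) := fun b i j hij =>
        (h2 (δ b) i j hij).mono (hQP (b, i)) (hQP (b, j))
      have hQA : ∀ c, Q c ⊆ A (δ c.1) := fun c => (hQP c).trans (h1 _ _)
      have hall : ∀ f : Fin N → ℕ, Sep f (A α) (A β) →
          (∀ b i j, i ≠ j → Sep f (Q (b, i)) (Q (b, j))) → ∀ c d, c ≠ d → Sep f (Q c) (Q d) := by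
        rintro f hf hf' ⟨b, i⟩ ⟨b', j⟩ hcd
        by_cases hb : b = b'
        · subst hb
          exact hf' b i j fun h => hcd (by rw [h])
        · have hsep : Sep f (A (δ b)) (A (δ b')) := by
            rcases b with _ | _ <;> rcases b' with _ | _
            · exact absurd rfl hb
            · exact hf.symm
            · exact hf
            · exact absurd rfl hb
          exact hsep.mono (hQA (b, i)) (hQA (b', j))
      have hex : ∀ a b : Fin S.card, (a : ℕ) < b ↔
          x (S.orderEmbOfFin rfl a) < x (S.orderEmbOfFin rfl b) := fun a b =>
        (S.orderEmbOfFin rfl).lt_iff_lt.symm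
      have hey : ∀ a b : Fin S.card, (patternOn π S a : ℕ) < patternOn π S b ↔
          y (S.orderEmbOfFin rfl a) < y (S.orderEmbOfFin rfl b) := fun a b =>
        patternOn_lt_iff π S a b
      -- Two cells in one column are in different rows, so that all pieces are separated in `y`, and
      -- the coordinates exchange their roles.
      by_cases hcol : (α.1 : ℕ) = β.1
      · have hrow : (α.2 : ℕ) ≠ β.2 := fun h => hne (hA.inj α β hcol h)
        have hint : Interleaved τ y x S := ⟨Q, hcover,
          hall y (hA.sep_y hrow) fun b i j hij => (hsame b i j hij).2,
          fun b i j hij => (hsame b i j hij).1, fun c hc => hmono c hc.swap⟩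
        exact Or.inr (Or.inr (Or.inr (hint.pullback (S.orderEmbOfFin rfl)
          (fun i => Finset.orderEmbOfFin_mem S rfl i) hey hex)))
      · have hint : Interleaved τ x y S := ⟨Q, hcover,
          hall x (hA.sep_x hcol) fun b i j hij => (hsame b i j hij).1,
          fun b i j hij => (hsame b i j hij).2, hmono⟩
        exact Or.inr (Or.inr (Or.inl (hint.pullback (S.orderEmbOfFin rfl)
          (fun i => Finset.orderEmbOfFin_mem S rfl i) hex hey)))

/-! ### Growth rates of griddable classes -/

theorem ncard_length_zero_le {ρ : ℝ} (hρ : 0 < ρ) (s : ℕ) :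
    ({_σ : Equiv.Perm (Fin s) | s = 0}.ncard : ℝ) ≤ ρ ^ s := by
  rcases Nat.eq_zero_or_pos s with rfl | hs
  · simp
  · have : {_σ : Equiv.Perm (Fin s) | s = 0} = ∅ := by
      ext σ
      simp [hs.ne']
    rw [this, Set.ncard_empty, Nat.cast_zero]
    positivity

theorem upperGrowthRate_le_of_two_pow {C G : PermClass} {q r : ℕ}
    (hG : ∀ π ∈ G.carrier, π.IsConcentrated q r) {t u : ℕ}
    (hCG : C.carrier ⊆ gridClass (fun (_ : Fin t) (_ : Fin u) => G)) {n : ℕ}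
    (hn : (n + 1) ^ 2 * C.speed n < 2 ^ n) :
    C.upperGrowthRate ≤ (inter C G).upperGrowthRate := by
  obtain ⟨Λ, _, k, hdec⟩ := decomposable_of_two_pow hG hCG hn
  refine le_of_forall_gt fun b hb => ?_
  obtain ⟨b', hb1, hb2⟩ := exists_between hb
  have hfin : b' ≠ ⊤ := (hb2.trans_le le_top).ne
  have hρ : 0 < b'.toReal := ENNReal.toReal_pos (bot_le.trans_lt hb1).ne' hfin
  rw [← ENNReal.ofReal_toReal hfin] at hb1 hb2
  obtain ⟨c, hc1, hc⟩ := exists_speed_le _ _ hρ hb1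
  refine lt_of_le_of_lt (upperGrowthRate_le_of_decomposable C Λ Λ _ k (c := 1 + c)
    (by linarith) hρ (fun s => ?_) hdec) hb2
  have hunion : {σ : Equiv.Perm (Fin s) | (⟨s, σ⟩ : FinPerm) ∈
      {σ : FinPerm | σ.1 = 0 ∨ σ ∈ (inter C G).carrier}} =
      {σ | s = 0} ∪ {σ | (⟨s, σ⟩ : FinPerm) ∈ (inter C G).carrier} := rfl
  rw [hunion]
  have h1 := Nat.cast_le (α := ℝ).2 (Set.ncard_union_le {_σ : Equiv.Perm (Fin s) | s = 0}
    {σ | (⟨s, σ⟩ : FinPerm) ∈ (inter C G).carrier})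
  push_cast at h1
  have h2 := ncard_length_zero_le hρ s
  have h3 : ({σ : Equiv.Perm (Fin s) | (⟨s, σ⟩ : FinPerm) ∈ (inter C G).carrier}.ncard : ℝ) ≤ _ :=
    hc s
  linarith

/-- The estimate is made for every `ρ` above the maximum. Requiring `ρ > 2` lets `ρ ^ n` absorb the
polynomial factor in the number of interleavings. -/
theorem upperGrowthRate_le_of_pellWords {C G : PermClass} {q r : ℕ}
    (hG : ∀ π ∈ G.carrier, π.IsConcentrated q r) {t u : ℕ}
    (hCG : C.carrier ⊆ gridClass (fun (_ : Fin t) (_ : Fin u) => G)) {n : ℕ}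
    (hn : (n + 1) ^ 2 * C.speed n < (pellWords n).card) :
    C.upperGrowthRate ≤ max (inter C G).upperGrowthRate 2 := by
  obtain ⟨Λ, Γ, τ, _, _, _, k, hdec⟩ := decomposable_of_pellWords hG hCG hn
  refine le_of_forall_gt fun b hb => ?_
  obtain ⟨b', hb1, hb2⟩ := exists_between hb
  have hfin : b' ≠ ⊤ := (hb2.trans_le le_top).ne
  have hρ : 0 < b'.toReal := ENNReal.toReal_pos (bot_le.trans_lt hb1).ne' hfin
  rw [← ENNReal.ofReal_toReal hfin] at hb1 hb2
  have hρ2 : 2 < b'.toReal := by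
    have h := (le_max_right _ _).trans_lt hb1
    rw [ENNReal.ofReal_toReal hfin] at h
    simpa using (ENNReal.toReal_lt_toReal (by simp) hfin).2 h
  obtain ⟨c, hc1, hc⟩ := exists_speed_le _ _ hρ ((le_max_left _ _).trans_lt hb1)
  obtain ⟨c', hc1', hc'⟩ := exists_interleaved_bound τ hρ2
  refine lt_of_le_of_lt (upperGrowthRate_le_of_decomposable C Λ Γ _ k (c := 1 + c + c' + c')
    (by linarith) hρ (fun s => ?_) hdec) hb2
  set Z : Set (Equiv.Perm (Fin s)) := {σ | s = 0} with hZ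
  set D : Set (Equiv.Perm (Fin s)) := {σ | (⟨s, σ⟩ : FinPerm) ∈ (inter C G).carrier} with hD
  set I : Set (Equiv.Perm (Fin s)) := {σ | Interleaved τ (fun i : Fin s => (i : ℕ))
    (fun i => (σ i : ℕ)) Finset.univ} with hI
  set J : Set (Equiv.Perm (Fin s)) := {σ | Interleaved τ (fun i => (σ i : ℕ))
    (fun i : Fin s => (i : ℕ)) Finset.univ} with hJ
  have hunion : {σ : Equiv.Perm (Fin s) | (⟨s, σ⟩ : FinPerm) ∈
      withInterleavings (inter C G) τ} = Z ∪ (D ∪ (I ∪ J)) := rfl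
  rw [hunion]
  have h1 : ((Z ∪ (D ∪ (I ∪ J))).ncard : ℝ) ≤ Z.ncard + (D.ncard + (I.ncard + J.ncard)) := by
    have e1 := Set.ncard_union_le Z (D ∪ (I ∪ J))
    have e2 := Set.ncard_union_le D (I ∪ J)
    have e3 := Set.ncard_union_le I J
    exact_mod_cast (by omega : (Z ∪ (D ∪ (I ∪ J))).ncard ≤
      Z.ncard + (D.ncard + (I.ncard + J.ncard)))
  have h2 : (Z.ncard : ℝ) ≤ _ := ncard_length_zero_le hρ s
  have h3 : (D.ncard : ℝ) ≤ _ := hc s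
  have h4 : (I.ncard : ℝ) ≤ _ := hc' s
  have h5 : (J.ncard : ℝ) ≤ I.ncard := Nat.cast_le.2 (ncard_interleaved_swap τ s)
  linarith

theorem exists_speed_lt_two_pow {C : PermClass} (h : C.lowerGrowthRate < 2) :
    ∃ n, (n + 1) ^ 2 * C.speed n < 2 ^ n := by
  by_contra! hcon
  refine absurd (le_lowerGrowthRate C 1 2 one_pos two_pos fun n => ?_) (not_le.2 (by simpa using h))
  rw [one_mul]
  exact_mod_cast hcon n

theorem exists_speed_lt_card_pellWords {C : PermClass}
    (h : C.lowerGrowthRate < ENNReal.ofReal (1 + √2)) :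
    ∃ n, (n + 1) ^ 2 * C.speed n < (pellWords n).card := by
  by_contra! hcon
  refine absurd (le_lowerGrowthRate C (1 / 2) (1 + √2) (by norm_num) (by positivity) fun n => ?_)
    (not_le.2 h)
  refine (le_card_pellWords n).trans ?_
  exact_mod_cast hcon n

end GridGrowth

theorem mainTheorem6 (C G : PermClass) (hG : Concentrated G.carrier) (hCG : Griddable C G)
    (hgr : C.lowerGrowthRate < ENNReal.ofReal (1 + √2)) :
    (∃ k : ℕ, C.HasGrowthRate (k : ℝ≥0∞)) ∨
      ∃ D : PermClass, D.carrier ⊆ G.carrier ∧ C.upperGrowthRate = D.upperGrowthRate := by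
  open GridGrowth in
  obtain ⟨q, r, hG⟩ := hG
  obtain ⟨t, u, hCG⟩ := hCG
  have hD : (inter C G).upperGrowthRate ≤ C.upperGrowthRate :=
    upperGrowthRate_mono Set.inter_subset_left
  rcases lt_or_ge C.lowerGrowthRate 2 with h2 | h2
  · obtain ⟨n, hn⟩ := exists_speed_lt_two_pow h2
    exact Or.inr ⟨inter C G, Set.inter_subset_right,
      (upperGrowthRate_le_of_two_pow hG hCG hn).antisymm hD⟩
  · obtain ⟨n, hn⟩ := exists_speed_lt_card_pellWords hgr
    have hle := upperGrowthRate_le_of_pellWords hG hCG hn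
    -- Either the bound is 2 and meets the lower growth rate, or it is the upper growth rate of the
    -- subclass `inter C G`.
    rcases le_total (inter C G).upperGrowthRate 2 with hD2 | hD2
    · rw [max_eq_right hD2] at hle
      have hlu := lowerGrowthRate_le_upperGrowthRate C
      exact Or.inl ⟨2, by simpa using (hlu.trans hle).antisymm h2,
        by simpa using hle.antisymm (h2.trans hlu)⟩
    · rw [max_eq_left hD2] at hle
      exact Or.inr ⟨inter C G, Set.inter_subset_right, hle.antisymm hD⟩
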